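/- **Setting.** Let $T>0$, $c\in\mathbb R$, and $g_0,g_1\in C^4([0,T])$ with $g_i(0)=g_i'(0)=0$. Fix constants $a_0,a_1,a_2,a_3>0$ and call $a:\mathbb R\to\mathbb R$ a *damping law* if $a\in W^{3,\infty}_{loc}(\mathbb R)$, $a(0)=0$, $a_0\le a'\le a_1$, $|a''|\le a_2$ and $|a'''|\le a_3$. For a damping law $a$ let the *state* $(p,u)$ be the classical solution, in $C^1([0,T];L^2(0,1)^2)\cap C([0,T];H^1(0,1)^2)$, of $$\partial_t p+\partial_x u=0,\qquad \partial_t u+\partial_x p+a(u)=0\qquad\text{in }(0,1)\times(0,T),$$ $$u(0,t)=g_0(t),\quad u(1,t)=g_1(t),\qquad p(x,0)=c,\quad u(x,0)=0.$$ Let $\underline u<\overline u$ be such that $\underline u\le u(x,t)\le\overline u$ on $[0,1]\times[0,T]$ for the states of all damping laws. Let $D(F)\subset H^2(\underline u,\overline u)$ be the set of restrictions of damping laws to $[\underline u,\overline u]$, and let $F:D(F)\to L^2(0,T)$, $F(a)=p(0,\cdot)-p(1,\cdot)$. For $a\in D(F)$ the derivative $F'(a):H^2(\underline u,\overline u)\to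 L^2(0,T)$ is the bounded linear operator that is a Fréchet derivative of $F$ at $a$ relative to $D(F)$ and that acts on every $b\in H^2(\underline u,\overline u)$ by $F'(a)b=r(0,\cdot)-r(1,\cdot)$, where $(r,w)$ is the classical solution (in the same class) of the sensitivity system $$\partial_t r+\partial_x w=0,\qquad \partial_t w+\partial_x r=-a'(u)w-b(u),\qquad r(x,0)=w(x,0)=w(0,t)=w(1,t)=0 .$$ **Lemma (adjoint representation).** Let $a$ be a damping law and let $\psi\in H^1(0,T)$ with $\psi(T)=0$. Then the state $(p,u)$, the operator $F'(a)$, and a classical solution $(q,v)\in C^1([0,T];L^2(0,1)^2)\cap C([0,T];H^1(0,1)^2)$ of the adjoint system $$\partial_t q+\partial_x v=0,\qquad \partial_t v+\partial_x q=a'(u)\,v\qquad\text{in }(0,1)\times(0,T),$$ $$v(0,t)=v(1,t)=\psi(t),\qquad q(x,T)=v(x,T)=0$$ exist, and for every such solution $(q,v)$ the following holds: an element $\phi\in H^2(\underline u,\overline u)$ equals $F'(a)^*\psi$, where $F'(a)^*:L^2(0,T)\to H^2(\underline u,\overline u)$ is the Hilbert space adjoint, if and only if $$(\phi,b)_{H^2(\underline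 u,\overline u)}=\int_0^T\big(b(u(t)),v(t)\big)_{L^2(0,1)}\,dt\qquad\text{for all }b\in H^2(\underline u,\overline u).$$ -/

import Mathlib

open MeasureTheory Set Filter Topology
open scoped ContDiff

noncomputable section

/-- The real Lebesgue space `L²(α, β)`. -/
abbrev L2 (α β : ℝ) : Type := Lp ℝ 2 (volume.restrict (Ioo α β))

/-- `g` is the weak derivative of `f` on the interval `(α, β)`. -/
def IsWeakDeriv {α β : ℝ} (f g : L2 α β) : Prop :=
  ∀ φ : ℝ → ℝ, ContDiff ℝ ∞ φ → HasCompactSupport φ → tsupport φ ⊆ Ioo α β →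
    ∫ x in Ioo α β, f x * deriv φ x = -∫ x in Ioo α β, g x * φ x

theorem L2.inner_test {α β : ℝ} {φ : ℝ → ℝ} (hφ : MemLp φ 2 (volume.restrict (Ioo α β)))
    (f : L2 α β) : inner ℝ (hφ.toLp φ) f = ∫ x in Ioo α β, f x * φ x := by
  rw [L2.inner_def]
  refine integral_congr_ae ?_
  filter_upwards [hφ.coeFn_toLp] with x hx
  simp [hx]

theorem memLp_test {α β : ℝ} {φ : ℝ → ℝ} (h : Continuous φ) (hc : HasCompactSupport φ) :
    MemLp φ 2 (volume.restrict (Ioo α β)) :=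
  h.memLp_of_hasCompactSupport hc

theorem isWeakDeriv_iff {α β : ℝ} (f g : L2 α β) :
    IsWeakDeriv f g ↔ ∀ φ : ℝ → ℝ, ∀ h : ContDiff ℝ ∞ φ, ∀ hc : HasCompactSupport φ,
      tsupport φ ⊆ Ioo α β →
        inner ℝ ((memLp_test (α := α) (β := β) (h.continuous_deriv (by simp)) hc.deriv).toLp
          (deriv φ)) f
        = -inner ℝ ((memLp_test (α := α) (β := β) h.continuous hc).toLp φ) g := by
  unfold IsWeakDeriv
  simp only [L2.inner_test]

/-- The Sobolev space `H^m(α, β)`: an element is the tuple `(f, f', …, f^(m))` of an `L²` function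
and its weak derivatives up to order `m`. As a subspace of the Hilbert sum of `m + 1` copies of
`L²(α, β)` it carries the usual inner product `∑_{j ≤ m} (f^(j), g^(j))_{L²}`. -/
def sobolevSubmodule (m : ℕ) (α β : ℝ) : Submodule ℝ (PiLp 2 (fun _ : Fin (m + 1) => L2 α β)) where
  carrier := {f | ∀ i : Fin m, IsWeakDeriv (f i.castSucc) (f i.succ)}
  add_mem' := by
    intro f g hf hg i
    have hf := (isWeakDeriv_iff _ _).1 (hf i)
    have hg := (isWeakDeriv_iff _ _).1 (hg i)
    refine (isWeakDeriv_iff _ _).2 fun φ h hc hs => ?_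
    simp only [PiLp.add_apply, inner_add_right, hf φ h hc hs, hg φ h hc hs]
    ring
  zero_mem' := by
    intro i
    refine (isWeakDeriv_iff _ _).2 fun φ h hc hs => ?_
    simp
  smul_mem' := by
    intro c f hf i
    have hf := (isWeakDeriv_iff _ _).1 (hf i)
    refine (isWeakDeriv_iff _ _).2 fun φ h hc hs => ?_
    simp only [PiLp.smul_apply, inner_smul_right, hf φ h hc hs]
    ring

theorem isClosed_sobolevSubmodule (m : ℕ) (α β : ℝ) :
    IsClosed (sobolevSubmodule m α β : Set (PiLp 2 (fun _ : Fin (m + 1) => L2 α β))) := by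
  have : (sobolevSubmodule m α β : Set (PiLp 2 (fun _ : Fin (m + 1) => L2 α β)))
      = {f | ∀ i : Fin m, IsWeakDeriv (f i.castSucc) (f i.succ)} := rfl
  rw [this]
  simp only [isWeakDeriv_iff, Set.ofPred_forall]
  refine isClosed_iInter fun i => isClosed_iInter fun φ => isClosed_iInter fun h =>
    isClosed_iInter fun hc => isClosed_iInter fun _ => isClosed_eq ?_ ?_
  · exact continuous_const.inner (PiLp.continuous_apply 2 _ _)
  · exact (continuous_const.inner (PiLp.continuous_apply 2 _ _)).neg

/-- The Sobolev space `H^m(α, β)` as a real Hilbert space. -/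
abbrev Sobolev (m : ℕ) (α β : ℝ) : Type := sobolevSubmodule m α β

instance (m : ℕ) (α β : ℝ) : CompleteSpace (Sobolev m α β) :=
  (isClosed_sobolevSubmodule m α β).completeSpace_coe

namespace Sobolev

variable {m : ℕ} {α β : ℝ}

/-- The underlying `L²` function. -/
def toL2 (f : Sobolev m α β) : L2 α β := f.1 0

/-- The weak derivative of an `H¹` function. -/
def dx (f : Sobolev 1 α β) : L2 α β := f.1 1

open Classical in
/-- Point values: the representative that is continuous on `[α, β]`; for `m ≥ 1` and `α < β` it
exists and is unique on `[α, β]`. -/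
def ev (f : Sobolev m α β) : ℝ → ℝ :=
  if h : ∃ g : ℝ → ℝ, ContinuousOn g (Icc α β) ∧ f.toL2 =ᵐ[volume.restrict (Ioo α β)] g
  then h.choose else 0

end Sobolev

/-- `(p, u)` is a classical solution, in `C¹([0,T]; L² × L²) ∩ C([0,T]; H¹ × H¹)`, of
`∂ₜ p + ∂ₓ u = 0`, `∂ₜ u + ∂ₓ p + σ(t, x, u(x,t)) = 0` on `(0,1) × [0,T]` with the boundary
conditions `u(0,t) = γ₀(t)`, `u(1,t) = γ₁(t)`. Here `p t` stands for the function `p(·,t)`. -/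
structure IsClassicalSolution (T : ℝ) (σ : ℝ → ℝ → ℝ → ℝ) (γ₀ γ₁ : ℝ → ℝ)
    (p u : ℝ → Sobolev 1 0 1) : Prop where
  continuousOn_p : ContinuousOn p (Icc 0 T)
  continuousOn_u : ContinuousOn u (Icc 0 T)
  contDiffOn_p : ContDiffOn ℝ 1 (fun t => (p t).toL2) (Icc 0 T)
  contDiffOn_u : ContDiffOn ℝ 1 (fun t => (u t).toL2) (Icc 0 T)
  mass : ∀ t ∈ Icc 0 T, derivWithin (fun s => (p s).toL2) (Icc 0 T) t + (u t).dx = 0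
  momentum : ∀ t ∈ Icc 0 T, ∀ᵐ x ∂(volume.restrict (Ioo (0 : ℝ) 1)),
    derivWithin (fun s => (u s).toL2) (Icc 0 T) t x + (p t).dx x + σ t x ((u t).ev x) = 0
  left : ∀ t ∈ Icc 0 T, (u t).ev 0 = γ₀ t
  right : ∀ t ∈ Icc 0 T, (u t).ev 1 = γ₁ t

/-- `h ∈ L²(0,T)` is the pressure drop `t ↦ p(0,t) - p(1,t)`. -/
def IsPressureDrop {T : ℝ} (p : ℝ → Sobolev 1 0 1) (h : L2 0 T) : Prop :=
  h =ᵐ[volume.restrict (Ioo 0 T)] fun t => (p t).ev 0 - (p t).ev 1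

/-- The fixed data: time horizon `T`, initial pressure `c`, boundary fluxes `g₀, g₁`, the bounds
`a₀, …, a₃` for the damping laws, and the interval `[lo, hi]` on which damping laws are
considered. -/
structure PipeData where
  T : ℝ
  c : ℝ
  g₀ : ℝ → ℝ
  g₁ : ℝ → ℝ
  a₀ : ℝ
  a₁ : ℝ
  a₂ : ℝ
  a₃ : ℝ
  lo : ℝ
  hi : ℝ

namespace PipeData

variable (D : PipeData)

/-- Parameter space `H²(lo, hi)`. -/
abbrev H2 : Type := Sobolev 2 D.lo D.hi

/-- Damping laws: `a ∈ W^{3,∞}_loc(ℝ)` (that is, `a ∈ C²` with locally Lipschitz `a''`), `a(0) = 0`,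
`a₀ ≤ a' ≤ a₁`, `|a''| ≤ a₂` and `|a'''| ≤ a₃` almost everywhere. -/
structure IsDampingLaw (a : ℝ → ℝ) : Prop where
  contDiff : ContDiff ℝ 2 a
  locallyLipschitz : LocallyLipschitz (iteratedDeriv 2 a)
  zero : a 0 = 0
  deriv_mem : ∀ ξ, deriv a ξ ∈ Icc D.a₀ D.a₁
  abs_deriv2_le : ∀ ξ, |iteratedDeriv 2 a ξ| ≤ D.a₂
  abs_deriv3_le : ∀ᵐ ξ, |iteratedDeriv 3 a ξ| ≤ D.a₃

/-- `(p, u)` is the state for the damping law `a`, started at rest: `p(x,0) = c`, `u(x,0) = 0`. -/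
def IsState (a : ℝ → ℝ) (p u : ℝ → Sobolev 1 0 1) : Prop :=
  IsClassicalSolution D.T (fun _ _ y => a y) D.g₀ D.g₁ p u ∧
    ∀ x ∈ Icc (0 : ℝ) 1, (p 0).ev x = D.c ∧ (u 0).ev x = 0

/-- Standing assumptions on the data; the last one says that `[lo, hi]` contains all values of the
velocities that belong to damping laws with the given bounds. -/
structure Admissible : Prop where
  T_pos : 0 < D.T
  a₀_pos : 0 < D.a₀
  a₁_pos : 0 < D.a₁
  a₂_pos : 0 < D.a₂
  a₃_pos : 0 < D.a₃
  lo_lt_hi : D.lo < D.hi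
  contDiffOn_g₀ : ContDiffOn ℝ 4 D.g₀ (Icc 0 D.T)
  contDiffOn_g₁ : ContDiffOn ℝ 4 D.g₁ (Icc 0 D.T)
  g₀_zero : D.g₀ 0 = 0
  g₁_zero : D.g₁ 0 = 0
  deriv_g₀_zero : derivWithin D.g₀ (Icc 0 D.T) 0 = 0
  deriv_g₁_zero : derivWithin D.g₁ (Icc 0 D.T) 0 = 0
  velocity_mem : ∀ a, D.IsDampingLaw a → ∀ p u, D.IsState a p u →
    ∀ t ∈ Icc 0 D.T, ∀ x ∈ Icc (0 : ℝ) 1, (u t).ev x ∈ Icc D.lo D.hi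

/-- `A ∈ H²(lo, hi)` is the restriction to `[lo, hi]` of the function `a`. -/
def IsRestriction (a : ℝ → ℝ) (A : D.H2) : Prop := EqOn A.ev a (Icc D.lo D.hi)

/-- `D(F)`: the elements of `H²(lo, hi)` that are restrictions of damping laws. -/
def forwardDomain : Set D.H2 := {A | ∃ a, D.IsDampingLaw a ∧ D.IsRestriction a A}

open Classical in
/-- The forward operator `F`, mapping a damping law to the pressure drop of its state. -/
def forward (A : D.H2) : L2 0 D.T :=
  if h : ∃ y : L2 0 D.T, ∃ a p u, D.IsDampingLaw a ∧ D.IsRestriction a A ∧ D.IsState a p u ∧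
    IsPressureDrop p y
  then h.choose else 0

/-- `(r, w)` solves the sensitivity system in direction `b` at the damping law `a` with velocity
`u`: `∂ₜ r + ∂ₓ w = 0`, `∂ₜ w + ∂ₓ r = -a'(u) w - b(u)`, homogeneous initial and boundary values. -/
def IsSensitivity (a : ℝ → ℝ) (u : ℝ → Sobolev 1 0 1) (b : D.H2) (r w : ℝ → Sobolev 1 0 1) :
    Prop :=
  IsClassicalSolution D.T (fun t x y => deriv a ((u t).ev x) * y + b.ev ((u t).ev x)) 0 0 r w ∧
    r 0 = 0 ∧ w 0 = 0

/-- The bounded operator `L : H²(lo, hi) → L²(0,T)` is the derivative `F'(A)`: it is a Fréchet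
derivative of `F` on `D(F)` at `A`, and in every direction `b ∈ H²(lo, hi)`, also in those that are
not tangent to `D(F)`, it is given by the sensitivity system, `L b = r(0,·) - r(1,·)`. -/
def IsForwardDeriv (A : D.H2) (L : D.H2 →L[ℝ] L2 0 D.T) : Prop :=
  HasFDerivWithinAt D.forward L D.forwardDomain A ∧
    ∀ a, D.IsDampingLaw a → D.IsRestriction a A → ∀ p u, D.IsState a p u → ∀ b : D.H2,
      (∃ r w, D.IsSensitivity a u b r w) ∧
        ∀ r w, D.IsSensitivity a u b r w → IsPressureDrop r (L b)

open Classical in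
/-- The derivative `F'(A)`. -/
def forwardDeriv (A : D.H2) : D.H2 →L[ℝ] L2 0 D.T :=
  if h : ∃ L, D.IsForwardDeriv A L then h.choose else 0

/-- `(q, v)` solves the adjoint system `∂ₜ q + ∂ₓ v = 0`, `∂ₜ v + ∂ₓ q = a'(u) v` with
`q(·,T) = v(·,T) = 0` and `v(0,t) = v(1,t) = ψ(t)`. -/
def IsAdjointState (a : ℝ → ℝ) (u : ℝ → Sobolev 1 0 1) (ψ : Sobolev 1 0 D.T)
    (q v : ℝ → Sobolev 1 0 1) : Prop :=
  IsClassicalSolution D.T (fun t x y => -(deriv a ((u t).ev x) * y)) ψ.ev ψ.ev q v ∧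
    q D.T = 0 ∧ v D.T = 0

end PipeData

end

noncomputable section

open scoped BoundedContinuousFunction NNReal

/-! ### Primitives of `L²` functions on an interval -/

namespace L2

variable {α β : ℝ}

/-! The representation itself is a duality computation. For a sensitivity solution `(r, w)` and an
adjoint solution `(q, v)`, the time derivative of `(r, q) + (w, v)` is `ψ(t) (r(0,t) - r(1,t)) -
(b(u), v)`: the damping terms `a'(u) w v` cancel, and integration by parts in `x` leaves boundary
terms in which `w = 0` and `v = ψ`. The pairing vanishes at `t = 0` and at `t = T`, so integration
gives `(ψ, F'(a) b) = ∫ (b(u), v) dt` for every `b` (`IsAdjointState.inner_eq`). Since an element of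
a Hilbert space is determined by its inner products, both directions follow.

Most of the work is existence of the objects involved. State, sensitivity and adjoint solutions all
come from `BoundaryLift.exists_isWave`. Travelling waves lift the boundary data, so that the
remaining velocity vanishes at both ends. Even reflection of the pressure and odd reflection of the
velocity to a circle of length two then turn the wave operator into `∂ₜ + ∂ₓ`. The system is
differentiated in time and viewed in the moving frame, which leaves an ordinary differential
equation in `L²` of the circle; Picard–Lindelöf and Gronwall solve it on all of `[0, T]`.
Integration in time recovers pressure and velocity, and testing with even and odd functions recovers
spatial derivatives and boundary values.

Differentiability of `F` rests on `IsWave.exists_bound`: an energy estimate, together with the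
multiplier `(x - 1/2) p`, bounds the solution and its pressure drop by the source. Applied to
differences it gives uniqueness, Lipschitz dependence and boundedness of the sensitivity map.
Applied to the second-order remainder, with an interpolation inequality, it gives an error of order
`‖b‖ ^ (3/2)` for small `b` (`forward_remainder_le`). -/

theorem integrableOn (g : L2 α β) : IntegrableOn g (Ioo α β) :=
  (Lp.memLp g).integrable (by norm_num)

theorem integrable_indicator (g : L2 α β) : Integrable ((Ioo α β).indicator g) :=
  (integrableOn g).integrable_indicator measurableSet_Ioo

/-- The primitive of `g` that vanishes at `α`. -/
def prim (g : L2 α β) (x : ℝ) : ℝ := ∫ s in α..x, (Ioo α β).indicator g s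

theorem continuous_prim (g : L2 α β) : Continuous (prim g) :=
  intervalIntegral.continuous_primitive
    (fun _ _ => (integrable_indicator g).intervalIntegrable) α

@[simp] theorem prim_left (g : L2 α β) : prim g α = 0 := by simp [prim]

theorem prim_congr {f g : ℝ → ℝ} (h : f =ᵐ[volume.restrict (Ioo α β)] g) (x : ℝ) :
    ∫ s in α..x, (Ioo α β).indicator f s = ∫ s in α..x, (Ioo α β).indicator g s := by
  have : (Ioo α β).indicator f =ᵐ[volume] (Ioo α β).indicator g := by
    filter_upwards [(ae_restrict_iff' measurableSet_Ioo).1 h] with s hs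
    by_cases hm : s ∈ Ioo α β
    · simp [hm, hs hm]
    · simp [hm]
  exact intervalIntegral.integral_congr_ae (this.mono fun x hx _ => hx)

theorem prim_add (f g : L2 α β) (x : ℝ) : prim (f + g) x = prim f x + prim g x := by
  unfold prim
  rw [prim_congr (Lp.coeFn_add f g), indicator_add']
  exact intervalIntegral.integral_add (integrable_indicator f).intervalIntegrable
    (integrable_indicator g).intervalIntegrable

theorem prim_smul (c : ℝ) (g : L2 α β) (x : ℝ) : prim (c • g) x = c * prim g x := by
  unfold prim
  rw [prim_congr (Lp.coeFn_smul c g), ← intervalIntegral.integral_const_mul]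
  congr 1
  ext s
  by_cases hs : s ∈ Ioo α β <;> simp [hs]

theorem integral_Ioo_mul (f g : L2 α β) : ∫ x in Ioo α β, f x * g x = inner ℝ f g := by
  rw [L2.inner_def]
  simp [mul_comm]

/-- Cauchy–Schwarz against the constant function 1. The order of `α` and `β` is irrelevant: for `β <
α` the measure and the square root both vanish. -/
theorem integral_abs_le (g : L2 α β) :
    ∫ x in Ioo α β, |g x| ≤ √(β - α) * ‖g‖ := by
  have h1 : MemLp (fun _ : ℝ => (1 : ℝ)) 2 (volume.restrict (Ioo α β)) := memLp_const 1
  have h2 : MemLp (fun x => |g x|) 2 (volume.restrict (Ioo α β)) := (Lp.memLp g).abs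
  have e : ∫ x in Ioo α β, |g x| = inner ℝ (h1.toLp _) (h2.toLp _) := by
    rw [L2.inner_def]
    refine integral_congr_ae ?_
    filter_upwards [h1.coeFn_toLp, h2.coeFn_toLp] with x hx hy
    rw [hx, hy]
    simp
  have n2 : ‖h2.toLp _‖ = ‖g‖ := by
    refine le_antisymm (Lp.norm_le_norm_of_ae_le ?_) (Lp.norm_le_norm_of_ae_le ?_) <;>
    · filter_upwards [h2.coeFn_toLp] with x hx
      simp [hx]
  have n1 : ‖h1.toLp _‖ = √(β - α) := by
    have : ‖h1.toLp _‖ * ‖h1.toLp _‖ = max (β - α) 0 := by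
      rw [← real_inner_self_eq_norm_mul_norm, L2.inner_def]
      have : ∫ x in Ioo α β, (1 : ℝ) = max (β - α) 0 := by simp
      rw [← this]
      refine integral_congr_ae ?_
      filter_upwards [h1.coeFn_toLp] with x hx
      rw [hx]
      simp
    rw [← Real.sqrt_mul_self (norm_nonneg (h1.toLp _)), this]
    rcases le_total 0 (β - α) with h | h
    · rw [max_eq_left h]
    · rw [max_eq_right h, Real.sqrt_eq_zero_of_nonpos h, Real.sqrt_zero]
  rw [e, ← n1, ← n2]
  exact real_inner_le_norm _ _

theorem abs_prim_le (g : L2 α β) (x : ℝ) : |prim g x| ≤ √(β - α) * ‖g‖ := by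
  refine le_trans ?_ (integral_abs_le g)
  rw [← integral_indicator measurableSet_Ioo]
  rw [← Real.norm_eq_abs]
  refine (intervalIntegral.norm_integral_le_integral_norm_uIoc).trans ?_
  simp only [Real.norm_eq_abs]
  have : (fun s => |(Ioo α β).indicator g s|) = (Ioo α β).indicator fun s => |g s| := by
    ext s
    by_cases hs : s ∈ Ioo α β <;> simp [hs]
  rw [this]
  refine setIntegral_le_integral ?_ (Eventually.of_forall fun s => ?_)
  · exact (integrable_indicator_iff measurableSet_Ioo).2 (integrableOn g).abs
  · exact indicator_nonneg (fun _ _ => abs_nonneg _) _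

theorem prim_eq {x : ℝ} (g : L2 α β) (hx : x ∈ Icc α β) : prim g x = ∫ s in α..x, g s := by
  unfold prim
  refine intervalIntegral.integral_congr_ae ?_
  have : ∀ᵐ s : ℝ, s ≠ β := by simp [ae_iff]
  filter_upwards [this] with s hs h
  rw [uIoc_of_le hx.1] at h
  have hm : s ∈ Ioo α β := ⟨h.1, lt_of_le_of_ne (h.2.trans hx.2) hs⟩
  exact indicator_of_mem hm _

theorem prim_right (g : L2 α β) (h : α ≤ β) : prim g β = ∫ s in Ioo α β, g s := by
  rw [prim_eq g (right_mem_Icc.2 h), intervalIntegral.integral_of_le h, integral_Ioc_eq_integral_Ioo]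

theorem ac_prim (g : L2 α β) : AbsolutelyContinuousOnInterval (prim g) α β :=
  (integrable_indicator g).intervalIntegrable.absolutelyContinuousOnInterval_intervalIntegral
    left_mem_uIcc

theorem ae_hasDerivAt_prim (g : L2 α β) :
    ∀ᵐ x ∂(volume.restrict (Ioo α β)), HasDerivAt (prim g) (g x) x := by
  rw [ae_restrict_iff' measurableSet_Ioo]
  filter_upwards [LocallyIntegrable.ae_hasDerivAt_integral
    (integrable_indicator g).locallyIntegrable] with x hx hm
  have := hx α
  rwa [indicator_of_mem hm] at this

/-- Integration by parts for absolutely continuous functions with given derivatives. -/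
theorem integral_parts (h : α ≤ β) {F G f g : ℝ → ℝ} (hF : AbsolutelyContinuousOnInterval F α β)
    (hG : AbsolutelyContinuousOnInterval G α β)
    (hf : ∀ᵐ x ∂(volume.restrict (Ioo α β)), HasDerivAt F (f x) x)
    (hg : ∀ᵐ x ∂(volume.restrict (Ioo α β)), HasDerivAt G (g x) x) :
    ∫ x in Ioo α β, (f x * G x + F x * g x) = F β * G β - F α * G α := by
  rw [← hF.integral_deriv_mul_eq_sub hG, intervalIntegral.integral_of_le h,
    integral_Ioc_eq_integral_Ioo]
  refine integral_congr_ae ?_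
  filter_upwards [hf, hg] with x h1 h2
  rw [h1.deriv, h2.deriv]

theorem ac_const_add_prim (c : ℝ) (g : L2 α β) :
    AbsolutelyContinuousOnInterval (fun x => c + prim g x) α β :=
  AbsolutelyContinuousOnInterval.add
    ((LipschitzWith.const c).lipschitzOnWith.absolutelyContinuousOnInterval) (ac_prim g)

theorem ac_of_contDiff {φ : ℝ → ℝ} (h : ContDiff ℝ ∞ φ) :
    AbsolutelyContinuousOnInterval φ α β := by
  obtain ⟨K, hK⟩ := (h.of_le (m := 1) (by simp)).contDiffOn.exists_lipschitzOnWith (s := uIcc α β)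
    (by simp) (convex_Icc _ _) isCompact_Icc
  exact hK.absolutelyContinuousOnInterval

end L2

theorem eq_zero_of_tsupport_subset_Ioo {α β : ℝ} {φ : ℝ → ℝ} (hs : tsupport φ ⊆ Ioo α β) {x : ℝ}
    (hx : x ∉ Ioo α β) : φ x = 0 :=
  image_eq_zero_of_notMem_tsupport fun h => hx (hs h)

/-- Integration by parts for absolutely continuous functions; the boundary terms vanish because a
test function is zero at `α` and `β`. -/
theorem isWeakDeriv_of_prim {α β : ℝ} (h : α ≤ β) {f g : L2 α β} {c : ℝ}
    (hf : f =ᵐ[volume.restrict (Ioo α β)] fun x => c + L2.prim g x) : IsWeakDeriv f g := by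
  intro φ hφ hc hs
  have key := L2.integral_parts (f := g) (g := deriv φ) h (L2.ac_const_add_prim c g)
    (L2.ac_of_contDiff hφ) ((L2.ae_hasDerivAt_prim g).mono fun x hx => hx.const_add c)
    (Eventually.of_forall fun x => (hφ.differentiable (by simp) x).hasDerivAt)
  rw [eq_zero_of_tsupport_subset_Ioo hs (x := β) (by simp),
    eq_zero_of_tsupport_subset_Ioo hs (x := α) (by simp)] at key
  have e : ∫ x in Ioo α β, f x * deriv φ x = ∫ x in Ioo α β, (c + L2.prim g x) * deriv φ x :=
    integral_congr_ae (hf.mono fun x hx => by simp only [hx])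
  have hφb : ∃ C, ∀ x, ‖φ x‖ ≤ C := hc.exists_bound_of_continuous hφ.continuous
  obtain ⟨C, hC⟩ := hφb
  have hφ'b : ∃ C, ∀ x, ‖deriv φ x‖ ≤ C :=
    hc.deriv.exists_bound_of_continuous (hφ.continuous_deriv (by simp))
  obtain ⟨C', hC'⟩ := hφ'b
  rw [integral_add] at key
  · rw [e]
    linarith
  · exact Integrable.mul_bdd (L2.integrableOn g) hφ.continuous.aestronglyMeasurable
      (Eventually.of_forall hC)
  · refine Integrable.mul_bdd ?_ (hφ.continuous_deriv (by simp)).aestronglyMeasurable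
      (Eventually.of_forall hC')
    exact (((continuous_const.add (L2.continuous_prim g)).integrableOn_Icc).mono_set
      Ioo_subset_Icc_self)

/-- A function whose weak derivative vanishes is constant. -/
theorem ae_const_of_isWeakDeriv_zero {α β : ℝ} (hαβ : α < β) {e : L2 α β}
    (he : IsWeakDeriv e 0) : ∃ c : ℝ, e =ᵐ[volume.restrict (Ioo α β)] fun _ => c := by
  have hmid : (α + β) / 2 ∈ Ioo α β := ⟨by linarith, by linarith⟩
  -- A fixed test function of integral one, used to absorb the mean of an arbitrary test function.
  let θ : ContDiffBump ((α + β) / 2) := ⟨(β - α) / 8, (β - α) / 4, by linarith, by linarith⟩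
  let θ₀ : ℝ → ℝ := θ.normed volume
  have hθc : ContDiff ℝ ∞ θ₀ := θ.contDiff_normed
  have hθs : HasCompactSupport θ₀ := θ.hasCompactSupport_normed
  have hθt : tsupport θ₀ ⊆ Ioo α β := by
    rw [θ.tsupport_normed_eq, Real.closedBall_eq_Icc]
    exact Icc_subset_Ioo (by simp only [θ]; linarith) (by simp only [θ]; linarith)
  have hθi : ∫ x in Ioo α β, θ₀ x = 1 := by
    rw [setIntegral_eq_integral_of_forall_compl_eq_zero]
    · exact θ.integral_normed
    · intro x hx
      exact eq_zero_of_tsupport_subset_Ioo hθt hx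
  set c := ∫ x in Ioo α β, e x * θ₀ x with hcdef
  refine ⟨c, ?_⟩
  have intOn : ∀ φ : ℝ → ℝ, ContDiff ℝ ∞ φ → IntegrableOn φ (Ioo α β) := fun φ h =>
    h.continuous.integrableOn_Icc.mono_set Ioo_subset_Icc_self
  have intMul : ∀ φ : ℝ → ℝ, ContDiff ℝ ∞ φ → HasCompactSupport φ →
      IntegrableOn (fun x => e x * φ x) (Ioo α β) := by
    intro φ h hc
    obtain ⟨C, hC⟩ := hc.exists_bound_of_continuous h.continuous
    exact Integrable.mul_bdd (L2.integrableOn e) h.continuous.aestronglyMeasurable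
      (Eventually.of_forall hC)
  have key : ∀ᵐ x ∂(volume : Measure ℝ), x ∈ Ioo α β → (fun x => e x - c) x = 0 := by
    refine isOpen_Ioo.ae_eq_zero_of_integral_contDiff_smul_eq_zero ?_ ?_
    · exact ((L2.integrableOn e).sub (integrableOn_const (by simp))).locallyIntegrableOn
    intro φ hφ hφc hφs
    set m := ∫ x in Ioo α β, φ x with hm
    -- With the mean removed, the primitive `Φ` of `g` has compact support in the interval. It is
    -- therefore an admissible test function, and the hypothesis on `e` gives `∫ e g = 0`.
    let g : ℝ → ℝ := fun x => φ x - m * θ₀ x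
    have hg : ContDiff ℝ ∞ g := hφ.sub (contDiff_const.mul hθc)
    have hg0 : ∀ x ∉ Ioo α β, g x = 0 := fun x hx => by
      simp [g, eq_zero_of_tsupport_subset_Ioo hφs hx, eq_zero_of_tsupport_subset_Ioo hθt hx]
    have hgi : ∫ x in Ioo α β, g x = 0 := by
      simp only [g]
      rw [integral_sub (intOn φ hφ) ((intOn θ₀ hθc).const_mul m), integral_const_mul, hθi]
      simp [hm]
    let Φ : ℝ → ℝ := fun x => ∫ s in α..x, g s
    have hΦd : ∀ x, HasDerivAt Φ (g x) x := fun x =>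
      intervalIntegral.integral_hasDerivAt_right (hg.continuous.intervalIntegrable _ _)
        (hg.continuous.stronglyMeasurableAtFilter _ _) hg.continuous.continuousAt
    have hΦ' : deriv Φ = g := funext fun x => (hΦd x).deriv
    have hΦ : ContDiff ℝ ∞ Φ := by
      rw [contDiff_infty_iff_deriv]
      exact ⟨fun x => (hΦd x).differentiableAt, hΦ' ▸ hg⟩
    -- the support of `g` is inside a compact subinterval
    set K := tsupport φ ∪ tsupport θ₀ with hK
    have hKc : IsCompact K := hφc.isCompact.union hθs.isCompact
    have hKs : K ⊆ Ioo α β := union_subset hφs hθt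
    have hgK : ∀ x ∉ K, g x = 0 := fun x hx => by
      rw [hK, mem_union, not_or] at hx
      simp [g, image_eq_zero_of_notMem_tsupport hx.1, image_eq_zero_of_notMem_tsupport hx.2]
    have hKne : K.Nonempty := by
      by_contra hne
      rw [not_nonempty_iff_eq_empty] at hne
      have : ∀ x, θ₀ x = 0 := fun x => image_eq_zero_of_notMem_tsupport fun hx => by
        have : x ∈ K := Or.inr hx
        simp [hne] at this
      simp [this] at hθi
    obtain ⟨a, haK, ha⟩ := hKc.exists_isLeast hKne
    obtain ⟨b, hbK, hb⟩ := hKc.exists_isGreatest hKne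
    have hΦa : ∀ x < a, Φ x = 0 := by
      intro x hx
      have : ∫ s in α..x, g s = ∫ s in α..x, (0 : ℝ) := by
        refine intervalIntegral.integral_congr fun s hs => ?_
        refine hgK s fun hsK => ?_
        have h1 := ha hsK
        rcases le_total α x with hαx | hαx
        · rw [uIcc_of_le hαx] at hs
          linarith [hs.2]
        · rw [uIcc_of_ge hαx] at hs
          linarith [hs.2, (hKs hsK).1]
      simp [Φ, this]
    have hΦb : ∀ x > b, Φ x = 0 := by
      intro x hx
      have hαb : α < b := (hKs hbK).1
      have hbβ : b < β := (hKs hbK).2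
      have h1 : ∫ s in α..β, g s = 0 := by
        rw [intervalIntegral.integral_of_le hαβ.le, integral_Ioc_eq_integral_Ioo, hgi]
      have h2 : ∫ s in x..β, g s = ∫ s in x..β, (0 : ℝ) := by
        refine intervalIntegral.integral_congr fun s hs => ?_
        refine hgK s fun hsK => ?_
        have h1 := hb hsK
        rcases le_total x β with hxβ | hxβ
        · rw [uIcc_of_le hxβ] at hs
          linarith [hs.1]
        · rw [uIcc_of_ge hxβ] at hs
          linarith [hs.1]
      have h3 := intervalIntegral.integral_add_adjacent_intervals
        (hg.continuous.intervalIntegrable (μ := volume) α x)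
        (hg.continuous.intervalIntegrable x β)
      simp only [h1, h2, intervalIntegral.integral_zero, add_zero] at h3
      exact h3
    have hΦts : tsupport Φ ⊆ Icc a b := by
      refine closure_minimal (fun x hx => ?_) isClosed_Icc
      by_contra hxab
      rw [mem_Icc, not_and_or, not_le, not_le] at hxab
      rcases hxab with h | h
      · exact hx (hΦa x h)
      · exact hx (hΦb x h)
    have hΦs : tsupport Φ ⊆ Ioo α β :=
      hΦts.trans (Icc_subset_Ioo (hKs haK).1 (hKs hbK).2)
    have hΦc : HasCompactSupport Φ :=
      isCompact_Icc.of_isClosed_subset (isClosed_tsupport _) hΦts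
    have h0 := he Φ hΦ hΦc hΦs
    have hz : ∫ x in Ioo α β, (0 : L2 α β) x * Φ x = 0 := by
      rw [integral_congr_ae (g := fun _ => (0 : ℝ)), integral_zero]
      filter_upwards [Lp.coeFn_zero ℝ 2 (volume.restrict (Ioo α β))] with x hx
      rw [hx, Pi.zero_apply, zero_mul]
    rw [hz, neg_zero, hΦ'] at h0
    have h1 : ∫ x in Ioo α β, e x * g x
        = (∫ x in Ioo α β, e x * φ x) - m * c := by
      rw [hcdef, ← integral_const_mul, ← integral_sub (intMul φ hφ hφc)
        ((intMul θ₀ hθc hθs).const_mul m)]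
      refine integral_congr_ae (Eventually.of_forall fun x => ?_)
      simp only [g]
      ring
    rw [h1] at h0
    have h2 : ∫ x, φ x • (fun x => e x - c) x = ∫ x in Ioo α β, φ x • (fun x => e x - c) x := by
      rw [setIntegral_eq_integral_of_forall_compl_eq_zero]
      intro x hx
      simp [eq_zero_of_tsupport_subset_Ioo hφs hx]
    rw [h2]
    have h3 : ∫ x in Ioo α β, φ x • (fun x => e x - c) x
        = (∫ x in Ioo α β, e x * φ x) - c * m := by
      rw [hm, ← integral_const_mul, ← integral_sub (intMul φ hφ hφc) ((intOn φ hφ).const_mul c)]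
      refine integral_congr_ae (Eventually.of_forall fun x => ?_)
      simp only [smul_eq_mul]
      ring
    rw [h3]
    linarith
  filter_upwards [(ae_restrict_iff' measurableSet_Ioo).2 key] with x hx
  simpa [sub_eq_zero] using hx

theorem IsWeakDeriv.sub {α β : ℝ} {f f' g g' : L2 α β} (h : IsWeakDeriv f g)
    (h' : IsWeakDeriv f' g') : IsWeakDeriv (f - f') (g - g') := by
  rw [isWeakDeriv_iff] at *
  intro φ hφ hc hs
  rw [inner_sub_right, inner_sub_right, h φ hφ hc hs, h' φ hφ hc hs]
  ring

theorem L2.memLp_prim {α β : ℝ} (c : ℝ) (g : L2 α β) :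
    MemLp (fun x => c + L2.prim g x) 2 (volume.restrict (Ioo α β)) := by
  refine MemLp.of_bound (C := |c| + √(β - α) * ‖g‖)
    (continuous_const.add (L2.continuous_prim g)).aestronglyMeasurable
    (Eventually.of_forall fun x => ?_)
  exact (abs_add_le _ _).trans (by gcongr; exact L2.abs_prim_le g x)

/-- Subtracting the primitive of `g` leaves a function with zero weak derivative, hence a constant.
This supplies the continuous representative behind `Sobolev.ev`. -/
theorem IsWeakDeriv.exists_prim {α β : ℝ} (hαβ : α < β) {f g : L2 α β} (h : IsWeakDeriv f g) :
    ∃ c, f =ᵐ[volume.restrict (Ioo α β)] fun x => c + L2.prim g x := by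
  have hm := L2.memLp_prim 0 g
  have h1 : IsWeakDeriv (hm.toLp _) g := isWeakDeriv_of_prim hαβ.le hm.coeFn_toLp
  have h2 := h.sub h1
  rw [sub_self] at h2
  obtain ⟨c, hc⟩ := ae_const_of_isWeakDeriv_zero hαβ h2
  refine ⟨c, ?_⟩
  filter_upwards [hc, hm.coeFn_toLp, Lp.coeFn_sub f (hm.toLp _)] with x h1 h2 h3
  rw [h3, Pi.sub_apply, h2] at h1
  linarith

/-! ### Point values of Sobolev functions -/

theorem eqOn_Icc_of_ae_eq_Ioo {α β : ℝ} (hαβ : α < β) {f g : ℝ → ℝ}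
    (h : f =ᵐ[volume.restrict (Ioo α β)] g) (hf : ContinuousOn f (Icc α β))
    (hg : ContinuousOn g (Icc α β)) : EqOn f g (Icc α β) := by
  refine Measure.eqOn_Icc_of_ae_eq (μ := volume) hαβ.ne ?_ hf hg
  rwa [Measure.restrict_congr_set Ioo_ae_eq_Icc.symm]

namespace Sobolev

variable {m : ℕ} {α β : ℝ}

theorem ev_spec {f : Sobolev m α β} {g : ℝ → ℝ} (hg : ContinuousOn g (Icc α β))
    (h : f.toL2 =ᵐ[volume.restrict (Ioo α β)] g) :
    ContinuousOn f.ev (Icc α β) ∧ f.toL2 =ᵐ[volume.restrict (Ioo α β)] f.ev := by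
  have hex : ∃ g : ℝ → ℝ, ContinuousOn g (Icc α β) ∧ f.toL2 =ᵐ[volume.restrict (Ioo α β)] g :=
    ⟨g, hg, h⟩
  rw [ev, dif_pos hex]
  exact hex.choose_spec

theorem ev_eqOn (hαβ : α < β) {f : Sobolev m α β} {g : ℝ → ℝ} (hg : ContinuousOn g (Icc α β))
    (h : f.toL2 =ᵐ[volume.restrict (Ioo α β)] g) : EqOn f.ev g (Icc α β) :=
  eqOn_Icc_of_ae_eq_Ioo hαβ ((ev_spec hg h).2.symm.trans h) (ev_spec hg h).1 hg

/-- The `H¹` function with given weak derivative. -/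
def mk (f g : L2 α β) (h : IsWeakDeriv f g) : Sobolev 1 α β :=
  ⟨WithLp.toLp 2 ![f, g], fun i => by fin_cases i; exact h⟩

@[simp] theorem toL2_mk (f g : L2 α β) (h : IsWeakDeriv f g) : (mk f g h).toL2 = f := rfl

@[simp] theorem dx_mk (f g : L2 α β) (h : IsWeakDeriv f g) : (mk f g h).dx = g := rfl

theorem isWeakDeriv (f : Sobolev 1 α β) : IsWeakDeriv f.toL2 f.dx := f.2 0

theorem exists_prim (hαβ : α < β) (f : Sobolev 1 α β) :
    ∃ c, f.toL2 =ᵐ[volume.restrict (Ioo α β)] fun x => c + L2.prim f.dx x :=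
  f.isWeakDeriv.exists_prim hαβ

theorem continuousOn_ev (hαβ : α < β) (f : Sobolev 1 α β) : ContinuousOn f.ev (Icc α β) := by
  obtain ⟨c, hc⟩ := f.exists_prim hαβ
  exact (ev_spec (continuous_const.add (L2.continuous_prim _)).continuousOn hc).1

theorem toL2_ae_eq_ev (hαβ : α < β) (f : Sobolev 1 α β) :
    f.toL2 =ᵐ[volume.restrict (Ioo α β)] f.ev := by
  obtain ⟨c, hc⟩ := f.exists_prim hαβ
  exact (ev_spec (continuous_const.add (L2.continuous_prim _)).continuousOn hc).2

theorem ev_eq_prim (hαβ : α < β) (f : Sobolev 1 α β) {x : ℝ} (hx : x ∈ Icc α β) :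
    f.ev x = f.ev α + L2.prim f.dx x := by
  obtain ⟨c, hc⟩ := f.exists_prim hαβ
  have h := ev_eqOn hαβ (continuous_const.add (L2.continuous_prim _)).continuousOn hc
  rw [h hx, h (left_mem_Icc.2 hαβ.le)]
  simp

/-- Weak derivatives are unique by the fundamental lemma of the calculus of variations, so the
function component of the tuple determines the derivative component. -/
theorem ext_toL2 {f g : Sobolev 1 α β} (h : f.toL2 = g.toL2) : f = g := by
  have hd : f.dx = g.dx := by
    have h2 := f.isWeakDeriv.sub g.isWeakDeriv
    rw [h, sub_self] at h2
    rw [← sub_eq_zero]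
    have h3 : ∀ᵐ x ∂(volume : Measure ℝ), x ∈ Ioo α β → (f.dx - g.dx) x = 0 := by
      refine isOpen_Ioo.ae_eq_zero_of_integral_contDiff_smul_eq_zero
        (L2.integrableOn _).locallyIntegrableOn fun φ hφ hc hs => ?_
      have := h2 φ hφ hc hs
      have hz : ∫ x in Ioo α β, (0 : L2 α β) x * deriv φ x = 0 := by
        rw [integral_congr_ae (g := fun _ => (0 : ℝ)), integral_zero]
        filter_upwards [Lp.coeFn_zero ℝ 2 (volume.restrict (Ioo α β))] with x hx
        rw [hx, Pi.zero_apply, zero_mul]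
      rw [hz, eq_comm, neg_eq_zero] at this
      rw [← setIntegral_eq_integral_of_forall_compl_eq_zero (s := Ioo α β), ← this]
      · simp only [smul_eq_mul, mul_comm]
      · intro x hx
        simp [eq_zero_of_tsupport_subset_Ioo hs hx]
    refine Lp.ext ?_
    filter_upwards [(ae_restrict_iff' measurableSet_Ioo).2 h3,
      Lp.coeFn_zero ℝ 2 (volume.restrict (Ioo α β))] with x h1 h2
    rw [h1, h2, Pi.zero_apply]
  refine Subtype.ext (PiLp.ext fun i => ?_)
  fin_cases i
  · exact h
  · exact hd

theorem ext_ev (hαβ : α < β) {f g : Sobolev 1 α β} (h : EqOn f.ev g.ev (Ioo α β)) : f = g := by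
  refine ext_toL2 (Lp.ext ?_)
  filter_upwards [f.toL2_ae_eq_ev hαβ, g.toL2_ae_eq_ev hαβ, ae_restrict_mem measurableSet_Ioo]
    with x h1 h2 h3
  rw [h1, h2, h h3]

@[simp] theorem toL2_add (f g : Sobolev m α β) : (f + g).toL2 = f.toL2 + g.toL2 := rfl

@[simp] theorem toL2_sub (f g : Sobolev m α β) : (f - g).toL2 = f.toL2 - g.toL2 := rfl

@[simp] theorem toL2_smul (c : ℝ) (f : Sobolev m α β) : (c • f).toL2 = c • f.toL2 := rfl

@[simp] theorem toL2_neg (f : Sobolev m α β) : (-f).toL2 = -f.toL2 := rfl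

@[simp] theorem toL2_zero : (0 : Sobolev m α β).toL2 = 0 := rfl

@[simp] theorem dx_add (f g : Sobolev 1 α β) : (f + g).dx = f.dx + g.dx := rfl

@[simp] theorem dx_sub (f g : Sobolev 1 α β) : (f - g).dx = f.dx - g.dx := rfl

@[simp] theorem dx_smul (c : ℝ) (f : Sobolev 1 α β) : (c • f).dx = c • f.dx := rfl

@[simp] theorem dx_neg (f : Sobolev 1 α β) : (-f).dx = -f.dx := rfl

@[simp] theorem dx_zero : (0 : Sobolev 1 α β).dx = 0 := rfl

theorem continuous_toL2 : Continuous (toL2 : Sobolev m α β → L2 α β) :=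
  (PiLp.continuous_apply 2 _ 0).comp continuous_subtype_val

theorem continuous_dx : Continuous (dx : Sobolev 1 α β → L2 α β) :=
  (PiLp.continuous_apply 2 _ 1).comp continuous_subtype_val

theorem ev_add (hαβ : α < β) (f g : Sobolev 1 α β) {x : ℝ} (hx : x ∈ Icc α β) :
    (f + g).ev x = f.ev x + g.ev x := by
  refine ev_eqOn hαβ ((f.continuousOn_ev hαβ).add (g.continuousOn_ev hαβ)) ?_ hx
  filter_upwards [f.toL2_ae_eq_ev hαβ, g.toL2_ae_eq_ev hαβ, Lp.coeFn_add f.toL2 g.toL2]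
    with x h1 h2 h3
  rw [toL2_add, h3, Pi.add_apply, h1, h2, Pi.add_apply]

theorem ev_smul (hαβ : α < β) (c : ℝ) (f : Sobolev 1 α β) {x : ℝ} (hx : x ∈ Icc α β) :
    (c • f).ev x = c * f.ev x := by
  refine ev_eqOn hαβ (continuousOn_const.mul (f.continuousOn_ev hαβ)) ?_ hx
  filter_upwards [f.toL2_ae_eq_ev hαβ, Lp.coeFn_smul c f.toL2] with x h1 h3
  rw [toL2_smul, h3, Pi.smul_apply, h1, smul_eq_mul, Pi.mul_apply]

theorem ev_sub (hαβ : α < β) (f g : Sobolev 1 α β) {x : ℝ} (hx : x ∈ Icc α β) :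
    (f - g).ev x = f.ev x - g.ev x := by
  have : f - g = f + (-1 : ℝ) • g := by simp [sub_eq_add_neg]
  rw [this, ev_add hαβ _ _ hx, ev_smul hαβ _ _ hx]
  ring

theorem ev_zero (hαβ : α < β) {x : ℝ} (hx : x ∈ Icc α β) : (0 : Sobolev 1 α β).ev x = 0 := by
  refine ev_eqOn (g := fun _ => 0) hαβ continuousOn_const ?_ hx
  exact Lp.coeFn_zero _ _ _

/-- Sobolev embedding on an interval. -/
theorem abs_ev_le (hαβ : α < β) (f : Sobolev 1 α β) {x : ℝ} (hx : x ∈ Icc α β) :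
    |f.ev x| ≤ (√(β - α))⁻¹ * ‖f.toL2‖ + 2 * (√(β - α) * ‖f.dx‖) := by
  have hpos : 0 < √(β - α) := Real.sqrt_pos.2 (by linarith)
  set M := √(β - α) * ‖f.dx‖ with hM
  -- The oscillation of `f` is at most `2 * M`; averaging over `y` then replaces the value at `y` by
  -- the mean of `|f|`.
  have h1 : ∀ y ∈ Icc α β, |f.ev x| ≤ |f.ev y| + 2 * M := by
    intro y hy
    have e : f.ev x = f.ev y + L2.prim f.dx x + -L2.prim f.dx y := by
      rw [f.ev_eq_prim hαβ hx, f.ev_eq_prim hαβ hy]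
      ring
    rw [e]
    refine (abs_add_three _ _ _).trans ?_
    rw [abs_neg]
    linarith [L2.abs_prim_le f.dx x, L2.abs_prim_le f.dx y]
  have h2 : ∫ y in Ioo α β, |f.ev x| ≤ ∫ y in Ioo α β, (|f.toL2 y| + 2 * M) := by
    refine integral_mono_ae (integrableOn_const (by simp))
      ((L2.integrableOn _).abs.add (integrableOn_const (by simp))) ?_
    filter_upwards [f.toL2_ae_eq_ev hαβ, ae_restrict_mem measurableSet_Ioo] with y hy hy'
    rw [hy]
    exact h1 y (Ioo_subset_Icc_self hy')
  rw [integral_add (L2.integrableOn _).abs (integrableOn_const (by simp))] at h2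
  simp only [integral_const, MeasurableSet.univ, measureReal_restrict_apply, univ_inter,
    Real.volume_real_Ioo, smul_eq_mul, max_eq_left (sub_nonneg.2 hαβ.le)] at h2
  have h3 := L2.integral_abs_le f.toL2
  have hs : √(β - α) * √(β - α) = β - α := Real.mul_self_sqrt (by linarith)
  have h4 : √(β - α) * √(β - α) * (|f.ev x| - 2 * M) ≤ √(β - α) * ‖f.toL2‖ := by
    rw [hs]
    linarith
  rw [mul_assoc] at h4
  have h5 := le_of_mul_le_mul_left h4 hpos
  have h6 : |f.ev x| - 2 * M ≤ (√(β - α))⁻¹ * ‖f.toL2‖ := by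
    rw [inv_mul_eq_div, le_div_iff₀ hpos]
    linarith
  linarith

theorem norm_toL2_le (f : Sobolev m α β) : ‖f.toL2‖ ≤ ‖f‖ := PiLp.norm_apply_le f.1 0

theorem norm_dx_le (f : Sobolev 1 α β) : ‖f.dx‖ ≤ ‖f‖ := PiLp.norm_apply_le f.1 1

/-- Integration by parts for `H¹` functions. -/
theorem inner_dx_add (hαβ : α < β) (f g : Sobolev 1 α β) :
    inner ℝ f.dx g.toL2 + inner ℝ f.toL2 g.dx = f.ev β * g.ev β - f.ev α * g.ev α := by
  have hr := right_mem_Icc.2 hαβ.le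
  have key := L2.integral_parts (f := f.dx) (g := g.dx) hαβ.le (L2.ac_const_add_prim (f.ev α) f.dx)
    (L2.ac_const_add_prim (g.ev α) g.dx)
    ((L2.ae_hasDerivAt_prim f.dx).mono fun x hx => hx.const_add _)
    ((L2.ae_hasDerivAt_prim g.dx).mono fun x hx => hx.const_add _)
  rw [← f.ev_eq_prim hαβ hr, ← g.ev_eq_prim hαβ hr] at key
  simp only [L2.prim_left, add_zero] at key
  rw [← key, ← L2.integral_Ioo_mul, ← L2.integral_Ioo_mul, ← integral_add]
  · refine integral_congr_ae ?_
    filter_upwards [f.toL2_ae_eq_ev hαβ, g.toL2_ae_eq_ev hαβ, ae_restrict_mem measurableSet_Ioo]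
      with x h1 h2 h3
    rw [h1, h2, ← f.ev_eq_prim hαβ (Ioo_subset_Icc_self h3),
      ← g.ev_eq_prim hαβ (Ioo_subset_Icc_self h3)]
  · exact (Lp.memLp f.dx).integrable_mul (Lp.memLp g.toL2)
  · exact (Lp.memLp f.toL2).integrable_mul (Lp.memLp g.dx)

end Sobolev

/-! ### Multiplication by bounded continuous functions -/

namespace L2

variable {α β : ℝ}

/-- Multiplication of `L²` functions by bounded continuous functions. -/
def mulL : (ℝ →ᵇ ℝ) →L[ℝ] L2 α β →L[ℝ] L2 α β :=
  ((ContinuousLinearMap.mul ℝ ℝ).holderL (volume.restrict (Ioo α β)) ⊤ 2 2).comp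
    (BoundedContinuousFunction.toLp ⊤ (volume.restrict (Ioo α β)) ℝ)

theorem coeFn_mulL (φ : ℝ →ᵇ ℝ) (g : L2 α β) :
    mulL φ g =ᵐ[volume.restrict (Ioo α β)] fun x => φ x * g x := by
  have h := (ContinuousLinearMap.mul ℝ ℝ).coeFn_holder (r := 2)
    (BoundedContinuousFunction.toLp ⊤ (volume.restrict (Ioo α β)) ℝ φ) g
  filter_upwards [h, BoundedContinuousFunction.coeFn_toLp (p := ⊤) (𝕜 := ℝ)
    (μ := volume.restrict (Ioo α β)) φ] with x hx hy
  simp only [ContinuousLinearMap.mul_apply'] at hx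
  rw [hy] at hx
  exact hx

theorem norm_mulL_le (φ : ℝ →ᵇ ℝ) (g : L2 α β) : ‖mulL φ g‖ ≤ ‖φ‖ * ‖g‖ := by
  refine Lp.norm_le_mul_norm_of_ae_le_mul ?_
  filter_upwards [coeFn_mulL φ g] with x hx
  rw [hx, norm_mul]
  gcongr
  exact φ.norm_coe_le_norm x

/-- The restriction of a bounded continuous function to `(α, β)`. -/
def ofBCF : (ℝ →ᵇ ℝ) →L[ℝ] L2 α β :=
  BoundedContinuousFunction.toLp 2 (volume.restrict (Ioo α β)) ℝ

theorem coeFn_ofBCF (φ : ℝ →ᵇ ℝ) : (ofBCF φ : L2 α β) =ᵐ[volume.restrict (Ioo α β)] φ :=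
  BoundedContinuousFunction.coeFn_toLp (p := 2) (𝕜 := ℝ) (μ := volume.restrict (Ioo α β)) φ

theorem inner_mulL_left (φ : ℝ →ᵇ ℝ) (f g : L2 α β) :
    inner ℝ (mulL φ f) g = inner ℝ f (mulL φ g) := by
  rw [← integral_Ioo_mul, ← integral_Ioo_mul]
  refine integral_congr_ae ?_
  filter_upwards [coeFn_mulL φ f, coeFn_mulL φ g] with x h1 h2
  rw [h1, h2]
  ring

/-- The function equal to `x` on `[0, 1]` and constant outside. -/
def clamp : ℝ →ᵇ ℝ :=
  BoundedContinuousFunction.ofNormedAddCommGroup (fun x => max 0 (min x 1))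
    (by fun_prop) 1 fun x => by
      rw [Real.norm_eq_abs, abs_of_nonneg (le_max_left _ _)]
      exact max_le zero_le_one (min_le_right _ _)

theorem clamp_apply {x : ℝ} (hx : x ∈ Icc (0 : ℝ) 1) : clamp x = x := by
  change max 0 (min x 1) = x
  rw [min_eq_left hx.2, max_eq_right hx.1]

theorem norm_clamp_le : ‖clamp‖ ≤ 1 :=
  BoundedContinuousFunction.norm_ofNormedAddCommGroup_le _ zero_le_one _

end L2

/-! ### The linear wave system with an `L²` source -/

/-- `(p, u)` is a classical solution of `∂ₜ p + ∂ₓ u = 0`, `∂ₜ u + ∂ₓ p + f(t) = 0`. -/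
structure IsWave (T : ℝ) (f : ℝ → L2 0 1) (p u : ℝ → Sobolev 1 0 1) : Prop where
  continuousOn_p : ContinuousOn p (Icc 0 T)
  continuousOn_u : ContinuousOn u (Icc 0 T)
  continuousOn_f : ContinuousOn f (Icc 0 T)
  deriv_p : ∀ t ∈ Icc 0 T, HasDerivWithinAt (fun s => (p s).toL2) (-(u t).dx) (Icc 0 T) t
  deriv_u : ∀ t ∈ Icc 0 T, HasDerivWithinAt (fun s => (u s).toL2) (-(p t).dx - f t) (Icc 0 T) t

/-- The source is defined as the residual of the momentum equation and not through `σ`. Its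
continuity in time then follows from the regularity class alone, without any assumption on `σ`. -/
theorem IsClassicalSolution.exists_isWave {T : ℝ} (hT : 0 < T) {σ : ℝ → ℝ → ℝ → ℝ}
    {γ₀ γ₁ : ℝ → ℝ} {p u : ℝ → Sobolev 1 0 1} (h : IsClassicalSolution T σ γ₀ γ₁ p u) :
    ∃ f, IsWave T f p u ∧ ∀ t ∈ Icc 0 T,
      f t =ᵐ[volume.restrict (Ioo 0 1)] fun x => σ t x ((u t).ev x) := by
  have hu : UniqueDiffOn ℝ (Icc 0 T) := uniqueDiffOn_Icc hT
  refine ⟨fun t => -derivWithin (fun s => (u s).toL2) (Icc 0 T) t - (p t).dx,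
    ⟨h.continuousOn_p, h.continuousOn_u, ?_, fun t ht => ?_, fun t ht => ?_⟩, fun t ht => ?_⟩
  · exact (h.contDiffOn_u.continuousOn_derivWithin hu le_rfl).neg.sub
      (Sobolev.continuous_dx.comp_continuousOn h.continuousOn_p)
  · rw [← eq_neg_of_add_eq_zero_left (h.mass t ht)]
    exact (h.contDiffOn_p.differentiableOn (by simp) t ht).hasDerivWithinAt
  · refine HasDerivWithinAt.congr_deriv ((h.contDiffOn_u.differentiableOn (by simp) t ht).hasDerivWithinAt) ?_
    abel
  · filter_upwards [h.momentum t ht, Lp.coeFn_sub (-derivWithin (fun s => (u s).toL2) (Icc 0 T) t)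
      (p t).dx, Lp.coeFn_neg (derivWithin (fun s => (u s).toL2) (Icc 0 T) t)] with x h1 h2 h3
    rw [h2, Pi.sub_apply, h3, Pi.neg_apply]
    linarith

namespace IsWave

variable {T : ℝ} {f f₁ f₂ : ℝ → L2 0 1} {p u p₁ u₁ p₂ u₂ : ℝ → Sobolev 1 0 1}

theorem contDiffOn_of_deriv (hT : 0 < T) {E : Type*} [NormedAddCommGroup E] [NormedSpace ℝ E]
    {F F' : ℝ → E} (h : ∀ t ∈ Icc 0 T, HasDerivWithinAt F (F' t) (Icc 0 T) t)
    (hc : ContinuousOn F' (Icc 0 T)) : ContDiffOn ℝ 1 F (Icc 0 T) := by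
  have hu : UniqueDiffOn ℝ (Icc 0 T) := uniqueDiffOn_Icc hT
  rw [show (1 : WithTop ℕ∞) = 0 + 1 from rfl, contDiffOn_succ_iff_derivWithin hu]
  refine ⟨fun t ht => (h t ht).differentiableWithinAt, by simp, ?_⟩
  rw [contDiffOn_zero]
  exact hc.congr fun t ht => (h t ht).derivWithin (hu t ht)

theorem isClassicalSolution (hT : 0 < T) (h : IsWave T f p u) {σ : ℝ → ℝ → ℝ → ℝ}
    {γ₀ γ₁ : ℝ → ℝ}
    (hσ : ∀ t ∈ Icc 0 T, f t =ᵐ[volume.restrict (Ioo 0 1)] fun x => σ t x ((u t).ev x))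
    (h₀ : ∀ t ∈ Icc 0 T, (u t).ev 0 = γ₀ t) (h₁ : ∀ t ∈ Icc 0 T, (u t).ev 1 = γ₁ t) :
    IsClassicalSolution T σ γ₀ γ₁ p u := by
  have hu : UniqueDiffOn ℝ (Icc 0 T) := uniqueDiffOn_Icc hT
  have cp := Sobolev.continuous_dx.comp_continuousOn h.continuousOn_p
  have cu := Sobolev.continuous_dx.comp_continuousOn h.continuousOn_u
  refine ⟨h.continuousOn_p, h.continuousOn_u, contDiffOn_of_deriv hT h.deriv_p cu.neg,
    contDiffOn_of_deriv hT h.deriv_u (cp.neg.sub h.continuousOn_f), fun t ht => ?_,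
    fun t ht => ?_, h₀, h₁⟩
  · rw [(h.deriv_p t ht).derivWithin (hu t ht)]
    simp
  · rw [(h.deriv_u t ht).derivWithin (hu t ht)]
    filter_upwards [hσ t ht, Lp.coeFn_sub (-(p t).dx) (f t), Lp.coeFn_neg (p t).dx] with x h1 h2 h3
    rw [h2, Pi.sub_apply, h3, Pi.neg_apply, h1]
    ring

theorem sub (h₁ : IsWave T f₁ p₁ u₁) (h₂ : IsWave T f₂ p₂ u₂) :
    IsWave T (f₁ - f₂) (p₁ - p₂) (u₁ - u₂) where
  continuousOn_p := h₁.continuousOn_p.sub h₂.continuousOn_p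
  continuousOn_u := h₁.continuousOn_u.sub h₂.continuousOn_u
  continuousOn_f := h₁.continuousOn_f.sub h₂.continuousOn_f
  deriv_p t ht := by
    refine HasDerivWithinAt.congr_deriv ((h₁.deriv_p t ht).sub (h₂.deriv_p t ht)) ?_
    simp only [Pi.sub_apply, Sobolev.dx_sub]
    abel
  deriv_u t ht := by
    refine HasDerivWithinAt.congr_deriv ((h₁.deriv_u t ht).sub (h₂.deriv_u t ht)) ?_
    simp only [Pi.sub_apply, Sobolev.dx_sub]
    abel

theorem add (h₁ : IsWave T f₁ p₁ u₁) (h₂ : IsWave T f₂ p₂ u₂) :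
    IsWave T (f₁ + f₂) (p₁ + p₂) (u₁ + u₂) where
  continuousOn_p := h₁.continuousOn_p.add h₂.continuousOn_p
  continuousOn_u := h₁.continuousOn_u.add h₂.continuousOn_u
  continuousOn_f := h₁.continuousOn_f.add h₂.continuousOn_f
  deriv_p t ht := by
    refine HasDerivWithinAt.congr_deriv ((h₁.deriv_p t ht).add (h₂.deriv_p t ht)) ?_
    simp only [Pi.add_apply, Sobolev.dx_add]
    abel
  deriv_u t ht := by
    refine HasDerivWithinAt.congr_deriv ((h₁.deriv_u t ht).add (h₂.deriv_u t ht)) ?_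
    simp only [Pi.add_apply, Sobolev.dx_add]
    abel

theorem smul (c : ℝ) (h : IsWave T f p u) : IsWave T (c • f) (c • p) (c • u) where
  continuousOn_p := h.continuousOn_p.const_smul c
  continuousOn_u := h.continuousOn_u.const_smul c
  continuousOn_f := h.continuousOn_f.const_smul c
  deriv_p t ht := by
    refine HasDerivWithinAt.congr_deriv ((h.deriv_p t ht).const_smul c) ?_
    simp
  deriv_u t ht := by
    refine HasDerivWithinAt.congr_deriv ((h.deriv_u t ht).const_smul c) ?_
    simp [smul_sub]

theorem continuousOn_toL2_p (h : IsWave T f p u) : ContinuousOn (fun t => (p t).toL2) (Icc 0 T) :=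
  Sobolev.continuous_toL2.comp_continuousOn h.continuousOn_p

theorem continuousOn_toL2_u (h : IsWave T f p u) : ContinuousOn (fun t => (u t).toL2) (Icc 0 T) :=
  Sobolev.continuous_toL2.comp_continuousOn h.continuousOn_u

/-- The bilinear identity behind energy estimates and duality. -/
theorem hasDerivWithinAt_pairing (h₁ : IsWave T f₁ p₁ u₁) (h₂ : IsWave T f₂ p₂ u₂) {t : ℝ}
    (ht : t ∈ Icc 0 T) :
    HasDerivWithinAt (fun s => inner ℝ (p₁ s).toL2 (p₂ s).toL2 + inner ℝ (u₁ s).toL2 (u₂ s).toL2)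
      (-inner ℝ (f₁ t) (u₂ t).toL2 - inner ℝ (u₁ t).toL2 (f₂ t)
        - ((u₁ t).ev 1 * (p₂ t).ev 1 - (u₁ t).ev 0 * (p₂ t).ev 0)
        - ((p₁ t).ev 1 * (u₂ t).ev 1 - (p₁ t).ev 0 * (u₂ t).ev 0)) (Icc 0 T) t := by
  refine HasDerivWithinAt.congr_deriv (((h₁.deriv_p t ht).inner ℝ (h₂.deriv_p t ht)).add
    ((h₁.deriv_u t ht).inner ℝ (h₂.deriv_u t ht))) ?_
  rw [← Sobolev.inner_dx_add zero_lt_one, ← Sobolev.inner_dx_add zero_lt_one]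
  simp only [inner_sub_left, inner_sub_right, inner_neg_left, inner_neg_right]
  ring

theorem integral_eq_sub {g g' : ℝ → ℝ} (hT : 0 ≤ T)
    (h : ∀ t ∈ Icc 0 T, HasDerivWithinAt g (g' t) (Icc 0 T) t) (hg : ContinuousOn g' (Icc 0 T)) :
    ∫ t in (0 : ℝ)..T, g' t = g T - g 0 := by
  refine intervalIntegral.integral_eq_sub_of_hasDerivAt_of_le hT
    (fun t ht => (h t ht).continuousWithinAt) (fun t ht => ?_) ?_
  · exact (h t (Ioo_subset_Icc_self ht)).hasDerivAt (Icc_mem_nhds ht.1 ht.2)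
  · exact (uIcc_of_le hT ▸ hg).intervalIntegrable

theorem le_gronwallBound {g g' : ℝ → ℝ} {K ε : ℝ}
    (h : ∀ t ∈ Icc 0 T, HasDerivWithinAt g (g' t) (Icc 0 T) t) (h0 : g 0 ≤ 0)
    (hb : ∀ t ∈ Icc 0 T, g' t ≤ K * g t + ε) :
    ∀ t ∈ Icc 0 T, g t ≤ gronwallBound 0 K ε t := by
  intro t ht
  have := le_gronwallBound_of_liminf_deriv_right_le (f := g) (f' := g') (δ := 0) (K := K) (ε := ε)
    (a := 0) (b := T) (fun t ht => (h t ht).continuousWithinAt) (fun x hx r hr => ?_) h0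
    (fun x hx => hb x (Ico_subset_Icc_self hx)) t ht
  · simpa using this
  · have h1 : HasDerivWithinAt g (g' x) (Ici x) x :=
      (h x (Ico_subset_Icc_self hx)).mono_of_mem_nhdsWithin
        (mem_of_superset (Icc_mem_nhdsGE hx.2) (Icc_subset_Icc_left hx.1))
    exact h1.liminf_right_slope_le hr

/-- When the solution is paired with itself, the boundary terms disappear because `u` vanishes at
both ends. The energy `E` then satisfies `E' ≤ (2 * K + 1) * E + ε ^ 2`, by `2 * ε * ‖u‖ ≤ ‖u‖ ^ 2 +
ε ^ 2`, and Gronwall applies. -/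
theorem energy_le (h : IsWave T f p u) (hp : (p 0).toL2 = 0) (hu : (u 0).toL2 = 0)
    (h₀ : ∀ t ∈ Icc 0 T, (u t).ev 0 = 0) (h₁ : ∀ t ∈ Icc 0 T, (u t).ev 1 = 0) {K ε : ℝ}
    (hK : 0 ≤ K) (hf : ∀ t ∈ Icc 0 T, ‖f t‖ ≤ K * ‖(u t).toL2‖ + ε) {t : ℝ} (ht : t ∈ Icc 0 T) :
    ‖(p t).toL2‖ ^ 2 + ‖(u t).toL2‖ ^ 2
      ≤ ε ^ 2 * ((Real.exp ((2 * K + 1) * T) - 1) / (2 * K + 1)) := by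
  have key := le_gronwallBound (K := 2 * K + 1) (ε := ε ^ 2)
    (fun t ht => h.hasDerivWithinAt_pairing h ht) (by simp [hp, hu]) (fun t ht => ?_) t ht
  · simp only [real_inner_self_eq_norm_sq] at key
    refine key.trans ?_
    rw [gronwallBound_of_K_ne_0 (by positivity)]
    have : Real.exp ((2 * K + 1) * t) ≤ Real.exp ((2 * K + 1) * T) :=
      Real.exp_le_exp.2 (mul_le_mul_of_nonneg_left ht.2 (by positivity))
    calc 0 * Real.exp ((2 * K + 1) * t) + ε ^ 2 / (2 * K + 1) * (Real.exp ((2 * K + 1) * t) - 1)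
        = ε ^ 2 * ((Real.exp ((2 * K + 1) * t) - 1) / (2 * K + 1)) := by ring
      _ ≤ _ := by gcongr
  · rw [h₀ t ht, h₁ t ht, real_inner_comm]
    simp only [real_inner_self_eq_norm_sq]
    have h1 : -inner ℝ (u t).toL2 (f t) ≤ ‖(u t).toL2‖ * (K * ‖(u t).toL2‖ + ε) := by
      have := (abs_le.1 (abs_real_inner_le_norm (u t).toL2 (f t))).1
      have h2 := mul_le_mul_of_nonneg_left (hf t ht) (norm_nonneg (u t).toL2)
      linarith
    nlinarith [sq_nonneg (‖(u t).toL2‖ - ε), sq_nonneg ‖(p t).toL2‖]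

end IsWave

/-! ### Multiplication by `x` and the control of boundary traces -/

namespace Sobolev

theorem ev_mk_eqOn {f g : L2 0 1} (h : IsWeakDeriv f g) {G : ℝ → ℝ}
    (hG : ContinuousOn G (Icc 0 1)) (hf : f =ᵐ[volume.restrict (Ioo 0 1)] G) :
    EqOn (mk f g h).ev G (Icc 0 1) :=
  ev_eqOn zero_lt_one hG hf

/-- Product rule for `x f`. The weight kills the left trace and keeps the right one, so `x f` serves
both as a multiplier for trace estimates and as a cut-off in the boundary lift. -/
theorem exists_mul_clamp (f : Sobolev 1 0 1) : ∃ g : Sobolev 1 0 1,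
    g.toL2 = L2.mulL L2.clamp f.toL2 ∧ g.dx = f.toL2 + L2.mulL L2.clamp f.dx ∧
      g.ev 0 = 0 ∧ g.ev 1 = f.ev 1 := by
  have hac : AbsolutelyContinuousOnInterval (fun x => f.ev 0 + L2.prim f.dx x) 0 1 :=
    L2.ac_const_add_prim _ _
  have hid : AbsolutelyContinuousOnInterval (fun x : ℝ => x) 0 1 :=
    L2.ac_of_contDiff contDiff_id
  set F : ℝ → ℝ := fun x => f.ev 0 + L2.prim f.dx x with hF
  have hfF : ∀ x ∈ Icc (0 : ℝ) 1, f.ev x = F x := fun x hx => f.ev_eq_prim zero_lt_one hx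
  have hmul : L2.mulL L2.clamp f.toL2 =ᵐ[volume.restrict (Ioo 0 1)] fun x => x * F x := by
    filter_upwards [L2.coeFn_mulL L2.clamp f.toL2, f.toL2_ae_eq_ev zero_lt_one,
      ae_restrict_mem measurableSet_Ioo] with x h1 h2 h3
    rw [h1, h2, L2.clamp_apply (Ioo_subset_Icc_self h3), hfF x (Ioo_subset_Icc_self h3)]
  have hd : IsWeakDeriv (L2.mulL L2.clamp f.toL2) (f.toL2 + L2.mulL L2.clamp f.dx) := by
    intro φ hφ hc hs
    have key := L2.integral_parts (α := 0) (β := 1) (f := fun x => 1 * F x + x * f.dx x)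
      (g := deriv φ) zero_le_one (hid.fun_mul hac) (L2.ac_of_contDiff hφ)
      ((L2.ae_hasDerivAt_prim f.dx).mono fun x hx => (hasDerivAt_id x).mul (hx.const_add _))
      (Eventually.of_forall fun x => (hφ.differentiable (by simp) x).hasDerivAt)
    rw [eq_zero_of_tsupport_subset_Ioo hs (x := 1) (by simp),
      eq_zero_of_tsupport_subset_Ioo hs (x := 0) (by simp)] at key
    have m1 := memLp_test (α := 0) (β := 1) hφ.continuous hc
    have m2 := memLp_test (α := 0) (β := 1) (hφ.continuous_deriv (by simp)) hc.deriv
    have i1 : IntegrableOn (fun x => (f.toL2 + L2.mulL L2.clamp f.dx) x * φ x) (Ioo 0 1) :=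
      (Lp.memLp (f.toL2 + L2.mulL L2.clamp f.dx)).integrable_mul m1
    have i2 : IntegrableOn (fun x => (L2.mulL L2.clamp f.toL2) x * deriv φ x) (Ioo 0 1) :=
      (Lp.memLp (L2.mulL L2.clamp f.toL2)).integrable_mul m2
    simp only [mul_zero, sub_zero] at key
    rw [eq_neg_iff_add_eq_zero, add_comm, ← integral_add i1 i2]
    refine Eq.trans ?_ key
    refine integral_congr_ae ?_
    filter_upwards [hmul, Lp.coeFn_add f.toL2 (L2.mulL L2.clamp f.dx),
      L2.coeFn_mulL L2.clamp f.dx, f.toL2_ae_eq_ev zero_lt_one,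
      ae_restrict_mem measurableSet_Ioo] with x h1 h2 h3 h4 h5
    rw [h1, h2, Pi.add_apply, h3, h4, L2.clamp_apply (Ioo_subset_Icc_self h5),
      hfF x (Ioo_subset_Icc_self h5), one_mul]
  have hev := ev_mk_eqOn hd (by
    exact (continuous_id.mul (continuous_const.add (L2.continuous_prim _))).continuousOn) hmul
  refine ⟨mk _ _ hd, rfl, rfl, ?_, ?_⟩
  · rw [hev (by simp)]
    simp
  · rw [hev (by simp), hfF 1 (by simp)]
    simp

end Sobolev

namespace IsWave

variable {T : ℝ} {f f₁ f₂ : ℝ → L2 0 1} {p u p₁ u₁ p₂ u₂ : ℝ → Sobolev 1 0 1}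

/-- Integration of `(x g²)' = g² + 2 x g g'` over the interval. -/
theorem inner_mul_clamp_dx (g : Sobolev 1 0 1) :
    inner ℝ (L2.mulL L2.clamp g.dx) g.toL2 = (g.ev 1 ^ 2 - ‖g.toL2‖ ^ 2) / 2 := by
  obtain ⟨G, h1, h2, h3, h4⟩ := g.exists_mul_clamp
  have := Sobolev.inner_dx_add zero_lt_one G g
  rw [h1, h2, h3, h4, inner_add_left, real_inner_self_eq_norm_sq, L2.inner_mulL_left L2.clamp g.toL2,
    real_inner_comm (L2.mulL L2.clamp g.dx) g.toL2] at this
  linarith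

theorem inner_dx (g : Sobolev 1 0 1) :
    inner ℝ g.dx g.toL2 = (g.ev 1 ^ 2 - g.ev 0 ^ 2) / 2 := by
  have := Sobolev.inner_dx_add zero_lt_one g g
  rw [real_inner_comm g.dx g.toL2] at this
  linarith

/-- The multiplier identity that controls boundary traces. -/
theorem hasDerivWithinAt_multiplier (h : IsWave T f p u) {t : ℝ} (ht : t ∈ Icc 0 T)
    (h₀ : (u t).ev 0 = 0) (h₁ : (u t).ev 1 = 0) :
    HasDerivWithinAt (fun s => inner ℝ (L2.mulL L2.clamp (p s).toL2 - (1 / 2 : ℝ) • (p s).toL2)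
        (u s).toL2)
      ((‖(p t).toL2‖ ^ 2 + ‖(u t).toL2‖ ^ 2) / 2 - ((p t).ev 1 ^ 2 + (p t).ev 0 ^ 2) / 4
        - inner ℝ (L2.mulL L2.clamp (p t).toL2 - (1 / 2 : ℝ) • (p t).toL2) (f t)) (Icc 0 T) t := by
  -- The weight `x - 1/2` has opposite signs at the two ends, so the squares of both pressure traces
  -- enter with the same sign and can be estimated by interior quantities.
  have hm : HasDerivWithinAt (fun s => L2.mulL L2.clamp (p s).toL2 - (1 / 2 : ℝ) • (p s).toL2)
      (L2.mulL L2.clamp (-(u t).dx) - (1 / 2 : ℝ) • (-(u t).dx)) (Icc 0 T) t :=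
    ((L2.mulL L2.clamp).hasFDerivAt.comp_hasDerivWithinAt t (h.deriv_p t ht)).sub
      ((h.deriv_p t ht).const_smul (1 / 2 : ℝ))
  refine HasDerivWithinAt.congr_deriv (hm.inner ℝ (h.deriv_u t ht)) ?_
  have e1 := inner_mul_clamp_dx (u t)
  have e2 := inner_dx (u t)
  have e3 := inner_mul_clamp_dx (p t)
  have e4 := inner_dx (p t)
  rw [h₁] at e1
  rw [h₀, h₁] at e2
  have e5 : inner ℝ (L2.mulL L2.clamp (p t).toL2) (p t).dx
      = inner ℝ (L2.mulL L2.clamp (p t).dx) (p t).toL2 := by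
    rw [L2.inner_mulL_left, real_inner_comm]
  simp only [map_neg, inner_sub_left, inner_sub_right, inner_neg_left, inner_neg_right,
    inner_smul_left, smul_neg, e5, e1, e2, e3, real_inner_comm (p t).dx (p t).toL2, e4]
  simp only [conj_trivial]
  ring

theorem norm_multiplier_le (g : L2 0 1) :
    ‖L2.mulL L2.clamp g - (1 / 2 : ℝ) • g‖ ≤ 2 * ‖g‖ := by
  refine (norm_sub_le _ _).trans ?_
  have h1 := (L2.norm_mulL_le L2.clamp g).trans
    (mul_le_mul_of_nonneg_right L2.norm_clamp_le (norm_nonneg g))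
  rw [norm_smul, Real.norm_of_nonneg (by norm_num)]
  linarith [norm_nonneg g]

theorem continuousOn_ev {q : ℝ → Sobolev 1 0 1} {s : Set ℝ} (hq : ContinuousOn q s) {x : ℝ}
    (hx : x ∈ Icc (0 : ℝ) 1) : ContinuousOn (fun t => (q t).ev x) s := by
  intro t ht
  have hc := hq t ht
  rw [ContinuousWithinAt, tendsto_iff_norm_sub_tendsto_zero] at hc ⊢
  have hb : ∀ g : Sobolev 1 0 1, |g.ev x| ≤ 3 * ‖g‖ := by
    intro g
    have := g.abs_ev_le zero_lt_one hx
    simp only [sub_zero, Real.sqrt_one, inv_one, one_mul] at this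
    linarith [g.norm_toL2_le, g.norm_dx_le]
  refine squeeze_zero (fun _ => norm_nonneg _) (fun s => ?_) (by simpa using hc.const_mul 3)
  rw [← Sobolev.ev_sub zero_lt_one _ _ hx, Real.norm_eq_abs]
  exact hb _

/-- Energy and trace estimate for homogeneous data: everything is bounded by the part `ε` of the
source that is not controlled by the solution. -/
theorem exists_bound {T : ℝ} (hT : 0 < T) {K : ℝ} (hK : 0 ≤ K) :
    ∃ C : ℝ, 0 ≤ C ∧ ∀ {f : ℝ → L2 0 1} {p u : ℝ → Sobolev 1 0 1} {ε : ℝ}, IsWave T f p u →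
      (p 0).toL2 = 0 → (u 0).toL2 = 0 → (∀ t ∈ Icc 0 T, (u t).ev 0 = 0) →
      (∀ t ∈ Icc 0 T, (u t).ev 1 = 0) → 0 ≤ ε →
      (∀ t ∈ Icc 0 T, ‖f t‖ ≤ K * ‖(u t).toL2‖ + ε) →
      (∀ t ∈ Icc 0 T, ‖(p t).toL2‖ ≤ C * ε ∧ ‖(u t).toL2‖ ≤ C * ε) ∧
        ∀ y : L2 0 T, IsPressureDrop p y → ‖y‖ ≤ C * ε := by
  -- The Gronwall factor from `energy_le`; with `s = √c` both `L²` norms are at most `s * ε`.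
  set c : ℝ := (Real.exp ((2 * K + 1) * T) - 1) / (2 * K + 1) with hc
  have hc0 : 0 ≤ c := by
    have : 1 ≤ Real.exp ((2 * K + 1) * T) := Real.one_le_exp (by positivity)
    exact div_nonneg (by linarith) (by positivity)
  set s := √c with hs
  have hs0 : 0 ≤ s := Real.sqrt_nonneg _
  -- Obtained by integrating the multiplier identity over `[0, T]`: the first summand bounds the
  -- interior terms, the second the multiplier functional at time `T`. The factor 8 combines the
  -- weight `1/4` of the traces with `(y - z)² ≤ 2 (y² + z²)`.
  set B : ℝ := 8 * (T * (s ^ 2 / 2 + 2 * s * (K * s + 1)) + 2 * s ^ 2) with hB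
  have hB0 : 0 ≤ B := by positivity
  refine ⟨s + √B, by positivity, ?_⟩
  intro f p u ε h hp hu h₀ h₁ hε hf
  have hE : ∀ t ∈ Icc 0 T, ‖(p t).toL2‖ ^ 2 + ‖(u t).toL2‖ ^ 2 ≤ (s * ε) ^ 2 := by
    intro t ht
    refine (h.energy_le hp hu h₀ h₁ hK hf ht).trans (le_of_eq ?_)
    rw [mul_pow, hs, Real.sq_sqrt hc0]
    ring
  have hpb : ∀ t ∈ Icc 0 T, ‖(p t).toL2‖ ≤ s * ε := fun t ht =>
    abs_le_of_sq_le_sq' (by linarith [hE t ht, sq_nonneg ‖(u t).toL2‖]) (by positivity) |>.2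
  have hub : ∀ t ∈ Icc 0 T, ‖(u t).toL2‖ ≤ s * ε := fun t ht =>
    abs_le_of_sq_le_sq' (by linarith [hE t ht, sq_nonneg ‖(p t).toL2‖]) (by positivity) |>.2
  have hle : ∀ x, x ≤ s * ε → x ≤ (s + √B) * ε := fun x hx =>
    hx.trans (mul_le_mul_of_nonneg_right (by linarith [Real.sqrt_nonneg B]) hε)
  refine ⟨fun t ht => ⟨hle _ (hpb t ht), hle _ (hub t ht)⟩, fun y hy => ?_⟩
  have cp := h.continuousOn_toL2_p
  have cu := h.continuousOn_toL2_u
  have ce0 := continuousOn_ev h.continuousOn_p (x := 0) (by simp)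
  have ce1 := continuousOn_ev h.continuousOn_p (x := 1) (by simp)
  have cm : ContinuousOn (fun s => L2.mulL L2.clamp (p s).toL2 - (1 / 2 : ℝ) • (p s).toL2)
      (Icc 0 T) := ((L2.mulL L2.clamp).continuous.comp_continuousOn cp).sub
      (cp.const_smul (1 / 2 : ℝ))
  have hint := integral_eq_sub hT.le
    (fun t ht => h.hasDerivWithinAt_multiplier ht (h₀ t ht) (h₁ t ht))
    ((((cp.norm.pow 2).add (cu.norm.pow 2)).div_const 2).sub
      (((ce1.pow 2).add (ce0.pow 2)).div_const 4) |>.sub (cm.inner h.continuousOn_f))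
  simp only [hp, hu, inner_zero_right, sub_zero] at hint
  set X := inner ℝ (L2.mulL L2.clamp (p T).toL2 - (1 / 2 : ℝ) • (p T).toL2) (u T).toL2 with hX
  have hTm : T ∈ Icc 0 T := right_mem_Icc.2 hT.le
  have hXb : |X| ≤ 2 * (s * ε) * (s * ε) := by
    refine (abs_real_inner_le_norm _ _).trans ?_
    gcongr
    · exact (norm_multiplier_le _).trans (by linarith [hpb T hTm])
    · exact hub T hTm
  set M : ℝ := (s * ε) ^ 2 / 2 + 2 * (s * ε) * (K * (s * ε) + ε) with hM
  have hpt : ∀ t ∈ Icc 0 T, ((p t).ev 0 - (p t).ev 1) ^ 2 ≤ 8 * (M -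
      ((‖(p t).toL2‖ ^ 2 + ‖(u t).toL2‖ ^ 2) / 2 - ((p t).ev 1 ^ 2 + (p t).ev 0 ^ 2) / 4
        - inner ℝ (L2.mulL L2.clamp (p t).toL2 - (1 / 2 : ℝ) • (p t).toL2) (f t))) := by
    intro t ht
    have h1 : |inner ℝ (L2.mulL L2.clamp (p t).toL2 - (1 / 2 : ℝ) • (p t).toL2) (f t)|
        ≤ 2 * (s * ε) * (K * (s * ε) + ε) := by
      refine (abs_real_inner_le_norm _ _).trans ?_
      gcongr
      · exact (norm_multiplier_le _).trans (by linarith [hpb t ht])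
      · refine (hf t ht).trans ?_
        gcongr
        exact hub t ht
    nlinarith [hE t ht, (abs_le.1 h1).1, sq_nonneg ((p t).ev 0 + (p t).ev 1)]
  have hy2 : ‖y‖ ^ 2 = ∫ t in (0 : ℝ)..T, ((p t).ev 0 - (p t).ev 1) ^ 2 := by
    rw [← real_inner_self_eq_norm_sq, ← L2.integral_Ioo_mul,
      intervalIntegral.integral_of_le hT.le, integral_Ioc_eq_integral_Ioo]
    refine integral_congr_ae ?_
    filter_upwards [hy] with t ht
    rw [ht, sq]
  have hle2 : ‖y‖ ^ 2 ≤ 8 * (M * T - X) := by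
    rw [hy2, ← hint]
    have ic : ContinuousOn (fun t => (‖(p t).toL2‖ ^ 2 + ‖(u t).toL2‖ ^ 2) / 2
        - ((p t).ev 1 ^ 2 + (p t).ev 0 ^ 2) / 4
        - inner ℝ (L2.mulL L2.clamp (p t).toL2 - (1 / 2 : ℝ) • (p t).toL2) (f t)) (Icc 0 T) :=
      ((((cp.norm.pow 2).add (cu.norm.pow 2)).div_const 2).sub
      (((ce1.pow 2).add (ce0.pow 2)).div_const 4) |>.sub (cm.inner h.continuousOn_f))
    have ii := (uIcc_of_le hT.le ▸ ic : ContinuousOn _ (uIcc 0 T)).intervalIntegrable (μ := volume)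
    have e : M * T = ∫ t in (0 : ℝ)..T, M := by simp [mul_comm]
    rw [e, ← intervalIntegral.integral_sub (by simp) ii, ← intervalIntegral.integral_const_mul]
    refine intervalIntegral.integral_mono_on hT.le ?_ ?_ hpt
    · exact (uIcc_of_le hT.le ▸ ((ce0.sub ce1).pow 2) :
        ContinuousOn _ (uIcc 0 T)).intervalIntegrable
    · exact (intervalIntegrable_const.sub ii).const_mul 8
  have hfin : ‖y‖ ^ 2 ≤ (√B * ε) ^ 2 := by
    rw [mul_pow, Real.sq_sqrt hB0]
    refine hle2.trans ?_
    have : B * ε ^ 2 = 8 * (M * T + 2 * (s * ε) * (s * ε)) := by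
      rw [hB, hM]
      ring
    rw [this]
    linarith [(abs_le.1 hXb).1]
  have := abs_le_of_sq_le_sq' hfin (by positivity) |>.2
  exact this.trans (mul_le_mul_of_nonneg_right (by linarith) hε)

end IsWave

/-! ### Even and odd reflections on the circle of length two -/

theorem fact_zero_lt_two : Fact ((0 : ℝ) < 2) := ⟨two_pos⟩

attribute [instance] fact_zero_lt_two

/-- The circle of length two. -/
abbrev Circ : Type := AddCircle (2 : ℝ)

/-- The space `L²` of the circle, with normalized measure. -/
abbrev LCirc : Type := Lp ℝ 2 (AddCircle.haarAddCircle : Measure Circ)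

namespace Circ

theorem norm_coe {y : ℝ} (hy : y ∈ Icc (-1 : ℝ) 1) : ‖(y : Circ)‖ = |y| := by
  rw [AddCircle.norm_coe_eq_abs_iff _ two_ne_zero]
  rw [abs_le]
  constructor <;> norm_num <;> [exact hy.1; exact hy.2]

theorem exists_coe (x : Circ) : ∃ y ∈ Ioc (-1 : ℝ) 1, (y : Circ) = x := by
  have : x ∈ ((↑) : ℝ → Circ) '' Ioc (-1) (-1 + 2) := by
    rw [AddCircle.coe_image_Ioc_eq]
    trivial
  obtain ⟨y, hy, rfl⟩ := this
  exact ⟨y, ⟨hy.1, by linarith [hy.2]⟩, rfl⟩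

/-- On representatives in `(-1, 1]` the norm is the absolute value, so the circle is folded twice
onto the unit interval. The normalized measure compensates for the factor two, which makes the
reflections isometric. -/
theorem measurePreserving_norm :
    MeasurePreserving (fun x : Circ => ‖x‖) AddCircle.haarAddCircle
      (volume.restrict (Ioo (0 : ℝ) 1)) := by
  refine ⟨continuous_norm.measurable, Measure.ext fun S hS => ?_⟩
  rw [Measure.map_apply continuous_norm.measurable hS, Measure.restrict_apply hS]
  have h1 : volume ((fun x : Circ => ‖x‖) ⁻¹' S) = 2 * volume (S ∩ Ioo 0 1) := by
    rw [AddCircle.add_projection_respects_measure 2 (-1) (continuous_norm.measurable hS)]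
    have e : (QuotientAddGroup.mk ⁻¹' ((fun x : Circ => ‖x‖) ⁻¹' S) ∩ Ioc (-1 : ℝ) (-1 + 2))
        = (S ∩ Ioc 0 1) ∪ (Neg.neg ⁻¹' (S ∩ Ico 0 1)) := by
      ext y
      simp only [mem_inter_iff, mem_preimage, mem_Ioc, mem_union, mem_Ico]
      constructor
      · rintro ⟨hy, h2, h3⟩
        have hn := norm_coe (y := y) ⟨h2.le, by linarith⟩
        change ‖(y : Circ)‖ ∈ S at hy
        rw [hn] at hy
        rcases lt_or_ge 0 y with h | h
        · rw [abs_of_pos h] at hy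
          exact Or.inl ⟨hy, h, by linarith⟩
        · rw [abs_of_nonpos h] at hy
          exact Or.inr ⟨hy, by linarith, by linarith⟩
      · rintro (⟨hy, h2, h3⟩ | ⟨hy, h2, h3⟩)
        · refine ⟨?_, by linarith, by linarith⟩
          change ‖(y : Circ)‖ ∈ S
          rwa [norm_coe ⟨by linarith, h3⟩, abs_of_pos h2]
        · refine ⟨?_, by linarith, by linarith⟩
          change ‖(y : Circ)‖ ∈ S
          rwa [norm_coe ⟨by linarith, by linarith⟩, abs_of_nonpos (by linarith)]
    rw [e, measure_union, Measure.measure_preimage_neg, two_mul]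
    · congr 1
      · exact measure_congr (ae_eq_set_inter (ae_eq_refl _) Ioo_ae_eq_Ioc.symm)
      · exact measure_congr (ae_eq_set_inter (ae_eq_refl _) Ioo_ae_eq_Ico.symm)
    · rw [Set.disjoint_left]
      rintro y ⟨-, h1, -⟩ ⟨-, h2, -⟩
      linarith
    · exact measurable_neg (hS.inter measurableSet_Ico)
  rw [AddCircle.volume_eq_smul_haarAddCircle, Measure.smul_apply, smul_eq_mul,
    ENNReal.ofReal_ofNat] at h1
  exact (ENNReal.mul_right_inj two_ne_zero ENNReal.ofNat_ne_top).1 h1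

theorem toCircle_re (y : ℝ) : (AddCircle.toCircle (y : Circ) : ℂ).re = Real.cos (Real.pi * y) := by
  rw [AddCircle.toCircle_apply_mk, Circle.coe_exp, Complex.exp_ofReal_mul_I_re]
  ring_nf

theorem toCircle_im (y : ℝ) : (AddCircle.toCircle (y : Circ) : ℂ).im = Real.sin (Real.pi * y) := by
  rw [AddCircle.toCircle_apply_mk, Circle.coe_exp, Complex.exp_ofReal_mul_I_im]
  ring_nf

theorem continuous_re : Continuous fun x : Circ => (AddCircle.toCircle x : ℂ).re :=
  Complex.continuous_re.comp (continuous_subtype_val.comp AddCircle.continuous_toCircle)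

theorem continuous_im : Continuous fun x : Circ => (AddCircle.toCircle x : ℂ).im :=
  Complex.continuous_im.comp (continuous_subtype_val.comp AddCircle.continuous_toCircle)

theorem re_eq_cos_norm (x : Circ) :
    (AddCircle.toCircle x : ℂ).re = Real.cos (Real.pi * ‖x‖) := by
  obtain ⟨y, hy, rfl⟩ := exists_coe x
  rw [toCircle_re, norm_coe (Ioc_subset_Icc_self hy)]
  rcases abs_cases y with ⟨h, -⟩ | ⟨h, -⟩ <;> rw [h]
  rw [mul_neg, Real.cos_neg]

/-- The sign of the imaginary part. -/
def sgn (x : Circ) : ℝ := if 0 ≤ (AddCircle.toCircle x : ℂ).im then 1 else -1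

theorem sgn_mul_self (x : Circ) : sgn x * sgn x = 1 := by
  unfold sgn
  split_ifs <;> norm_num

theorem norm_sgn (x : Circ) : ‖sgn x‖ = 1 := by
  unfold sgn
  split_ifs <;> norm_num

theorem measurable_sgn : Measurable sgn :=
  Measurable.ite (measurableSet_le measurable_const continuous_im.measurable) measurable_const
    measurable_const

theorem sgn_coe_of_nonneg {y : ℝ} (hy : y ∈ Icc (0 : ℝ) 1) : sgn (y : Circ) = 1 := by
  unfold sgn
  rw [toCircle_im, if_pos]
  exact Real.sin_nonneg_of_nonneg_of_le_pi (by have := hy.1; positivity)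
    (by nlinarith [hy.2, Real.pi_pos])

theorem sgn_coe_of_neg {y : ℝ} (hy : y ∈ Ioo (-1 : ℝ) 0) : sgn (y : Circ) = -1 := by
  unfold sgn
  rw [toCircle_im, if_neg]
  rw [not_le]
  exact Real.sin_neg_of_neg_of_neg_pi_lt (by nlinarith [hy.2, Real.pi_pos])
    (by nlinarith [hy.1, Real.pi_pos])

theorem im_eq_sgn_mul (x : Circ) :
    (AddCircle.toCircle x : ℂ).im = sgn x * Real.sin (Real.pi * ‖x‖) := by
  obtain ⟨y, hy, rfl⟩ := exists_coe x
  rw [norm_coe (Ioc_subset_Icc_self hy), toCircle_im]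
  rcases lt_or_ge y 0 with h | h
  · rw [sgn_coe_of_neg ⟨hy.1, h⟩, abs_of_neg h, mul_neg, Real.sin_neg]
    ring
  · rw [sgn_coe_of_nonneg ⟨h, hy.2⟩, abs_of_nonneg h, one_mul]

/-- Even extension of functions on `(0, 1)`. -/
def even : L2 0 1 →ₗᵢ[ℝ] LCirc :=
  Lp.compMeasurePreservingₗᵢ ℝ (fun x : Circ => ‖x‖) measurePreserving_norm

theorem coeFn_even (f : L2 0 1) :
    even f =ᵐ[AddCircle.haarAddCircle] fun x : Circ => f ‖x‖ :=
  Lp.coeFn_compMeasurePreserving f measurePreserving_norm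

theorem memLp_sgn : MemLp sgn ⊤ (AddCircle.haarAddCircle : Measure Circ) :=
  memLp_top_of_bound measurable_sgn.aestronglyMeasurable 1
    (Eventually.of_forall fun x => (norm_sgn x).le)

/-- Odd extension of functions on `(0, 1)`. -/
def odd : L2 0 1 →L[ℝ] LCirc :=
  ((ContinuousLinearMap.mul ℝ ℝ).holderL AddCircle.haarAddCircle ⊤ 2 2 (memLp_sgn.toLp sgn)).comp
    even.toContinuousLinearMap

theorem coeFn_odd (f : L2 0 1) :
    odd f =ᵐ[AddCircle.haarAddCircle] fun x : Circ => sgn x * f ‖x‖ := by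
  have h := (ContinuousLinearMap.mul ℝ ℝ).coeFn_holder (r := 2) (memLp_sgn.toLp sgn) (even f)
  filter_upwards [h, coeFn_even f, memLp_sgn.coeFn_toLp] with x h1 h2 h3
  change ((ContinuousLinearMap.mul ℝ ℝ).holder 2 (memLp_sgn.toLp sgn) (even f)) x = _
  rw [h1, h2, h3]
  rfl

theorem inner_even_even (f g : L2 0 1) : inner ℝ (even f) (even g) = inner ℝ f g :=
  even.inner_map_map f g

theorem inner_odd_odd (f g : L2 0 1) : inner ℝ (odd f) (odd g) = inner ℝ f g := by
  rw [← inner_even_even, L2.inner_def, L2.inner_def]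
  refine integral_congr_ae ?_
  filter_upwards [coeFn_even f, coeFn_even g, coeFn_odd f, coeFn_odd g] with x h1 h2 h3 h4
  rw [h1, h2, h3, h4]
  simp only [RCLike.inner_apply, conj_trivial]
  linear_combination (f ‖x‖ * g ‖x‖) * sgn_mul_self x

theorem ae_norm_mem : ∀ᵐ x ∂(AddCircle.haarAddCircle : Measure Circ), ‖x‖ ∈ Ioo (0 : ℝ) 1 :=
  measurePreserving_norm.quasiMeasurePreserving.ae (ae_restrict_mem measurableSet_Ioo)

theorem sgn_neg {x : Circ} (hx : ‖x‖ ∈ Ioo (0 : ℝ) 1) : sgn (-x) = -sgn x := by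
  obtain ⟨y, hy, rfl⟩ := exists_coe x
  rw [norm_coe (Ioc_subset_Icc_self hy)] at hx
  have hy0 : y ≠ 0 := fun h => by simp [h] at hx
  have hy1 : y ≠ 1 := fun h => by simp [h] at hx
  have hy2 : y < 1 := lt_of_le_of_ne hy.2 hy1
  rw [← AddCircle.coe_neg]
  rcases lt_or_gt_of_ne hy0 with h | h
  · rw [sgn_coe_of_neg ⟨hy.1, h⟩, sgn_coe_of_nonneg ⟨by linarith, by linarith [hy.1]⟩, neg_neg]
  · rw [sgn_coe_of_neg ⟨by linarith, by linarith⟩, sgn_coe_of_nonneg ⟨h.le, hy.2⟩]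

/-- The integrand is odd under the measure-preserving map `x ↦ -x`. The function `sgn` fails to be
odd only at the two fixed points of this map, a null set. -/
theorem inner_even_odd (f g : L2 0 1) : inner ℝ (even f) (odd g) = 0 := by
  rw [L2.inner_def]
  have e : ∫ x, inner ℝ ((even f) x) ((odd g) x) ∂(AddCircle.haarAddCircle : Measure Circ)
      = ∫ x, sgn x * (f ‖x‖ * g ‖x‖) ∂(AddCircle.haarAddCircle : Measure Circ) := by
    refine integral_congr_ae ?_
    filter_upwards [coeFn_even f, coeFn_odd g] with x h1 h2
    rw [h1, h2]
    simp only [RCLike.inner_apply, conj_trivial]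
    ring
  rw [e]
  have e2 : ∫ x, sgn x * (f ‖x‖ * g ‖x‖) ∂(AddCircle.haarAddCircle : Measure Circ)
      = -∫ x, sgn x * (f ‖x‖ * g ‖x‖) ∂(AddCircle.haarAddCircle : Measure Circ) := by
    rw [← integral_neg]
    rw [← integral_neg_eq_self]
    refine integral_congr_ae ?_
    filter_upwards [ae_norm_mem] with x hx
    rw [sgn_neg hx, norm_neg]
    ring
  linarith

theorem inner_odd_even (f g : L2 0 1) : inner ℝ (odd f) (even g) = 0 := by
  rw [real_inner_comm, inner_even_odd]

/-- Translation on the circle. -/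
def shift (t : ℝ) : LCirc →ₗᵢ[ℝ] LCirc :=
  Lp.compMeasurePreservingₗᵢ ℝ (fun x : Circ => x + (t : Circ))
    (measurePreserving_add_right AddCircle.haarAddCircle (t : Circ))

theorem shift_add (s t : ℝ) (z : LCirc) : shift s (shift t z) = shift (s + t) z := by
  have h := Lp.compMeasurePreserving_comp_apply (E := ℝ) (p := 2) z
    (measurePreserving_add_right AddCircle.haarAddCircle (t : Circ))
    (measurePreserving_add_right AddCircle.haarAddCircle (s : Circ))
  refine Eq.trans h.symm ?_
  have e : ((fun x : Circ => x + (t : Circ)) ∘ fun x : Circ => x + (s : Circ))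
      = fun x : Circ => x + ((s + t : ℝ) : Circ) := by
    ext x
    simp [add_assoc]
  change Lp.compMeasurePreserving _ _ z = Lp.compMeasurePreserving _ _ z
  congr 1
  congr 1

theorem shift_zero (z : LCirc) : shift 0 z = z := by
  have h : shift 0 (shift 0 z) = shift 0 z := by rw [shift_add, add_zero]
  exact (shift 0).injective h

theorem inner_shift_left (t : ℝ) (z w : LCirc) :
    inner ℝ (shift t z) w = inner ℝ z (shift (-t) w) := by
  have : w = shift t (shift (-t) w) := by rw [shift_add, add_neg_cancel, shift_zero]
  conv_lhs => rw [this]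
  exact (shift t).inner_map_map _ _

theorem continuousOn_shift {s : Set ℝ} {g : ℝ → ℝ} {Z : ℝ → LCirc} (hg : Continuous g)
    (hZ : ContinuousOn Z s) : ContinuousOn (fun t => shift (g t) (Z t)) s := by
  let G : ℝ → C(Circ, Circ) := fun t => ⟨fun x => x + (g t : Circ), by fun_prop⟩
  have hG : Continuous G := by
    refine ContinuousMap.continuous_of_continuous_uncurry _ ?_
    change Continuous fun q : ℝ × Circ => q.2 + (g q.1 : Circ)
    exact continuous_snd.add ((AddCircle.continuous_mk' 2).comp (hg.comp continuous_fst))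
  exact hZ.compMeasurePreservingLp hG.continuousOn
    (fun t => measurePreserving_add_right AddCircle.haarAddCircle (g t : Circ)) (by norm_num)

theorem shift_toLp (t : ℝ) (Φ : C(Circ, ℝ)) :
    shift t (ContinuousMap.toLp 2 AddCircle.haarAddCircle ℝ Φ)
      = ContinuousMap.toLp 2 AddCircle.haarAddCircle ℝ
        (Φ.comp ⟨fun x => x + (t : Circ), by fun_prop⟩) := by
  have hmp := measurePreserving_add_right AddCircle.haarAddCircle (t : Circ)
  have h1 := ContinuousMap.coeFn_toLp (p := 2) (𝕜 := ℝ) AddCircle.haarAddCircle Φ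
  have h2 := hmp.quasiMeasurePreserving.ae_eq_comp h1
  have h3 := Lp.coeFn_compMeasurePreserving
    (ContinuousMap.toLp 2 AddCircle.haarAddCircle ℝ Φ) hmp
  have h4 := ContinuousMap.coeFn_toLp (p := 2) (𝕜 := ℝ) AddCircle.haarAddCircle
    (Φ.comp ⟨fun x => x + (t : Circ), by fun_prop⟩)
  exact Lp.ext ((h3.trans h2).trans h4.symm)

/-- The difference quotients converge in the supremum norm: `Ψ` is uniformly continuous on the
compact circle, so the mean value inequality for `s ↦ Φ(y + s) - s Ψ(y + t)` has an error
independent of `y`. -/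
theorem hasDerivAt_translate {Φ Ψ : C(Circ, ℝ)}
    (h : ∀ y : ℝ, HasDerivAt (fun y : ℝ => Φ (y : Circ)) (Ψ (y : Circ)) y) (t : ℝ) :
    HasDerivAt (fun t : ℝ => (Φ.comp ⟨fun x => x + (t : Circ), by fun_prop⟩ : C(Circ, ℝ)))
      (Ψ.comp ⟨fun x => x + (t : Circ), by fun_prop⟩) t := by
  rw [hasDerivAt_iff_isLittleO, Asymptotics.isLittleO_iff]
  intro ε hε
  obtain ⟨δ, hδ, hu⟩ := Metric.uniformContinuous_iff.1
    (CompactSpace.uniformContinuous_of_continuous Ψ.continuous) ε hε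
  filter_upwards [Metric.ball_mem_nhds t hδ] with r hr
  rw [ContinuousMap.norm_le _ (by positivity)]
  intro x
  obtain ⟨y, rfl⟩ := QuotientAddGroup.mk_surjective x
  have hcx : Convex ℝ (Metric.ball t δ) := convex_ball t δ
  have key := hcx.norm_image_sub_le_of_norm_hasDerivWithin_le (C := ε)
    (f := fun s : ℝ => Φ ((y + s : ℝ) : Circ) - s * Ψ ((y + t : ℝ) : Circ))
    (f' := fun s : ℝ => Ψ ((y + s : ℝ) : Circ) - 1 * Ψ ((y + t : ℝ) : Circ))
    (fun s _ => (((h (y + s)).comp_const_add y s).sub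
      ((hasDerivAt_id s).mul_const _)).hasDerivWithinAt)
    (fun s hs => by
      rw [one_mul, ← dist_eq_norm]
      refine (hu ?_).le
      rw [dist_eq_norm, ← AddCircle.coe_sub, add_sub_add_left_eq_sub]
      exact (QuotientAddGroup.norm_mk_le_norm).trans_lt (by simpa [Real.dist_eq] using hs)) (Metric.mem_ball_self hδ) hr
  refine le_trans (le_of_eq ?_) key
  congr 1
  simp only [ContinuousMap.sub_apply, ContinuousMap.comp_apply, ContinuousMap.coe_mk,
    ContinuousMap.smul_apply, smul_eq_mul, AddCircle.coe_add]
  change Φ ((y : Circ) + (r : Circ)) - Φ ((y : Circ) + (t : Circ))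
    - (r - t) * Ψ ((y : Circ) + (t : Circ)) = _
  ring

theorem hasDerivAt_shift_toLp {Φ Ψ : C(Circ, ℝ)}
    (h : ∀ y : ℝ, HasDerivAt (fun y : ℝ => Φ (y : Circ)) (Ψ (y : Circ)) y) (t : ℝ) :
    HasDerivAt (fun t : ℝ => shift t (ContinuousMap.toLp 2 AddCircle.haarAddCircle ℝ Φ))
      (shift t (ContinuousMap.toLp 2 AddCircle.haarAddCircle ℝ Ψ)) t := by
  simp only [shift_toLp]
  exact (ContinuousMap.toLp 2 AddCircle.haarAddCircle ℝ).hasFDerivAt.comp_hasDerivAt t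
    (hasDerivAt_translate h t)

/-- `η'` is the derivative of a function `η` whose even extension is smooth on the circle. -/
def EvenTest (η η' : L2 0 1) : Prop :=
  ∀ t, HasDerivAt (fun t : ℝ => shift t (even η)) (shift t (odd η')) t

/-- `θ'` is the derivative of a function `θ` whose odd extension is smooth on the circle. -/
def OddTest (θ θ' : L2 0 1) : Prop :=
  ∀ t, HasDerivAt (fun t : ℝ => shift t (odd θ)) (shift t (even θ')) t

theorem even_eq_toLp {f : L2 0 1} {φ : ℝ → ℝ} (hf : f =ᵐ[volume.restrict (Ioo 0 1)] φ)
    {Φ : C(Circ, ℝ)} (hΦ : ∀ x : Circ, Φ x = φ ‖x‖) :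
    even f = ContinuousMap.toLp 2 AddCircle.haarAddCircle ℝ Φ := by
  refine Lp.ext ?_
  filter_upwards [coeFn_even f, measurePreserving_norm.quasiMeasurePreserving.ae_eq_comp hf,
    ContinuousMap.coeFn_toLp (p := 2) (𝕜 := ℝ) AddCircle.haarAddCircle Φ] with x h1 h2 h3
  rw [h1, h3, hΦ]
  exact h2

theorem odd_eq_toLp {f : L2 0 1} {φ : ℝ → ℝ} (hf : f =ᵐ[volume.restrict (Ioo 0 1)] φ)
    {Φ : C(Circ, ℝ)} (hΦ : ∀ x : Circ, Φ x = sgn x * φ ‖x‖) :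
    odd f = ContinuousMap.toLp 2 AddCircle.haarAddCircle ℝ Φ := by
  refine Lp.ext ?_
  filter_upwards [coeFn_odd f, measurePreserving_norm.quasiMeasurePreserving.ae_eq_comp hf,
    ContinuousMap.coeFn_toLp (p := 2) (𝕜 := ℝ) AddCircle.haarAddCircle Φ] with x h1 h2 h3
  rw [h1, h3, hΦ]
  congr 1

/-- A function of `cos (π y)` is even and 2-periodic, so it is differentiable on the circle without
conditions at the ends. Such functions need not vanish at 0 and 1, and this lets them detect
boundary values. -/
theorem evenTest_cos {η η' : L2 0 1} {H h : ℝ → ℝ} (hH : ∀ c, HasDerivAt H (h c) c)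
    (hh : Continuous h)
    (hη : η =ᵐ[volume.restrict (Ioo 0 1)] fun y => H (Real.cos (Real.pi * y)))
    (hη' : η' =ᵐ[volume.restrict (Ioo 0 1)]
      fun y => -(Real.pi * (Real.sin (Real.pi * y) * h (Real.cos (Real.pi * y))))) :
    EvenTest η η' := by
  have hHc : Continuous H := continuous_iff_continuousAt.2 fun c => (hH c).continuousAt
  let Φ : C(Circ, ℝ) := ⟨fun x => H (AddCircle.toCircle x : ℂ).re, hHc.comp continuous_re⟩
  let Ψ : C(Circ, ℝ) := ⟨fun x => -(Real.pi * ((AddCircle.toCircle x : ℂ).im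
    * h (AddCircle.toCircle x : ℂ).re)),
    (continuous_const.mul (continuous_im.mul (hh.comp continuous_re))).neg⟩
  have h1 : even η = ContinuousMap.toLp 2 AddCircle.haarAddCircle ℝ Φ :=
    even_eq_toLp hη fun x => by simp only [Φ, ContinuousMap.coe_mk, re_eq_cos_norm]
  have h2 : odd η' = ContinuousMap.toLp 2 AddCircle.haarAddCircle ℝ Ψ :=
    odd_eq_toLp hη' fun x => by
      simp only [Ψ, ContinuousMap.coe_mk, re_eq_cos_norm, im_eq_sgn_mul]
      ring
  intro t
  rw [h1, h2]
  refine hasDerivAt_shift_toLp (fun y => ?_) t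
  simp only [Φ, Ψ, ContinuousMap.coe_mk, toCircle_re, toCircle_im]
  have h3 : HasDerivAt (fun y : ℝ => Real.cos (Real.pi * y)) (-Real.sin (Real.pi * y) * Real.pi) y := by
    have := ((hasDerivAt_id y).const_mul Real.pi)
    simp only [mul_one, id] at this
    exact this.cos
  refine ((hH (Real.cos (Real.pi * y))).comp y h3).congr_deriv ?_
  ring

/-- The odd extension is built as the primitive `I` of the even extension of `deriv φ`, which makes
its derivative evident. It is periodic because the integral over one period is `I 1 - I (-1) = 2 * φ
1 = 0`. -/
theorem oddTest_of_contDiff {θ θ' : L2 0 1} {φ : ℝ → ℝ} (hφ : ContDiff ℝ ∞ φ)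
    (hs : tsupport φ ⊆ Ioo 0 1) (hθ : θ =ᵐ[volume.restrict (Ioo 0 1)] φ)
    (hθ' : θ' =ᵐ[volume.restrict (Ioo 0 1)] deriv φ) : OddTest θ θ' := by
  have hdc : Continuous (deriv φ) := hφ.continuous_deriv (by simp)
  have h0 : φ 0 = 0 := eq_zero_of_tsupport_subset_Ioo hs (by simp)
  have h1 : φ 1 = 0 := eq_zero_of_tsupport_subset_Ioo hs (by simp)
  have hd : ∀ y, HasDerivAt φ (deriv φ y) y := fun y =>
    (hφ.differentiable (by simp) y).hasDerivAt
  let Ψ : C(Circ, ℝ) := ⟨fun x => deriv φ ‖x‖, hdc.comp continuous_norm⟩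
  have hΨc : Continuous fun s : ℝ => Ψ (s : Circ) :=
    Ψ.continuous.comp (AddCircle.continuous_mk' 2)
  let I : ℝ → ℝ := fun y => ∫ s in (0 : ℝ)..y, Ψ (s : Circ)
  have hI : ∀ y : ℝ, HasDerivAt I (Ψ (y : Circ)) y := fun y =>
    intervalIntegral.integral_hasDerivAt_right (hΨc.intervalIntegrable _ _)
      (hΨc.stronglyMeasurableAtFilter _ _) hΨc.continuousAt
  have hIpos : ∀ y ∈ Icc (0 : ℝ) 1, I y = φ y := by
    intro y hy
    have : I y = ∫ s in (0 : ℝ)..y, deriv φ s := by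
      refine intervalIntegral.integral_congr fun s hs => ?_
      rw [uIcc_of_le hy.1] at hs
      simp only [Ψ, ContinuousMap.coe_mk]
      rw [norm_coe ⟨by linarith [hs.1], hs.2.trans hy.2⟩, abs_of_nonneg hs.1]
    rw [this, intervalIntegral.integral_eq_sub_of_hasDerivAt (fun s _ => hd s)
      (hdc.intervalIntegrable _ _), h0, sub_zero]
  have hIneg : ∀ y ∈ Icc (-1 : ℝ) 0, I y = -φ (-y) := by
    intro y hy
    have : I y = ∫ s in (0 : ℝ)..y, deriv φ (-s) := by
      refine intervalIntegral.integral_congr fun s hs => ?_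
      rw [uIcc_of_ge hy.2] at hs
      simp only [Ψ, ContinuousMap.coe_mk]
      rw [norm_coe ⟨by linarith [hs.1, hy.1], by linarith [hs.2]⟩, abs_of_nonpos hs.2]
    rw [this, intervalIntegral.integral_comp_neg, intervalIntegral.integral_eq_sub_of_hasDerivAt
      (fun s _ => hd s) (hdc.intervalIntegrable _ _), neg_zero, h0, zero_sub]
  have hper : Function.Periodic I 2 := by
    intro y
    have hp : Function.Periodic (fun s : ℝ => Ψ (s : Circ)) 2 := by
      intro s
      simp only [AddCircle.coe_add_period]
    have e : I (y + 2) = I y + ∫ s in y..(y + 2), Ψ (s : Circ) :=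
      (intervalIntegral.integral_add_adjacent_intervals (hΨc.intervalIntegrable _ _)
        (hΨc.intervalIntegrable _ _)).symm
    have e2 : ∫ s in y..(y + 2), Ψ (s : Circ) = ∫ s in (-1 : ℝ)..(-1 + 2), Ψ (s : Circ) :=
      hp.intervalIntegral_add_eq y (-1)
    have e3 : ∫ s in (-1 : ℝ)..(-1 + 2), Ψ (s : Circ) = I 1 - I (-1) := by
      rw [show (-1 : ℝ) + 2 = 1 by norm_num]
      exact (intervalIntegral.integral_interval_sub_left (hΨc.intervalIntegrable _ _)
        (hΨc.intervalIntegrable _ _)).symm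
    rw [e, e2, e3, hIpos 1 (by simp), hIneg (-1) (by simp), neg_neg, h1]
    simp
  have hIc : Continuous I := continuous_iff_continuousAt.2 fun y => (hI y).continuousAt
  let Φ : C(Circ, ℝ) := ⟨hper.lift, continuous_coinduced_dom.mpr hIc⟩
  have hΦ : ∀ y : ℝ, Φ (y : Circ) = I y := fun y => rfl
  have e1 : odd θ = ContinuousMap.toLp 2 AddCircle.haarAddCircle ℝ Φ := by
    refine odd_eq_toLp hθ fun x => ?_
    obtain ⟨y, hy, rfl⟩ := exists_coe x
    rw [hΦ, norm_coe (Ioc_subset_Icc_self hy)]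
    rcases lt_or_ge y 0 with h | h
    · rw [sgn_coe_of_neg ⟨hy.1, h⟩, abs_of_neg h, hIneg y ⟨hy.1.le, h.le⟩]
      ring
    · rw [sgn_coe_of_nonneg ⟨h, hy.2⟩, abs_of_nonneg h, hIpos y ⟨h, hy.2⟩, one_mul]
  have e2 : even θ' = ContinuousMap.toLp 2 AddCircle.haarAddCircle ℝ Ψ :=
    even_eq_toLp hθ' fun x => rfl
  intro t
  rw [e1, e2]
  exact hasDerivAt_shift_toLp (Φ := Φ) (Ψ := Ψ) hI t

/-- A velocity that is tested against all even functions has zero boundary values. -/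
theorem ae_eq_neg_prim_of_evenTest {a b : L2 0 1}
    (h : ∀ η η', EvenTest η η' → inner ℝ b η = inner ℝ a η') :
    (a =ᵐ[volume.restrict (Ioo 0 1)] fun x => -L2.prim b x) ∧ L2.prim b 1 = 0 := by
  have memc : ∀ {φ : ℝ → ℝ}, Continuous φ → MemLp φ 2 (volume.restrict (Ioo (0 : ℝ) 1)) := by
    intro φ hφ
    obtain ⟨C, hC⟩ := isCompact_Icc.exists_bound_of_continuousOn (s := Icc (0 : ℝ) 1)
      hφ.continuousOn
    refine MemLp.of_bound hφ.aestronglyMeasurable C ?_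
    filter_upwards [ae_restrict_mem measurableSet_Ioo] with x hx
    exact hC x (Ioo_subset_Icc_self hx)
  have hin : ∀ {φ : ℝ → ℝ} (hφ : Continuous φ) (g : L2 0 1),
      inner ℝ g ((memc hφ).toLp φ) = ∫ x in Ioo (0 : ℝ) 1, g x * φ x := by
    intro φ hφ g
    rw [real_inner_comm, L2.inner_test]
  have hcos : Continuous fun y : ℝ => Real.cos (Real.pi * y) := by fun_prop
  have hsin : Continuous fun y : ℝ => Real.sin (Real.pi * y) := by fun_prop
  -- The constant 1 is an even test function with derivative zero, so `b` has mean zero; this is the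
  -- boundary condition at the right end.
  have h1 : L2.prim b 1 = 0 := by
    have c1 : Continuous fun _ : ℝ => (1 : ℝ) := continuous_const
    have c0 : Continuous fun _ : ℝ => (0 : ℝ) := continuous_const
    have := h _ _ (evenTest_cos (H := fun _ => 1) (h := fun _ => 0)
      (fun c => hasDerivAt_const c 1) c0 (memc c1).coeFn_toLp
      (η' := (memc c0).toLp _) (by filter_upwards [(memc c0).coeFn_toLp] with x hx; rw [hx]; simp))
    rw [hin c1, hin c0] at this
    simp only [mul_one, mul_zero, integral_zero] at this
    rw [L2.prim_right b zero_le_one, this]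
  refine ⟨?_, h1⟩
  -- the primitive is tested against all functions vanishing suitably at the ends
  have key : ∀ k : ℝ → ℝ, Continuous k → ∫ y in Ioo (0 : ℝ) 1,
      ((a y + L2.prim b y) * Real.sin (Real.pi * y)) * k (Real.cos (Real.pi * y)) = 0 := by
    intro k hk
    let H : ℝ → ℝ := fun c => ∫ s in (0 : ℝ)..c, k s
    have hH : ∀ c, HasDerivAt H (k c) c := fun c =>
      intervalIntegral.integral_hasDerivAt_right (hk.intervalIntegrable _ _)
        (hk.stronglyMeasurableAtFilter _ _) hk.continuousAt
    have hHc : Continuous H := continuous_iff_continuousAt.2 fun c => (hH c).continuousAt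
    let η : ℝ → ℝ := fun y => H (Real.cos (Real.pi * y))
    let η' : ℝ → ℝ := fun y => -(Real.pi * (Real.sin (Real.pi * y) * k (Real.cos (Real.pi * y))))
    have cη : Continuous η := hHc.comp hcos
    have cη' : Continuous η' := (continuous_const.mul (hsin.mul (hk.comp hcos))).neg
    have hηd : ∀ y, HasDerivAt η (η' y) y := fun y => by
      have h3 : HasDerivAt (fun y : ℝ => Real.cos (Real.pi * y))
          (-Real.sin (Real.pi * y) * Real.pi) y := by
        have := ((hasDerivAt_id y).const_mul Real.pi)
        simp only [mul_one, id] at this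
        exact this.cos
      refine ((hH (Real.cos (Real.pi * y))).comp y h3).congr_deriv ?_
      simp only [η']
      ring
    have ht := h _ _ (evenTest_cos hH hk (memc cη).coeFn_toLp (memc cη').coeFn_toLp)
    rw [hin cη, hin cη'] at ht
    have hη1 : AbsolutelyContinuousOnInterval η 0 1 := by
      have : ContDiffOn ℝ 1 η (uIcc 0 1) := by
        refine ContDiff.contDiffOn ?_
        rw [contDiff_one_iff_deriv]
        refine ⟨fun y => (hηd y).differentiableAt, ?_⟩
        rwa [show deriv η = η' from funext fun y => (hηd y).deriv]
      obtain ⟨K, hK⟩ := this.exists_lipschitzOnWith (by simp) (convex_Icc _ _) isCompact_Icc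
      exact hK.absolutelyContinuousOnInterval
    have hp := L2.integral_parts (f := b) (g := η') zero_le_one (L2.ac_prim b) hη1
      (L2.ae_hasDerivAt_prim b) (Eventually.of_forall hηd)
    rw [h1, L2.prim_left, zero_mul, zero_mul, sub_zero] at hp
    have i1 : IntegrableOn (fun y => b y * η y) (Ioo 0 1) :=
      (Lp.memLp b).integrable_mul (memc cη)
    have i2 : IntegrableOn (fun y => L2.prim b y * η' y) (Ioo 0 1) :=
      ((L2.continuous_prim b).mul cη').integrableOn_Icc.mono_set Ioo_subset_Icc_self
    have i3 : IntegrableOn (fun y => a y * η' y) (Ioo 0 1) :=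
      (Lp.memLp a).integrable_mul (memc cη')
    rw [integral_add i1 i2, ht, ← integral_add i3 i2] at hp
    have e : ∫ y in Ioo (0 : ℝ) 1, (a y * η' y + L2.prim b y * η' y) =
        -Real.pi * ∫ y in Ioo (0 : ℝ) 1,
          ((a y + L2.prim b y) * Real.sin (Real.pi * y)) * k (Real.cos (Real.pi * y)) := by
      rw [← integral_const_mul]
      refine integral_congr_ae (Eventually.of_forall fun y => ?_)
      simp only [η']
      ring
    rw [e] at hp
    exact (mul_eq_zero.1 hp).resolve_left (neg_ne_zero.2 Real.pi_ne_zero)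
  have hz : ∀ᵐ y ∂(volume : Measure ℝ), y ∈ Ioo (0 : ℝ) 1 →
      (fun y => (a y + L2.prim b y) * Real.sin (Real.pi * y)) y = 0 := by
    refine isOpen_Ioo.ae_eq_zero_of_integral_contDiff_smul_eq_zero ?_ ?_
    · refine (IntegrableOn.locallyIntegrableOn ?_)
      refine Integrable.mul_bdd (c := 1) ?_ hsin.aestronglyMeasurable
        (Eventually.of_forall fun y => Real.abs_sin_le_one _)
      exact (L2.integrableOn a).add
        ((L2.continuous_prim b).integrableOn_Icc.mono_set Ioo_subset_Icc_self)
    · intro φ hφ hc hs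
      -- On `[0, 1]` every function of `y` is a function of `cos (π y)`, so `k` can reproduce an
      -- arbitrary test function.
      have := key (fun c => φ (Real.arccos c / Real.pi))
        (hφ.continuous.comp (Real.continuous_arccos.div_const _))
      rw [← setIntegral_eq_integral_of_forall_compl_eq_zero (s := Ioo 0 1)]
      · refine Eq.trans ?_ this
        refine setIntegral_congr_fun measurableSet_Ioo fun y hy => ?_
        have hy1 : 0 ≤ Real.pi * y := by have := hy.1; positivity
        have hy2 : Real.pi * y ≤ Real.pi := by nlinarith [hy.2, Real.pi_pos]
        simp only [smul_eq_mul]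
        rw [Real.arccos_cos hy1 hy2, mul_div_cancel_left₀ _ Real.pi_ne_zero]
        ring
      · intro x hx
        simp [eq_zero_of_tsupport_subset_Ioo hs hx]
  filter_upwards [(ae_restrict_iff' measurableSet_Ioo).2 hz, ae_restrict_mem measurableSet_Ioo]
    with y hy hm
  have hsp : 0 < Real.sin (Real.pi * y) := Real.sin_pos_of_pos_of_lt_pi
    (mul_pos Real.pi_pos hm.1) (by nlinarith [hm.2, Real.pi_pos])
  have := (mul_eq_zero.1 hy).resolve_right hsp.ne'
  linarith

theorem isWeakDeriv_of_oddTest {a b : L2 0 1}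
    (h : ∀ θ θ', OddTest θ θ' → inner ℝ b θ = inner ℝ a θ') : IsWeakDeriv a (-b) := by
  rw [isWeakDeriv_iff]
  intro φ hφ hc hs
  have := h _ _ (oddTest_of_contDiff hφ hs (memLp_test hφ.continuous hc).coeFn_toLp
    (memLp_test (hφ.continuous_deriv (by simp)) hc.deriv).coeFn_toLp)
  rw [inner_neg_right, neg_neg, real_inner_comm, ← this, real_inner_comm]

end Circ

/-! ### Global solutions of ordinary differential equations of linear growth -/

section ODE

variable {E : Type*} [NormedAddCommGroup E] [NormedSpace ℝ E]

/-- The radial retraction onto the closed ball of radius `R`. -/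
def radialRetract (R : ℝ) (x : E) : E := (R / max R ‖x‖) • x

theorem radialRetract_of_norm_le {R : ℝ} (hR : 0 < R) {x : E} (hx : ‖x‖ ≤ R) :
    radialRetract R x = x := by
  rw [radialRetract, max_eq_left hx, div_self hR.ne', one_smul]

theorem norm_radialRetract_le {R : ℝ} (hR : 0 < R) (x : E) : ‖radialRetract R x‖ ≤ ‖x‖ := by
  have hm : 0 < max R ‖x‖ := lt_max_of_lt_left hR
  rw [radialRetract, norm_smul, Real.norm_of_nonneg (by positivity)]
  exact mul_le_of_le_one_left (norm_nonneg _) ((div_le_one hm).2 (le_max_left _ _))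

theorem norm_radialRetract_le_radius {R : ℝ} (hR : 0 < R) (x : E) : ‖radialRetract R x‖ ≤ R := by
  have hm : 0 < max R ‖x‖ := lt_max_of_lt_left hR
  rw [radialRetract, norm_smul, Real.norm_of_nonneg (by positivity), div_mul_eq_mul_div,
    div_le_iff₀ hm]
  exact mul_le_mul_of_nonneg_left (le_max_right _ _) hR.le

theorem lipschitzWith_radialRetract {R : ℝ} (hR : 0 < R) :
    LipschitzWith 2 (radialRetract R : E → E) := by
  refine LipschitzWith.of_dist_le_mul fun x y => ?_
  rw [dist_eq_norm, dist_eq_norm]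
  set m := max R ‖x‖ with hm
  set n := max R ‖y‖ with hn
  have hm0 : 0 < m := lt_max_of_lt_left hR
  have hn0 : 0 < n := lt_max_of_lt_left hR
  have e : radialRetract R x - radialRetract R y
      = (R / m) • (x - y) + (R / m - R / n) • y := by
    simp only [radialRetract, ← hm, ← hn, smul_sub, sub_smul]
    abel
  have h1 : ‖(R / m) • (x - y)‖ ≤ ‖x - y‖ := by
    rw [norm_smul, Real.norm_of_nonneg (by positivity)]
    exact mul_le_of_le_one_left (norm_nonneg _) ((div_le_one hm0).2 (le_max_left _ _))
  have h2 : ‖(R / m - R / n) • y‖ ≤ ‖x - y‖ := by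
    have hnm : |n - m| ≤ ‖x - y‖ := by
      rw [hm, hn, max_comm R, max_comm R]
      refine (abs_max_sub_max_le_abs _ _ _).trans ?_
      rw [norm_sub_rev]
      exact abs_norm_sub_norm_le _ _
    have e2 : R / m - R / n = (R / m) * ((n - m) / n) := by field_simp
    rw [norm_smul, e2, norm_mul, norm_div (n - m), Real.norm_of_nonneg (by positivity : 0 ≤ R / m),
      Real.norm_eq_abs (n - m), Real.norm_of_nonneg hn0.le]
    have h3 : R / m ≤ 1 := (div_le_one hm0).2 (le_max_left _ _)
    have h4 : ‖y‖ / n ≤ 1 := (div_le_one hn0).2 (le_max_right _ _)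
    calc R / m * (|n - m| / n) * ‖y‖ = (R / m) * (|n - m| * (‖y‖ / n)) := by ring
      _ ≤ 1 * (‖x - y‖ * 1) := by gcongr
      _ = _ := by ring
  rw [e]
  refine (norm_add_le _ _).trans ?_
  push_cast
  linarith

theorem gronwallBound_le {δ K ε s t : ℝ} (hδ : 0 ≤ δ) (hK : 0 ≤ K) (hε : 0 ≤ ε) (h : s ≤ t) :
    gronwallBound δ K ε s ≤ gronwallBound δ K ε t := by
  rcases hK.eq_or_lt with rfl | hK
  · simp only [gronwallBound_K0]
    gcongr
  · simp only [gronwallBound_of_K_ne_0 hK.ne']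
    gcongr

/-- Composition with the radial retraction makes the field bounded and globally Lipschitz, so
Picard–Lindelöf gives a solution on all of `[0, T]`. The retraction does not increase norms, so the
linear growth bound survives. Gronwall then confines the solution to the ball on which the
retraction is the identity, and there the original equation holds. -/
theorem exists_forall_hasDerivWithinAt_of_linear_growth [CompleteSpace E] {F : ℝ → E → E}
    {T K ε : ℝ} (hT : 0 ≤ T) (hK : 0 ≤ K) (hε : 0 ≤ ε)
    (hc : ∀ x, ContinuousOn (fun t => F t x) (Icc 0 T))
    (hl : ∀ R : ℝ, ∃ L : ℝ≥0, ∀ t ∈ Icc 0 T, LipschitzOnWith L (F t) (Metric.closedBall 0 R))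
    (hg : ∀ t ∈ Icc 0 T, ∀ x, ‖F t x‖ ≤ K * ‖x‖ + ε) {x₀ : E} {δ : ℝ} (hδ : ‖x₀‖ ≤ δ) :
    ∃ Z : ℝ → E, Z 0 = x₀ ∧ (∀ t ∈ Icc 0 T, HasDerivWithinAt Z (F t (Z t)) (Icc 0 T) t) ∧
      ∀ t ∈ Icc 0 T, ‖Z t‖ ≤ gronwallBound δ K ε T := by
  have hb0 : 0 ≤ gronwallBound δ K ε T :=
    ((norm_nonneg _).trans hδ).trans ((gronwallBound_x0 _ _ _).symm.le.trans
      (gronwallBound_le ((norm_nonneg x₀).trans hδ) hK hε hT))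
  -- The added 1 only ensures a positive radius.
  set R : ℝ := gronwallBound δ K ε T + 1 with hR
  have hR0 : 0 < R := by positivity
  obtain ⟨L, hL⟩ := hl R
  have hmap : ∀ x : E, radialRetract R x ∈ Metric.closedBall (0 : E) R := fun x => by
    rw [mem_closedBall_zero_iff]
    exact norm_radialRetract_le_radius hR0 x
  have hM : 0 ≤ K * R + ε := by positivity
  have hPL : IsPicardLindelof (fun t x => F t (radialRetract R x))
      (⟨0, le_rfl, hT⟩ : Icc (0 : ℝ) T) x₀ ⟨(K * R + ε) * T, by positivity⟩ 0
      ⟨K * R + ε, hM⟩ (L * 2) := by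
    refine ⟨fun t ht => ?_, fun x _ => hc _, fun t ht x _ => ?_, ?_⟩
    · exact (((hL t ht).comp ((lipschitzWith_radialRetract hR0).lipschitzOnWith (s := univ))
        fun x _ => hmap x).mono (subset_univ _))
    · refine (hg t ht _).trans ?_
      have := norm_radialRetract_le_radius hR0 x
      change _ ≤ K * R + ε
      gcongr
    · change (K * R + ε) * max (T - 0) (0 - 0) ≤ (K * R + ε) * T - 0
      rw [sub_zero, sub_zero, sub_zero, max_eq_left hT]
  obtain ⟨Z, hZ0, hZ⟩ := hPL.exists_eq_forall_mem_Icc_hasDerivWithinAt₀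
  change Z 0 = x₀ at hZ0
  have hbd : ∀ t ∈ Icc 0 T, ‖Z t‖ ≤ gronwallBound δ K ε T := by
    intro t ht
    have := norm_le_gronwallBound_of_norm_deriv_right_le (f := Z)
      (f' := fun t => F t (radialRetract R (Z t))) (δ := δ) (K := K) (ε := ε)
      (a := 0) (b := T) (fun t ht => (hZ t ht).continuousWithinAt)
      (fun x hx => (hZ x (Ico_subset_Icc_self hx)).mono_of_mem_nhdsWithin
        (mem_of_superset (Icc_mem_nhdsGE hx.2) (Icc_subset_Icc_left hx.1)))
      (by rwa [hZ0]) (fun x hx => (hg x (Ico_subset_Icc_self hx) _).trans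
        (by gcongr; exact norm_radialRetract_le hR0 _)) t ht
    rw [sub_zero] at this
    exact this.trans (gronwallBound_le ((norm_nonneg x₀).trans hδ) hK hε ht.2)
  refine ⟨Z, hZ0, fun t ht => ?_, hbd⟩
  have := hZ t ht
  rwa [radialRetract_of_norm_le hR0 ((hbd t ht).trans (by linarith))] at this

end ODE

/-! ### Travelling waves and boundary lifts -/

namespace L2

variable {α β : ℝ}

/-- The primitive as a bounded continuous function. -/
def primB : L2 α β →L[ℝ] (ℝ →ᵇ ℝ) :=
  LinearMap.mkContinuous
    { toFun := fun g => BoundedContinuousFunction.ofNormedAddCommGroup (prim g) (continuous_prim g)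
        (√(β - α) * ‖g‖) (abs_prim_le g)
      map_add' := fun f g => by
        ext x
        exact prim_add f g x
      map_smul' := fun c g => by
        ext x
        exact prim_smul c g x } (√(β - α))
    fun g => BoundedContinuousFunction.norm_ofNormedAddCommGroup_le _ (by positivity) (abs_prim_le g)

theorem norm_primB_le (g : L2 α β) : ‖primB g‖ ≤ √(β - α) * ‖g‖ :=
  BoundedContinuousFunction.norm_ofNormedAddCommGroup_le _ (by positivity) (abs_prim_le g)

theorem prim_of_le (g : L2 α β) {x : ℝ} (hx : x ≤ α) : prim g x = 0 := by
  unfold prim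
  rw [intervalIntegral.integral_congr_ae (g := fun _ => 0), intervalIntegral.integral_zero]
  have : ∀ᵐ s : ℝ, s ≠ α := by simp [ae_iff]
  filter_upwards [this] with s hs h
  rw [uIoc_of_ge hx] at h
  exact indicator_of_notMem (fun hm => absurd hm.1 (not_lt.2 h.2)) _

theorem integral_indicator_eq (g : L2 α β) (x y : ℝ) :
    ∫ s in x..y, (Ioo α β).indicator g s = prim g y - prim g x := by
  unfold prim
  rw [intervalIntegral.integral_interval_sub_left] <;>
    exact (integrable_indicator g).intervalIntegrable

end L2

theorem measurePreserving_affine {σ : ℝ} (hσ : σ = 1 ∨ σ = -1) (κ s : ℝ) :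
    MeasurePreserving (fun x : ℝ => s + (σ * x + κ)) := by
  rcases hσ with rfl | rfl
  · have := measurePreserving_add_right volume (s + κ)
    refine Eq.mp ?_ this
    congr 1
    ext x
    ring
  · have := (measurePreserving_add_right volume (s + κ)).comp (Measure.measurePreserving_neg volume)
    refine Eq.mp ?_ this
    congr 1
    ext x
    change -x + (s + κ) = s + (-1 * x + κ)
    ring

namespace L2

/-- The waves `x ↦ g(s + σ x + κ)`, where `g` is extended by zero. -/
theorem exists_travelling {T : ℝ} (g : L2 0 T) {σ : ℝ} (hσ : σ = 1 ∨ σ = -1) (κ : ℝ) :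
    ∃ A : ℝ → L2 0 1, Continuous A ∧ ∀ s, A s =ᵐ[volume.restrict (Ioo 0 1)]
      fun x => (Ioo 0 T).indicator g (s + (σ * x + κ)) := by
  have hm : MemLp ((Ioo 0 T).indicator g) 2 volume :=
    (memLp_indicator_iff_restrict measurableSet_Ioo).2 (Lp.memLp g)
  let G : ℝ → C(ℝ, ℝ) := fun s => ⟨fun x => s + (σ * x + κ), by fun_prop⟩
  have hG : Continuous G := by
    refine ContinuousMap.continuous_of_continuous_uncurry _ ?_
    change Continuous fun q : ℝ × ℝ => q.1 + (σ * q.2 + κ)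
    fun_prop
  have hc := Continuous.compMeasurePreservingLp (continuous_const (y := hm.toLp _)) hG
    (fun s => measurePreserving_affine hσ κ s) (by norm_num)
  refine ⟨_, (LpToLpRestrictCLM ℝ ℝ ℝ volume 2 (Ioo 0 1)).continuous.comp hc, fun s => ?_⟩
  have h1 := LpToLpRestrictCLM_coeFn ℝ (Ioo (0 : ℝ) 1) (Lp.compMeasurePreserving (p := 2) (G s)
    (measurePreserving_affine hσ κ s) (hm.toLp _))
  have h2 := Lp.coeFn_compMeasurePreserving (hm.toLp _) (measurePreserving_affine hσ κ s)
  have h3 := (measurePreserving_affine hσ κ s).quasiMeasurePreserving.ae_eq_comp hm.coeFn_toLp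
  exact h1.trans (ae_restrict_of_ae (h2.trans h3))

/-- Fubini for the integrand `η(x) g(s + σ x + κ)`. This identifies the time integral of an
`L²`-valued wave by testing. -/
theorem integral_travelling {T : ℝ} (g : L2 0 T) {σ κ : ℝ}
    {A : ℝ → L2 0 1} (hA : Continuous A) (hAg : ∀ s, A s =ᵐ[volume.restrict (Ioo 0 1)]
      fun x => (Ioo 0 T).indicator g (s + (σ * x + κ))) (η : L2 0 1) (t : ℝ) :
    inner ℝ η (∫ s in (0 : ℝ)..t, A s)
      = ∫ x in Ioo 0 1, η x * (prim g (t + (σ * x + κ)) - prim g (0 + (σ * x + κ))) := by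
  have e1 : inner ℝ η (∫ s in (0 : ℝ)..t, A s) = ∫ s in (0 : ℝ)..t, inner ℝ η (A s) :=
    ((innerSL ℝ η).intervalIntegral_comp_comm (hA.intervalIntegrable 0 t)).symm
  have e2 : ∀ s, inner ℝ η (A s)
      = ∫ x in Ioo 0 1, η x * (Ioo 0 T).indicator g (s + (σ * x + κ)) := by
    intro s
    rw [← integral_Ioo_mul]
    refine integral_congr_ae ?_
    filter_upwards [hAg s] with x hx
    rw [hx]
  have hθ : Continuous fun x : ℝ => σ * x + κ := by fun_prop
  have hint : Integrable (fun z : ℝ × ℝ =>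
      (Ioo 0 1).indicator η z.1 * (Ioo 0 T).indicator g (z.2 + (σ * z.1 + κ)))
      ((volume : Measure ℝ).prod volume) := by
    have hmp : MeasurePreserving (fun p : ℝ × ℝ => (p.1, p.2 + (σ * p.1 + κ)))
        ((volume : Measure ℝ).prod volume) (volume.prod volume) :=
      (MeasurePreserving.id volume).skew_product (g := fun x s => s + (σ * x + κ))
        (by fun_prop) (Eventually.of_forall fun x =>
          (measurePreserving_add_right volume (σ * x + κ)).map_eq)
    exact (hmp.integrable_comp_of_integrable
      ((integrable_indicator η).mul_prod (integrable_indicator g)))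
  have e3 : ∀ s, inner ℝ η (A s)
      = ∫ x, (Ioo 0 1).indicator η x * (Ioo 0 T).indicator g (s + (σ * x + κ)) := by
    intro s
    rw [e2, ← integral_indicator measurableSet_Ioo]
    refine integral_congr_ae (Eventually.of_forall fun x => ?_)
    simp only [indicator]
    split_ifs <;> simp
  have e4 : ∫ x in Ioo 0 1, η x * (prim g (t + (σ * x + κ)) - prim g (0 + (σ * x + κ)))
      = ∫ x, ∫ s in (0 : ℝ)..t, (Ioo 0 1).indicator η x *
        (Ioo 0 T).indicator g (s + (σ * x + κ)) := by
    rw [← integral_indicator measurableSet_Ioo]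
    refine integral_congr_ae (Eventually.of_forall fun x => ?_)
    simp only
    rw [intervalIntegral.integral_const_mul, intervalIntegral.integral_comp_add_right
      (fun s => (Ioo 0 T).indicator g s), integral_indicator_eq]
    simp only [indicator]
    split_ifs <;> simp
  rw [e1, e4]
  simp only [e3]
  exact intervalIntegral_integral_swap
    (hint.swap.mono_measure (Measure.prod_mono Measure.restrict_le_self le_rfl))

theorem isWeakDeriv_travelling {T : ℝ} (g : L2 0 T) {σ κ s : ℝ}
    {a b : L2 0 1} (ha : a =ᵐ[volume.restrict (Ioo 0 1)]
      fun x => (Ioo 0 T).indicator g (s + (σ * x + κ)))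
    (hb : b =ᵐ[volume.restrict (Ioo 0 1)] fun x => prim g (s + (σ * x + κ))) :
    IsWeakDeriv b (σ • a) := by
  refine isWeakDeriv_of_prim zero_le_one (c := prim g (s + κ)) ?_
  filter_upwards [hb, ae_restrict_mem measurableSet_Ioo] with x hx hm
  have h1 : prim a x = ∫ y in (0 : ℝ)..x, (Ioo 0 T).indicator g (σ * y + (s + κ)) := by
    rw [prim_eq _ (Ioo_subset_Icc_self hm)]
    refine intervalIntegral.integral_congr_ae_restrict ?_
    rw [uIoc_of_le hm.1.le]
    refine Filter.EventuallyEq.trans (ae_restrict_of_ae_restrict_of_subset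
      (show Ioc 0 x ⊆ Ioo 0 1 from fun y hy => ⟨hy.1, lt_of_le_of_lt hy.2 hm.2⟩) ha) (Eventually.of_forall fun y => ?_)
    simp only
    congr 1
    ring
  rw [hx, prim_smul, h1, intervalIntegral.mul_integral_comp_mul_add, integral_indicator_eq]
  ring_nf

end L2

namespace Sobolev

/-- For `g` merely in `L²` the wave `A` is continuous in time with values in `L²`. The wave `B` of
the primitive is `B 0` plus the time integral of `A`, hence differentiable in time, with `∂ₜ B = A`
and `∂ₓ B = σ A`. -/
theorem exists_travelling {T : ℝ} (g : L2 0 T) {σ : ℝ} (hσ : σ = 1 ∨ σ = -1) (κ : ℝ) :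
    ∃ (A : ℝ → L2 0 1) (B : ℝ → Sobolev 1 0 1), Continuous A ∧
      (∀ t, HasDerivAt (fun s => (B s).toL2) (A t) t) ∧ (∀ t, (B t).dx = σ • A t) ∧
      ∀ t, EqOn (B t).ev (fun x => L2.prim g (t + (σ * x + κ))) (Icc 0 1) := by
  obtain ⟨A, hA, hAg⟩ := L2.exists_travelling g hσ κ
  have hc : ∀ t, Continuous fun x : ℝ => L2.prim g (t + (σ * x + κ)) := fun t =>
    (L2.continuous_prim g).comp (by fun_prop)
  let b : ℝ → ℝ →ᵇ ℝ := fun t => (L2.primB g).compContinuous ⟨fun x => t + (σ * x + κ), by fun_prop⟩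
  have hb : ∀ t, (L2.ofBCF (b t) : L2 0 1) =ᵐ[volume.restrict (Ioo 0 1)]
      fun x => L2.prim g (t + (σ * x + κ)) := fun t => L2.coeFn_ofBCF (α := 0) (β := 1) (b t)
  have hd : ∀ t, IsWeakDeriv (L2.ofBCF (b t) : L2 0 1) (σ • A t) := fun t =>
    L2.isWeakDeriv_travelling g (hAg t) (hb t)
  refine ⟨A, fun t => mk _ _ (hd t), hA, fun t => ?_, fun t => rfl, fun t =>
    ev_mk_eqOn (hd t) (hc t).continuousOn (hb t)⟩
  have e : (fun s => (mk _ _ (hd s)).toL2)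
      = fun t => L2.ofBCF (b 0) + ∫ s in (0 : ℝ)..t, A s := by
    funext t
    refine ext_inner_left ℝ fun η => ?_
    rw [inner_add_right, L2.integral_travelling g hA hAg, ← L2.integral_Ioo_mul, toL2_mk,
      ← L2.integral_Ioo_mul, ← integral_add]
    · refine integral_congr_ae ?_
      filter_upwards [hb t, hb 0] with x h1 h2
      rw [h1, h2]
      ring
    · exact (Lp.memLp η).integrable_mul (Lp.memLp _)
    · have : MemLp (fun x => L2.prim g (t + (σ * x + κ)) - L2.prim g (0 + (σ * x + κ))) 2
          (volume.restrict (Ioo 0 1)) :=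
        MemLp.ae_eq (((hb t).sub (hb 0))) ((Lp.memLp _).sub (Lp.memLp _))
      exact (Lp.memLp η).integrable_mul this
  rw [e]
  exact (hA.integral_hasStrictDerivAt 0 t).hasDerivAt.const_add _

end Sobolev

/-- A pair `(π, ℓ)` with `ℓ = γ₀, γ₁` at the two ends, such that the residuals `∂ₜ π + ∂ₓ ℓ = -h₁`
and `∂ₜ ℓ + ∂ₓ π = -h₂` are differentiable in time. -/
structure BoundaryLift (γ₀ γ₁ : ℝ → ℝ) where
  (π ℓ : ℝ → Sobolev 1 0 1)
  (π' ℓ' h₁ h₂ h₁' h₂' : ℝ → L2 0 1)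
  hasDerivAt_π : ∀ t, HasDerivAt (fun s => (π s).toL2) (π' t) t
  hasDerivAt_ℓ : ∀ t, HasDerivAt (fun s => (ℓ s).toL2) (ℓ' t) t
  hasDerivAt_h₁ : ∀ t, HasDerivAt h₁ (h₁' t) t
  hasDerivAt_h₂ : ∀ t, HasDerivAt h₂ (h₂' t) t
  continuous_π' : Continuous π'
  continuous_ℓ' : Continuous ℓ'
  continuous_h₁' : Continuous h₁'
  continuous_h₂' : Continuous h₂'
  dx_π : ∀ t, (π t).dx = -ℓ' t - h₂ t
  dx_ℓ : ∀ t, (ℓ t).dx = -π' t - h₁ t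
  left : ∀ t, (ℓ t).ev 0 = γ₀ t
  right : ∀ t, (ℓ t).ev 1 = γ₁ t
  π_zero : π 0 = 0
  ℓ_zero : ℓ 0 = 0
  π'_zero : π' 0 = 0
  ℓ'_zero : ℓ' 0 = 0

theorem Sobolev.continuousOn_of_toL2_dx {α β : ℝ} {q : ℝ → Sobolev 1 α β} {s : Set ℝ}
    (h₀ : ContinuousOn (fun t => (q t).toL2) s) (h₁ : ContinuousOn (fun t => (q t).dx) s) :
    ContinuousOn q s := by
  rw [continuousOn_iff_continuous_domRestrict] at *
  refine Continuous.subtype_mk (f := fun t : s => (q t).1) ?_ _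
  refine (PiLp.continuous_toLp 2 _).comp (f := fun t : s => WithLp.ofLp (q t).1) ?_
  refine continuous_pi fun i => ?_
  fin_cases i
  · exact h₀
  · exact h₁

theorem Sobolev.exists_mulClamp_linear : ∃ M : Sobolev 1 0 1 → Sobolev 1 0 1, ∀ f,
    (M f).toL2 = L2.mulL L2.clamp f.toL2 ∧ (M f).dx = f.toL2 + L2.mulL L2.clamp f.dx ∧
      (M f).ev 0 = 0 ∧ (M f).ev 1 = f.ev 1 :=
  ⟨fun f => f.exists_mul_clamp.choose, fun f => f.exists_mul_clamp.choose_spec⟩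

/-- With `B₀` a function of `t - x` and `B₁` a function of `t + x - 1`, the lift is `ℓ = (1 - x) B₀
+ x B₁` and `π = (1 - x) B₀ - x B₁`. The derivatives of the waves cancel in both equations, and only
the derivatives of the weights remain. The residuals are thus `B₀ ∓ B₁`, which are differentiable in
time although the boundary data are only in `H¹`. Everything vanishes at time zero because
primitives vanish on the negative half-line. -/
theorem BoundaryLift.nonempty {T : ℝ} (g₀ g₁ : L2 0 T) :
    Nonempty (BoundaryLift (L2.prim g₀) (L2.prim g₁)) := by
  obtain ⟨A₀, B₀, hA₀, hB₀, hd₀, he₀⟩ := Sobolev.exists_travelling g₀ (σ := -1) (Or.inr rfl) 0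
  obtain ⟨A₁, B₁, hA₁, hB₁, hd₁, he₁⟩ := Sobolev.exists_travelling g₁ (σ := 1) (Or.inl rfl) (-1)
  obtain ⟨M, hM⟩ := Sobolev.exists_mulClamp_linear
  have cM := (L2.mulL (α := 0) (β := 1) L2.clamp).continuous
  have dM : ∀ {B : ℝ → Sobolev 1 0 1} {A : ℝ → L2 0 1},
      (∀ t, HasDerivAt (fun s => (B s).toL2) (A t) t) →
      ∀ t, HasDerivAt (fun s => (M (B s)).toL2) (L2.mulL L2.clamp (A t)) t := fun hB t => by
    simp only [(hM _).1]
    exact (L2.mulL L2.clamp).hasFDerivAt.comp_hasDerivAt t (hB t)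
  have m0 : (0 : ℝ) ∈ Icc (0 : ℝ) 1 := by simp
  have m1 : (1 : ℝ) ∈ Icc (0 : ℝ) 1 := by simp
  have z₀ : B₀ 0 = 0 := Sobolev.ext_ev zero_lt_one fun x hx => by
    rw [he₀ 0 (Ioo_subset_Icc_self hx), Sobolev.ev_zero zero_lt_one (Ioo_subset_Icc_self hx)]
    exact L2.prim_of_le _ (by linarith [hx.1])
  have z₁ : B₁ 0 = 0 := Sobolev.ext_ev zero_lt_one fun x hx => by
    rw [he₁ 0 (Ioo_subset_Icc_self hx), Sobolev.ev_zero zero_lt_one (Ioo_subset_Icc_self hx)]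
    exact L2.prim_of_le _ (by linarith [hx.2])
  have y₀ : A₀ 0 = 0 := by
    have := hd₀ 0
    rw [z₀, Sobolev.dx_zero] at this
    simpa using this.symm
  have y₁ : A₁ 0 = 0 := by
    have := hd₁ 0
    rw [z₁, Sobolev.dx_zero] at this
    simpa using this.symm
  have n₀ : ∀ t, (B₀ t).dx = -A₀ t := fun t => by rw [hd₀, neg_one_smul]
  have n₁ : ∀ t, (B₁ t).dx = A₁ t := fun t => by rw [hd₁, one_smul]
  have zM : M 0 = 0 := Sobolev.ext_toL2 (by rw [(hM 0).1]; simp)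
  refine ⟨{
    π := fun t => B₀ t - M (B₀ t) - M (B₁ t)
    ℓ := fun t => B₀ t - M (B₀ t) + M (B₁ t)
    π' := fun t => A₀ t - L2.mulL L2.clamp (A₀ t) - L2.mulL L2.clamp (A₁ t)
    ℓ' := fun t => A₀ t - L2.mulL L2.clamp (A₀ t) + L2.mulL L2.clamp (A₁ t)
    h₁ := fun t => (B₀ t).toL2 - (B₁ t).toL2
    h₂ := fun t => (B₀ t).toL2 + (B₁ t).toL2
    h₁' := fun t => A₀ t - A₁ t
    h₂' := fun t => A₀ t + A₁ t
    hasDerivAt_π := fun t => ((hB₀ t).sub (dM hB₀ t)).sub (dM hB₁ t)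
    hasDerivAt_ℓ := fun t => ((hB₀ t).sub (dM hB₀ t)).add (dM hB₁ t)
    hasDerivAt_h₁ := fun t => (hB₀ t).sub (hB₁ t)
    hasDerivAt_h₂ := fun t => (hB₀ t).add (hB₁ t)
    continuous_π' := (hA₀.sub (cM.comp hA₀)).sub (cM.comp hA₁)
    continuous_ℓ' := (hA₀.sub (cM.comp hA₀)).add (cM.comp hA₁)
    continuous_h₁' := hA₀.sub hA₁
    continuous_h₂' := hA₀.add hA₁
    dx_π := fun t => ?_
    dx_ℓ := fun t => ?_
    left := fun t => ?_
    right := fun t => ?_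
    π_zero := by simp [z₀, z₁, zM]
    ℓ_zero := by simp [z₀, z₁, zM]
    π'_zero := by simp [y₀, y₁]
    ℓ'_zero := by simp [y₀, y₁] }⟩
  · simp only [Sobolev.dx_sub, (hM _).2.1, n₀, n₁, map_neg]
    abel
  · simp only [Sobolev.dx_sub, Sobolev.dx_add, (hM _).2.1, n₀, n₁, map_neg]
    abel
  · rw [Sobolev.ev_add zero_lt_one _ _ m0, Sobolev.ev_sub zero_lt_one _ _ m0, (hM _).2.2.1,
      (hM _).2.2.1, he₀ t m0]
    simp
  · rw [Sobolev.ev_add zero_lt_one _ _ m1, Sobolev.ev_sub zero_lt_one _ _ m1, (hM _).2.2.2,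
      (hM _).2.2.2, he₁ t m1]
    simp

namespace BoundaryLift

variable {γ₀ γ₁ : ℝ → ℝ}

theorem h₁_zero (B : BoundaryLift γ₀ γ₁) : B.h₁ 0 = 0 := by
  have := B.dx_ℓ 0
  rw [B.ℓ_zero, B.π'_zero, Sobolev.dx_zero] at this
  simpa using this.symm

theorem h₂_zero (B : BoundaryLift γ₀ γ₁) : B.h₂ 0 = 0 := by
  have := B.dx_π 0
  rw [B.π_zero, B.ℓ'_zero, Sobolev.dx_zero] at this
  simpa using this.symm

theorem left_zero (B : BoundaryLift γ₀ γ₁) : γ₀ 0 = 0 := by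
  rw [← B.left, B.ℓ_zero, Sobolev.ev_zero zero_lt_one (by simp)]

theorem toL2_ℓ (B : BoundaryLift γ₀ γ₁) (t : ℝ) : (B.ℓ t).toL2 =ᵐ[volume.restrict (Ioo 0 1)]
    fun x => γ₀ t - L2.prim (B.π' t + B.h₁ t) x := by
  filter_upwards [(B.ℓ t).toL2_ae_eq_ev zero_lt_one, ae_restrict_mem measurableSet_Ioo] with x hx hm
  rw [hx, (B.ℓ t).ev_eq_prim zero_lt_one (Ioo_subset_Icc_self hm), B.left, B.dx_ℓ,
    ← neg_add', ← neg_one_smul ℝ, L2.prim_smul]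
  ring

theorem right_eq (B : BoundaryLift γ₀ γ₁) (t : ℝ) : γ₁ t = γ₀ t - L2.prim (B.π' t + B.h₁ t) 1 := by
  rw [← B.right, (B.ℓ t).ev_eq_prim zero_lt_one (by simp), B.left, B.dx_ℓ,
    ← neg_add', ← neg_one_smul ℝ, L2.prim_smul]
  ring

theorem continuous_left (B : BoundaryLift γ₀ γ₁) : Continuous γ₀ := by
  have hc : Continuous B.ℓ := by
    rw [← continuousOn_univ]
    refine Sobolev.continuousOn_of_toL2_dx (continuousOn_univ.2 ?_) (continuousOn_univ.2 ?_)
    · exact continuous_iff_continuousAt.2 fun t => (B.hasDerivAt_ℓ t).continuousAt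
    · have h1 : Continuous B.h₁ :=
        continuous_iff_continuousAt.2 fun t => (B.hasDerivAt_h₁ t).continuousAt
      exact (B.continuous_π'.neg.sub h1).congr fun t => (B.dx_ℓ t).symm
  have := IsWave.continuousOn_ev (hc.continuousOn (s := univ)) (x := 0) (by simp)
  rw [continuousOn_univ] at this
  exact this.congr B.left

end BoundaryLift

/-! ### Existence for the damped wave system -/

theorem exists_primitive {E : Type*} [NormedAddCommGroup E] [NormedSpace ℝ E] [CompleteSpace E]
    {T : ℝ} (hT : 0 ≤ T) {y : ℝ → E} (hy : ContinuousOn y (Icc 0 T)) :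
    ∃ Y : ℝ → E, Y 0 = 0 ∧ ∀ t ∈ Icc 0 T, HasDerivWithinAt Y (y t) (Icc 0 T) t := by
  have hc : Continuous (IccExtend hT ((Icc 0 T).domRestrict y)) :=
    (continuousOn_iff_continuous_domRestrict.1 hy).Icc_extend'
  refine ⟨fun t => ∫ s in (0 : ℝ)..t, IccExtend hT ((Icc 0 T).domRestrict y) s, by simp,
    fun t ht => ?_⟩
  have := (hc.integral_hasStrictDerivAt 0 t).hasDerivAt.hasDerivWithinAt (s := Icc 0 T)
  rwa [IccExtend_of_mem hT _ ht] at this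

theorem eq_zero_of_hasDerivWithinAt_zero {T : ℝ} {D : ℝ → ℝ} (h0 : D 0 = 0)
    (h : ∀ t ∈ Icc 0 T, HasDerivWithinAt D 0 (Icc 0 T) t) {t : ℝ} (ht : t ∈ Icc 0 T) : D t = 0 := by
  rw [← h0]
  exact constant_of_has_deriv_right_zero (fun t ht => (h t ht).continuousWithinAt)
    (fun x hx => (h x (Ico_subset_Icc_self hx)).mono_of_mem_nhdsWithin
      (mem_of_superset (Icc_mem_nhdsGE hx.2) (Icc_subset_Icc_left hx.1))) t ht

/-! ### Even and odd parts of functions on the circle -/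

namespace Circ

theorem norm_odd (f : L2 0 1) : ‖odd f‖ = ‖f‖ := by
  rw [← sq_eq_sq₀ (norm_nonneg _) (norm_nonneg _), ← real_inner_self_eq_norm_sq, inner_odd_odd,
    real_inner_self_eq_norm_sq]

/-- The even part, as a function on `(0, 1)`. -/
def evenPart : LCirc →L[ℝ] L2 0 1 := ContinuousLinearMap.adjoint even.toContinuousLinearMap

/-- The odd part, as a function on `(0, 1)`. -/
def oddPart : LCirc →L[ℝ] L2 0 1 := ContinuousLinearMap.adjoint odd

theorem inner_evenPart (z : LCirc) (η : L2 0 1) : inner ℝ (evenPart z) η = inner ℝ z (even η) :=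
  ContinuousLinearMap.adjoint_inner_left _ _ _

theorem inner_oddPart (z : LCirc) (η : L2 0 1) : inner ℝ (oddPart z) η = inner ℝ z (odd η) :=
  ContinuousLinearMap.adjoint_inner_left _ _ _

theorem evenPart_odd (f : L2 0 1) : evenPart (odd f) = 0 :=
  ext_inner_right ℝ fun η => by rw [inner_evenPart, inner_odd_even, inner_zero_left]

theorem oddPart_odd (f : L2 0 1) : oddPart (odd f) = f :=
  ext_inner_right ℝ fun η => by rw [inner_oddPart, inner_odd_odd]

theorem norm_evenPart_le (z : LCirc) : ‖evenPart z‖ ≤ ‖z‖ := by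
  refine (evenPart.le_of_opNorm_le ?_ z).trans_eq (one_mul _)
  exact (LinearIsometryEquiv.norm_map _ _).le.trans (even.norm_toContinuousLinearMap_le)

theorem norm_oddPart_le (z : LCirc) : ‖oddPart z‖ ≤ ‖z‖ := by
  refine (oddPart.le_of_opNorm_le ?_ z).trans_eq (one_mul _)
  exact (LinearIsometryEquiv.norm_map _ _).le.trans
    (odd.opNorm_le_bound zero_le_one fun f => by rw [norm_odd, one_mul])

end Circ

/-- A damping term `S` on the pointwise level, with formal time derivative `N` along curves `U`
with `∂ₜ U = Y`. -/
structure IsDamping (T K : ℝ) (S : ℝ → (ℝ →ᵇ ℝ) → L2 0 1) (N : ℝ → (ℝ →ᵇ ℝ) → L2 0 1 → L2 0 1) :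
    Prop where
  continuousOn : ∀ {U : ℝ → ℝ →ᵇ ℝ} {Y : ℝ → L2 0 1}, ContinuousOn U (Icc 0 T) →
    ContinuousOn Y (Icc 0 T) → ContinuousOn (fun t => N t (U t) (Y t)) (Icc 0 T)
  lipschitz : ∀ R : ℝ, ∃ L : ℝ, 0 ≤ L ∧ ∀ t ∈ Icc 0 T, ∀ U U' Y Y', ‖U‖ ≤ R → ‖U'‖ ≤ R → ‖Y‖ ≤ R →
    ‖Y'‖ ≤ R → ‖N t U Y - N t U' Y'‖ ≤ L * (‖U - U'‖ + ‖Y - Y'‖)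
  growth : ∀ t ∈ Icc 0 T, ∀ U Y, ‖N t U Y‖ ≤ K * (1 + ‖U‖ + ‖Y‖)
  hasDerivWithinAt : ∀ {U : ℝ → ℝ →ᵇ ℝ} {Y : ℝ → L2 0 1}, ContinuousOn U (Icc 0 T) →
    ContinuousOn Y (Icc 0 T) →
    (∀ t ∈ Icc 0 T, HasDerivWithinAt (fun s => (L2.ofBCF (U s) : L2 0 1)) (Y t) (Icc 0 T) t) →
    ∀ t ∈ Icc 0 T, HasDerivWithinAt (fun s => S s (U s)) (N t (U t) (Y t)) (Icc 0 T) t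

namespace BoundaryLift

open Circ

variable {γ₀ γ₁ : ℝ → ℝ}

/-- The time derivative of the pressure, in terms of the unknown on the circle. -/
def pDot (B : BoundaryLift γ₀ γ₁) (t : ℝ) (z : LCirc) : L2 0 1 :=
  evenPart (shift (-t) z) + B.π' t

/-- The time derivative of the velocity, in terms of the unknown on the circle. -/
def uDot (B : BoundaryLift γ₀ γ₁) (t : ℝ) (z : LCirc) : L2 0 1 :=
  oddPart (shift (-t) z) + B.ℓ' t

/-- The velocity, recovered from the mass balance and the left boundary value. -/
def vel (B : BoundaryLift γ₀ γ₁) (t : ℝ) (z : LCirc) : ℝ →ᵇ ℝ :=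
  BoundedContinuousFunction.const ℝ (γ₀ t) - L2.primB (B.pDot t z)

theorem norm_primB_unit_le (g : L2 0 1) : ‖L2.primB g‖ ≤ ‖g‖ := by
  simpa using L2.norm_primB_le g

theorem norm_pDot_le (B : BoundaryLift γ₀ γ₁) (t : ℝ) (z : LCirc) :
    ‖B.pDot t z‖ ≤ ‖z‖ + ‖B.π' t‖ :=
  (norm_add_le _ _).trans (by
    gcongr
    exact (norm_evenPart_le _).trans ((shift (-t)).norm_map z).le)

theorem norm_uDot_le (B : BoundaryLift γ₀ γ₁) (t : ℝ) (z : LCirc) :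
    ‖B.uDot t z‖ ≤ ‖z‖ + ‖B.ℓ' t‖ :=
  (norm_add_le _ _).trans (by
    gcongr
    exact (norm_oddPart_le _).trans ((shift (-t)).norm_map z).le)

theorem norm_vel_le (B : BoundaryLift γ₀ γ₁) (t : ℝ) (z : LCirc) :
    ‖B.vel t z‖ ≤ ‖γ₀ t‖ + (‖z‖ + ‖B.π' t‖) :=
  (norm_sub_le _ _).trans (add_le_add (BoundedContinuousFunction.norm_const_le _)
    ((norm_primB_unit_le _).trans (B.norm_pDot_le t z)))

theorem pDot_sub (B : BoundaryLift γ₀ γ₁) (t : ℝ) (z w : LCirc) :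
    ‖B.pDot t z - B.pDot t w‖ ≤ ‖z - w‖ := by
  rw [pDot, pDot, add_sub_add_right_eq_sub, ← map_sub, ← map_sub]
  exact (norm_evenPart_le _).trans ((shift (-t)).norm_map _).le

theorem uDot_sub (B : BoundaryLift γ₀ γ₁) (t : ℝ) (z w : LCirc) :
    ‖B.uDot t z - B.uDot t w‖ ≤ ‖z - w‖ := by
  rw [uDot, uDot, add_sub_add_right_eq_sub, ← map_sub, ← map_sub]
  exact (norm_oddPart_le _).trans ((shift (-t)).norm_map _).le

theorem vel_sub (B : BoundaryLift γ₀ γ₁) (t : ℝ) (z w : LCirc) :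
    ‖B.vel t z - B.vel t w‖ ≤ ‖z - w‖ := by
  rw [vel, vel, sub_sub_sub_cancel_left, ← map_sub, norm_sub_rev z w]
  refine (norm_primB_unit_le _).trans (B.pDot_sub t w z)

theorem continuousOn_pDot (B : BoundaryLift γ₀ γ₁) {Z : ℝ → LCirc} {s : Set ℝ}
    (hZ : ContinuousOn Z s) : ContinuousOn (fun t => B.pDot t (Z t)) s :=
  (evenPart.continuous.comp_continuousOn (continuousOn_shift continuous_neg hZ)).add
    B.continuous_π'.continuousOn

theorem continuousOn_uDot (B : BoundaryLift γ₀ γ₁) {Z : ℝ → LCirc} {s : Set ℝ}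
    (hZ : ContinuousOn Z s) : ContinuousOn (fun t => B.uDot t (Z t)) s :=
  (oddPart.continuous.comp_continuousOn (continuousOn_shift continuous_neg hZ)).add
    B.continuous_ℓ'.continuousOn

theorem continuous_bcf_const : Continuous (BoundedContinuousFunction.const ℝ : ℝ → ℝ →ᵇ ℝ) :=
  (LipschitzWith.of_dist_le_mul (K := 1) fun x y => by
    rw [NNReal.coe_one, one_mul]
    exact (BoundedContinuousFunction.dist_le dist_nonneg).2 fun _ => le_rfl).continuous

theorem continuousOn_vel (B : BoundaryLift γ₀ γ₁) {Z : ℝ → LCirc} {s : Set ℝ}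
    (hZ : ContinuousOn Z s) : ContinuousOn (fun t => B.vel t (Z t)) s :=
  (continuous_bcf_const.comp B.continuous_left).continuousOn.sub
    (L2.primB.continuous.comp_continuousOn (B.continuousOn_pDot hZ))

/-- The right-hand side of the differential equation on the circle. -/
def field (B : BoundaryLift γ₀ γ₁) (N : ℝ → (ℝ →ᵇ ℝ) → L2 0 1 → L2 0 1) (t : ℝ) (z : LCirc) :
    LCirc :=
  shift t (even (B.h₁' t) + odd (B.h₂' t - N t (B.vel t z) (B.uDot t z)))

/-- The unknown `Z` is `even (∂ₜ p - π') + odd (∂ₜ u - ℓ')`, seen in the frame that moves with the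
translation. The system differentiated in time becomes `∂ₜ z + ∂ₓ z = even h₁' + odd (h₂' - N)` on
the circle; in the moving frame the unbounded operator `∂ₓ` disappears. At time zero `∂ₜ p = 0` and
`∂ₜ u = -S 0 0`, which fixes the initial value. The bound `R` precedes `S` and `N`: it involves them
only through `K` and `σ`. -/
theorem exists_flow {T K σ : ℝ} (hT : 0 ≤ T) (hK : 0 ≤ K) (B : BoundaryLift γ₀ γ₁) :
    ∃ R : ℝ, ∀ {S : ℝ → (ℝ →ᵇ ℝ) → L2 0 1} {N : ℝ → (ℝ →ᵇ ℝ) → L2 0 1 → L2 0 1},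
      IsDamping T K S N → ‖S 0 0‖ ≤ σ → ∃ Z : ℝ → LCirc, Z 0 = odd (-S 0 0) ∧
        (∀ t ∈ Icc 0 T, HasDerivWithinAt Z (B.field N t (Z t)) (Icc 0 T) t) ∧
        ∀ t ∈ Icc 0 T, ‖B.pDot t (Z t)‖ ≤ R := by
  have hbd : ∀ {F : ℝ → L2 0 1}, Continuous F → ∃ C, 0 ≤ C ∧ ∀ t ∈ Icc 0 T, ‖F t‖ ≤ C := by
    intro F hF
    obtain ⟨C, hC⟩ := isCompact_Icc.exists_bound_of_continuousOn (hF.continuousOn (s := Icc 0 T))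
    exact ⟨max C 0, le_max_right _ _, fun t ht => (hC t ht).trans (le_max_left _ _)⟩
  obtain ⟨C₁, p₁, b₁⟩ := hbd B.continuous_h₁'
  obtain ⟨C₂, p₂, b₂⟩ := hbd B.continuous_h₂'
  obtain ⟨C₃, p₃, b₃⟩ := hbd B.continuous_π'
  obtain ⟨C₄, p₄, b₄⟩ := hbd B.continuous_ℓ'
  obtain ⟨C₅, b₅⟩ := isCompact_Icc.exists_bound_of_continuousOn
    (B.continuous_left.continuousOn (s := Icc 0 T))
  have p₅ : 0 ≤ C₅ := (norm_nonneg _).trans (b₅ 0 ⟨le_rfl, hT⟩)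
  refine ⟨gronwallBound σ (2 * K) (C₁ + C₂ + K * (1 + C₅ + C₃ + C₄)) T + C₃, ?_⟩
  intro S N hSN hS
  have hv : ∀ t ∈ Icc 0 T, ∀ z, ‖B.vel t z‖ ≤ C₅ + (‖z‖ + C₃) := fun t ht z =>
    (B.norm_vel_le t z).trans (by gcongr; exacts [b₅ t ht, b₃ t ht])
  have hu : ∀ t ∈ Icc 0 T, ∀ z, ‖B.uDot t z‖ ≤ ‖z‖ + C₄ := fun t ht z =>
    (B.norm_uDot_le t z).trans (by gcongr; exact b₄ t ht)
  have key := exists_forall_hasDerivWithinAt_of_linear_growth (F := B.field N)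
    (K := 2 * K) (ε := C₁ + C₂ + K * (1 + C₅ + C₃ + C₄)) (x₀ := odd (-S 0 0)) (δ := σ) hT
    (by positivity) (by positivity) (fun z => ?_) (fun R => ?_) (fun t ht z => ?_)
    (by rwa [norm_odd, norm_neg])
  · obtain ⟨Z, hZ0, hZ, hZb⟩ := key
    exact ⟨Z, hZ0, hZ, fun t ht => (B.norm_pDot_le _ _).trans (add_le_add (hZb t ht) (b₃ t ht))⟩
  · have hz : ContinuousOn (fun _ : ℝ => z) (Icc 0 T) := continuousOn_const
    refine continuousOn_shift continuous_id ((even.continuous.comp_continuousOn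
      B.continuous_h₁'.continuousOn).add (odd.continuous.comp_continuousOn
      (B.continuous_h₂'.continuousOn.sub ?_)))
    exact hSN.continuousOn (B.continuousOn_vel hz) (B.continuousOn_uDot hz)
  -- A radius that dominates both `vel` and `uDot` on the ball of radius `R`.
  · obtain ⟨L, hL0, hL⟩ := hSN.lipschitz (|R| + C₃ + C₄ + C₅)
    refine ⟨⟨2 * L, by positivity⟩, fun t ht => LipschitzOnWith.of_dist_le_mul fun z hz w hw => ?_⟩
    rw [mem_closedBall_zero_iff] at hz hw
    have hz' := hz.trans (le_abs_self R)
    have hw' := hw.trans (le_abs_self R)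
    rw [dist_eq_norm, dist_eq_norm, field, field, ← map_sub, LinearIsometry.norm_map,
      add_sub_add_left_eq_sub, ← map_sub, norm_odd, sub_sub_sub_cancel_left, norm_sub_rev]
    refine (hL t ht _ _ _ _ ((hv t ht z).trans ?_) ((hv t ht w).trans ?_)
      ((hu t ht z).trans ?_) ((hu t ht w).trans ?_)).trans ?_
    · linarith
    · linarith
    · linarith
    · linarith
    · change _ ≤ 2 * L * ‖z - w‖
      have h1 := mul_le_mul_of_nonneg_left (add_le_add (B.vel_sub t z w) (B.uDot_sub t z w)) hL0
      linarith
  · rw [field, LinearIsometry.norm_map]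
    refine (norm_add_le _ _).trans ?_
    rw [LinearIsometry.norm_map, norm_odd]
    have h1 := norm_sub_le (B.h₂' t) (N t (B.vel t z) (B.uDot t z))
    have h2 := hSN.growth t ht (B.vel t z) (B.uDot t z)
    have h3 := mul_le_mul_of_nonneg_left (add_le_add (hv t ht z) (hu t ht z)) hK
    have h4 := b₁ t ht
    have h5 := b₂ t ht
    linarith

end BoundaryLift

/-! ### Weak form of the reflected system and recovery of the solution -/

namespace Circ

/-- The derivative of the translation is moved to the test function, so `Z` needs no regularity in
space. -/
theorem hasDerivWithinAt_inner_shift {Z : ℝ → LCirc} {s : Set ℝ} {t : ℝ} {z' w w' : LCirc}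
    (hZ : HasDerivWithinAt Z (shift t z') s t)
    (hw : HasDerivAt (fun t => shift t w) (shift t w') t) :
    HasDerivWithinAt (fun r => inner ℝ (shift (-r) (Z r)) w)
      (inner ℝ z' w + inner ℝ (shift (-t) (Z t)) w') s t := by
  have h := hZ.inner ℝ hw.hasDerivWithinAt
  have e : ∀ r w, inner ℝ (shift (-r) (Z r)) w = inner ℝ (Z r) (shift r w) := fun r w => by
    rw [inner_shift_left, neg_neg]
  simp only [e]
  refine h.congr_deriv ?_
  rw [LinearIsometry.inner_map_map]
  ring

end Circ

/-- The constant function. -/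
def Sobolev.const (c : ℝ) : Sobolev 1 0 1 :=
  Sobolev.mk (L2.ofBCF (BoundedContinuousFunction.const ℝ c)) 0
    (isWeakDeriv_of_prim zero_le_one (c := c) (by
      filter_upwards [L2.coeFn_ofBCF (α := 0) (β := 1) (BoundedContinuousFunction.const ℝ c)]
        with x hx
      have : L2.prim (0 : L2 0 1) x = 0 := by
        have := L2.prim_smul 0 (0 : L2 0 1) x
        simpa using this
      rw [hx, this]
      simp))

theorem Sobolev.ev_const (c : ℝ) : EqOn (Sobolev.const c).ev (fun _ => c) (Icc 0 1) :=
  Sobolev.ev_mk_eqOn _ continuousOn_const (L2.coeFn_ofBCF _)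

namespace BoundaryLift

open Circ

variable {γ₀ γ₁ : ℝ → ℝ}

section

variable {T : ℝ} {S : ℝ → (ℝ →ᵇ ℝ) → L2 0 1} {N : ℝ → (ℝ →ᵇ ℝ) → L2 0 1 → L2 0 1}
  {Z : ℝ → LCirc}

theorem hasDerivWithinAt_evenPart (B : BoundaryLift γ₀ γ₁) {t : ℝ}
    (hZ : HasDerivWithinAt Z (B.field N t (Z t)) (Icc 0 T) t) {η η' : L2 0 1}
    (h : EvenTest η η') :
    HasDerivWithinAt (fun s => inner ℝ (evenPart (shift (-s) (Z s))) η)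
      (inner ℝ (B.h₁' t) η + inner ℝ (oddPart (shift (-t) (Z t))) η') (Icc 0 T) t := by
  simp only [inner_evenPart, inner_oddPart]
  refine (hasDerivWithinAt_inner_shift hZ (h t)).congr_deriv ?_
  rw [inner_add_left, inner_even_even, inner_odd_even, add_zero]

theorem hasDerivWithinAt_oddPart (B : BoundaryLift γ₀ γ₁) {t : ℝ}
    (hZ : HasDerivWithinAt Z (B.field N t (Z t)) (Icc 0 T) t) {θ θ' : L2 0 1}
    (h : OddTest θ θ') :
    HasDerivWithinAt (fun s => inner ℝ (oddPart (shift (-s) (Z s))) θ)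
      (inner ℝ (B.h₂' t - N t (B.vel t (Z t)) (B.uDot t (Z t))) θ
        + inner ℝ (evenPart (shift (-t) (Z t))) θ') (Icc 0 T) t := by
  simp only [inner_evenPart, inner_oddPart]
  refine (hasDerivWithinAt_inner_shift hZ (h t)).congr_deriv ?_
  rw [inner_add_left, inner_odd_odd, inner_even_odd, zero_add]

variable (B : BoundaryLift γ₀ γ₁)

/-- The mass balance, integrated in time. -/
theorem primitive_uDot {V : ℝ → L2 0 1} (hZ0 : Z 0 = odd (-S 0 0))
    (hZ : ∀ t ∈ Icc 0 T, HasDerivWithinAt Z (B.field N t (Z t)) (Icc 0 T) t) (hV0 : V 0 = 0)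
    (hV : ∀ t ∈ Icc 0 T, HasDerivWithinAt V (oddPart (shift (-t) (Z t))) (Icc 0 T) t) {t : ℝ}
    (ht : t ∈ Icc 0 T) :
    V t + (B.ℓ t).toL2 = L2.ofBCF (B.vel t (Z t)) ∧ B.vel t (Z t) 1 = γ₁ t := by
  have key : ∀ η η', EvenTest η η' →
      inner ℝ (evenPart (shift (-t) (Z t)) - B.h₁ t) η = inner ℝ (V t) η' := by
    intro η η' h
    -- The differentiated mass balance makes this quantity constant in time, and it vanishes at time
    -- zero.
    have hc : ∀ t ∈ Icc 0 T, HasDerivWithinAt (fun s => inner ℝ (evenPart (shift (-s) (Z s))) η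
        - inner ℝ (B.h₁ s) η - inner ℝ (V s) η') 0 (Icc 0 T) t := by
      intro t ht
      refine (((B.hasDerivWithinAt_evenPart (hZ t ht) h).sub
        ((B.hasDerivAt_h₁ t).hasDerivWithinAt.inner ℝ (hasDerivWithinAt_const t _ η))).sub
        ((hV t ht).inner ℝ (hasDerivWithinAt_const t _ η'))).congr_deriv ?_
      simp only [inner_zero_right]
      ring
    have h0 := eq_zero_of_hasDerivWithinAt_zero (by
      simp only [neg_zero, shift_zero, hZ0, evenPart_odd, hV0, B.h₁_zero, inner_zero_left, sub_zero])
      hc ht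
    rw [inner_sub_left]
    linarith
  -- Testing with even functions yields both the spatial derivative of `V t` and its zero boundary
  -- values.
  obtain ⟨h1, h2⟩ := ae_eq_neg_prim_of_evenTest key
  have hsum : ∀ x, L2.prim (B.pDot t (Z t)) x
      = L2.prim (evenPart (shift (-t) (Z t)) - B.h₁ t) x + L2.prim (B.π' t + B.h₁ t) x := by
    intro x
    rw [← L2.prim_add, pDot]
    congr 1
    abel
  constructor
  · refine Lp.ext ?_
    filter_upwards [h1, B.toL2_ℓ t, Lp.coeFn_add (V t) (B.ℓ t).toL2,
      L2.coeFn_ofBCF (α := 0) (β := 1) (B.vel t (Z t))] with x h1 h2 h3 h4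
    rw [h3, h4, Pi.add_apply, h1, h2]
    change _ = γ₀ t - L2.prim (B.pDot t (Z t)) x
    rw [hsum]
    ring
  · change γ₀ t - L2.prim (B.pDot t (Z t)) 1 = γ₁ t
    rw [hsum, h2, B.right_eq]
    ring

theorem vel_left (t : ℝ) (z : LCirc) : B.vel t z 0 = γ₀ t := by
  change γ₀ t - L2.prim (B.pDot t z) 0 = γ₀ t
  rw [L2.prim_left, sub_zero]

theorem isWeakDeriv_vel (t : ℝ) (z : LCirc) :
    IsWeakDeriv (L2.ofBCF (B.vel t z) : L2 0 1) (-B.pDot t z) := by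
  refine isWeakDeriv_of_prim zero_le_one (c := γ₀ t) ?_
  filter_upwards [L2.coeFn_ofBCF (α := 0) (β := 1) (B.vel t z)] with x hx
  rw [hx, ← neg_one_smul ℝ, L2.prim_smul]
  change γ₀ t - L2.prim (B.pDot t z) x = _
  ring

theorem pDot_init (hZ0 : Z 0 = odd (-S 0 0)) : B.pDot 0 (Z 0) = 0 := by
  rw [pDot, hZ0, neg_zero, shift_zero, evenPart_odd, B.π'_zero, add_zero]

theorem vel_init (hZ0 : Z 0 = odd (-S 0 0)) : B.vel 0 (Z 0) = 0 := by
  rw [vel, B.pDot_init hZ0, map_zero, sub_zero, B.left_zero]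
  rfl

/-- The momentum balance, integrated in time. -/
theorem primitive_pDot {P : ℝ → L2 0 1} (hZ0 : Z 0 = odd (-S 0 0))
    (hZ : ∀ t ∈ Icc 0 T, HasDerivWithinAt Z (B.field N t (Z t)) (Icc 0 T) t)
    (hS : ∀ t ∈ Icc 0 T, HasDerivWithinAt (fun s => S s (B.vel s (Z s)))
      (N t (B.vel t (Z t)) (B.uDot t (Z t))) (Icc 0 T) t) (hP0 : P 0 = 0)
    (hP : ∀ t ∈ Icc 0 T, HasDerivWithinAt P (evenPart (shift (-t) (Z t))) (Icc 0 T) t) {t : ℝ}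
    (ht : t ∈ Icc 0 T) :
    IsWeakDeriv (P t)
      (-(oddPart (shift (-t) (Z t)) - B.h₂ t + S t (B.vel t (Z t)))) := by
  -- Odd test functions give only the weak derivative, as they should: no boundary value of the
  -- pressure is prescribed.
  refine isWeakDeriv_of_oddTest fun θ θ' h => ?_
  have hc : ∀ t ∈ Icc 0 T, HasDerivWithinAt (fun s => inner ℝ (oddPart (shift (-s) (Z s))) θ
      - inner ℝ (B.h₂ s) θ + inner ℝ (S s (B.vel s (Z s))) θ - inner ℝ (P s) θ') 0 (Icc 0 T) t := by
    intro t ht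
    refine ((((B.hasDerivWithinAt_oddPart (hZ t ht) h).sub
      ((B.hasDerivAt_h₂ t).hasDerivWithinAt.inner ℝ (hasDerivWithinAt_const t _ θ))).add
      ((hS t ht).inner ℝ (hasDerivWithinAt_const t _ θ))).sub
      ((hP t ht).inner ℝ (hasDerivWithinAt_const t _ θ'))).congr_deriv ?_
    simp only [inner_zero_right, inner_sub_left]
    ring
  have h0 := eq_zero_of_hasDerivWithinAt_zero (by
    simp only [B.vel_init hZ0]
    simp only [neg_zero, shift_zero, hZ0, oddPart_odd, hP0, B.h₂_zero, inner_zero_left, sub_zero,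
      inner_neg_left]
    ring) hc ht
  rw [inner_add_left, inner_sub_left]
  linarith

end

/-- Existence of classical solutions of the damped wave system that start at rest. -/
theorem exists_isWave {T K σ : ℝ} (hT : 0 ≤ T) (hK : 0 ≤ K) (B : BoundaryLift γ₀ γ₁) (c : ℝ) :
    ∃ R : ℝ, ∀ {S : ℝ → (ℝ →ᵇ ℝ) → L2 0 1} {N : ℝ → (ℝ →ᵇ ℝ) → L2 0 1 → L2 0 1},
      IsDamping T K S N → ‖S 0 0‖ ≤ σ → ∃ (p u : ℝ → Sobolev 1 0 1) (U : ℝ → ℝ →ᵇ ℝ),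
        IsWave T (fun t => S t (U t)) p u ∧ (∀ t, EqOn (u t).ev (U t) (Icc 0 1)) ∧
        (∀ t ∈ Icc 0 T, (u t).ev 0 = γ₀ t ∧ (u t).ev 1 = γ₁ t ∧ ‖(u t).dx‖ ≤ R) ∧
        p 0 = Sobolev.const c ∧ u 0 = 0 := by
  obtain ⟨R, hR⟩ := B.exists_flow (σ := σ) hT hK
  refine ⟨R, fun {S N} hSN hS => ?_⟩
  obtain ⟨Z, hZ0, hZ, hZb⟩ := hR hSN hS
  have cZ : ContinuousOn Z (Icc 0 T) := fun t ht => (hZ t ht).continuousWithinAt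
  have cp := evenPart.continuous.comp_continuousOn (continuousOn_shift continuous_neg cZ)
  have cu := oddPart.continuous.comp_continuousOn (continuousOn_shift continuous_neg cZ)
  obtain ⟨P, hP0, hP⟩ := exists_primitive hT cp
  obtain ⟨V, hV0, hV⟩ := exists_primitive hT cu
  have hVU := fun t (ht : t ∈ Icc 0 T) => B.primitive_uDot hZ0 hZ hV0 hV ht
  -- The velocity recovered from the mass balance has `uDot` as its time derivative, so the even and
  -- odd halves of `Z` are consistent. Only after this can `N` be identified with the derivative of
  -- `S` along the velocity.
  have hU : ∀ t ∈ Icc 0 T, HasDerivWithinAt (fun s => (L2.ofBCF (B.vel s (Z s)) : L2 0 1))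
      (B.uDot t (Z t)) (Icc 0 T) t := fun t ht =>
    ((hV t ht).add (B.hasDerivAt_ℓ t).hasDerivWithinAt).congr (fun s hs => (hVU s hs).1.symm)
      (hVU t ht).1.symm
  have hSd := hSN.hasDerivWithinAt (B.continuousOn_vel cZ) (B.continuousOn_uDot cZ) hU
  have hPd := fun t (ht : t ∈ Icc 0 T) => B.primitive_pDot hZ0 hZ hSd hP0 hP ht
  -- The weak derivative of `P t` is available for `t ∈ [0, T]` only; the value 0 elsewhere is a
  -- default.
  have hPd' : ∀ t, ∃ q : Sobolev 1 0 1, t ∈ Icc 0 T → q.toL2 = P t ∧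
      q.dx = -(oddPart (shift (-t) (Z t)) - B.h₂ t + S t (B.vel t (Z t))) := fun t => by
    by_cases ht : t ∈ Icc 0 T
    · exact ⟨Sobolev.mk _ _ (hPd t ht), fun _ => ⟨rfl, rfl⟩⟩
    · exact ⟨0, fun h => absurd h ht⟩
  choose q hq using hPd'
  have hdp : ∀ t ∈ Icc 0 T, (Sobolev.const c + B.π t + q t).dx
      = -B.uDot t (Z t) - S t (B.vel t (Z t)) := fun t ht => by
    rw [Sobolev.dx_add, Sobolev.dx_add, (hq t ht).2, B.dx_π, Sobolev.const, Sobolev.dx_mk, uDot]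
    abel
  have cS : ContinuousOn (fun t => S t (B.vel t (Z t))) (Icc 0 T) := fun t ht =>
    (hSd t ht).continuousWithinAt
  have hp : ∀ t ∈ Icc 0 T, HasDerivWithinAt (fun s => (Sobolev.const c + B.π s + q s).toL2)
      (B.pDot t (Z t)) (Icc 0 T) t := fun t ht => by
    refine (((hP t ht).add (B.hasDerivAt_π t).hasDerivWithinAt).const_add
      (Sobolev.const c).toL2).congr (fun s hs => ?_) ?_
    · rw [Sobolev.toL2_add, Sobolev.toL2_add, (hq s hs).1, Pi.add_apply]
      abel
    · rw [Sobolev.toL2_add, Sobolev.toL2_add, (hq t ht).1, Pi.add_apply]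
      abel
  have hev : ∀ t, EqOn (Sobolev.mk _ _ (B.isWeakDeriv_vel t (Z t))).ev (B.vel t (Z t)) (Icc 0 1) :=
    fun t => Sobolev.ev_mk_eqOn _ (B.vel t (Z t)).continuous.continuousOn (L2.coeFn_ofBCF _)
  have h0T : (0 : ℝ) ∈ Icc 0 T := ⟨le_rfl, hT⟩
  refine ⟨fun t => Sobolev.const c + B.π t + q t,
    fun t => Sobolev.mk _ _ (B.isWeakDeriv_vel t (Z t)), fun t => B.vel t (Z t), ⟨?_, ?_, cS, ?_, ?_⟩,
    hev, fun t ht => ⟨?_, ?_, ?_⟩, ?_, ?_⟩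
  · refine Sobolev.continuousOn_of_toL2_dx (fun t ht => (hp t ht).continuousWithinAt) ?_
    exact ((B.continuousOn_uDot cZ).neg.sub cS).congr hdp
  · exact Sobolev.continuousOn_of_toL2_dx (fun t ht => (hU t ht).continuousWithinAt)
      (B.continuousOn_pDot cZ).neg
  · intro t ht
    refine (hp t ht).congr_deriv ?_
    rw [Sobolev.dx_mk, neg_neg]
  · intro t ht
    refine (hU t ht).congr_deriv ?_
    rw [hdp t ht]
    abel
  · rw [hev t (by simp), B.vel_left]
  · rw [hev t (by simp), (hVU t ht).2]
  · rw [Sobolev.dx_mk, norm_neg]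
    exact hZb t ht
  · refine Sobolev.ext_toL2 ?_
    rw [Sobolev.toL2_add, Sobolev.toL2_add, (hq 0 h0T).1, hP0, B.π_zero, Sobolev.toL2_zero, add_zero,
      add_zero]
  · refine Sobolev.ext_toL2 ?_
    rw [Sobolev.toL2_mk, B.vel_init hZ0, map_zero, Sobolev.toL2_zero]

end BoundaryLift

/-! ### Superposition operators -/

/-- The superposition operator `U ↦ G ∘ U`. -/
def superpose (G : C(ℝ, ℝ)) (U : ℝ →ᵇ ℝ) : ℝ →ᵇ ℝ where
  toContinuousMap := G.comp U.toContinuousMap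
  map_bounded' := by
    obtain ⟨C, hC⟩ := (isCompact_closedBall (0 : ℝ) ‖U‖).exists_bound_of_continuousOn
      G.continuous.continuousOn
    refine ⟨C + C, fun x y => (dist_le_norm_add_norm _ _).trans (add_le_add (hC _ ?_) (hC _ ?_))⟩ <;>
    · rw [mem_closedBall_zero_iff]
      exact U.norm_coe_le_norm _

/-- Functions at distance less than 1 from `U` take values in the ball of radius `‖U‖ + 1`, on which
`G` is uniformly continuous. -/
theorem continuous_superpose (G : C(ℝ, ℝ)) : Continuous (superpose G) := by
  rw [Metric.continuous_iff]
  intro U ε hε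
  obtain ⟨δ, hδ, h⟩ := Metric.uniformContinuousOn_iff.1
    ((isCompact_closedBall (0 : ℝ) (‖U‖ + 1)).uniformContinuousOn_of_continuous
      G.continuous.continuousOn) (ε / 2) (by positivity)
  refine ⟨min δ 1, by positivity, fun V hV => ?_⟩
  refine lt_of_le_of_lt ((BoundedContinuousFunction.dist_le (by positivity)).2 fun x => ?_)
    (half_lt_self hε)
  have h1 : dist (V x) (U x) < min δ 1 := (BoundedContinuousFunction.dist_coe_le_dist x).trans_lt hV
  refine (h _ ?_ _ ?_ (h1.trans_le (min_le_left _ _))).le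
  · rw [mem_closedBall_zero_iff]
    have h2 := h1.trans_le (min_le_right _ _)
    rw [dist_eq_norm] at h2
    have h3 := norm_sub_norm_le (V x) (U x)
    linarith [U.norm_coe_le_norm x]
  · rw [mem_closedBall_zero_iff]
    linarith [U.norm_coe_le_norm x]

theorem exists_abs_taylor_le {G g : C(ℝ, ℝ)} (hG : ∀ y, HasDerivAt G (g y) y) (M : ℝ) {ε : ℝ}
    (hε : 0 < ε) : ∃ δ > 0, ∀ a b : ℝ, |a| ≤ M → |b - a| < δ →
      |G b - G a - g a * (b - a)| ≤ ε * |b - a| := by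
  obtain ⟨δ, hδ, h⟩ := Metric.uniformContinuousOn_iff.1
    ((isCompact_closedBall (0 : ℝ) (M + 1)).uniformContinuousOn_of_continuous
      g.continuous.continuousOn) ε hε
  refine ⟨min δ 1, by positivity, fun a b ha hb => ?_⟩
  have key := (convex_ball a (min δ 1)).norm_image_sub_le_of_norm_hasDerivWithin_le (C := ε)
    (f := fun y : ℝ => G y - g a * y) (f' := fun y : ℝ => g y - g a * 1)
    (fun y _ => ((hG y).sub ((hasDerivAt_id y).const_mul (g a))).hasDerivWithinAt)
    (fun y hy => ?_) (Metric.mem_ball_self (by positivity)) (y := b)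
    (by rwa [Metric.mem_ball, Real.dist_eq])
  · refine le_trans (le_of_eq ?_) key
    rw [Real.norm_eq_abs]
    congr 1
    ring
  · rw [Metric.mem_ball, Real.dist_eq] at hy
    rw [mul_one, ← dist_eq_norm]
    refine (h y ?_ a ?_ ?_).le
    · rw [mem_closedBall_zero_iff, Real.norm_eq_abs]
      have := abs_sub_abs_le_abs_sub y a
      linarith [hy.trans_le (min_le_right _ _)]
    · rw [mem_closedBall_zero_iff, Real.norm_eq_abs]
      linarith
    · exact hy.trans_le (min_le_left _ _)

/-- The chain rule for superposition operators along curves that are continuous in the supremum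
norm and differentiable in `L²`. -/
theorem hasDerivWithinAt_superpose {G g : C(ℝ, ℝ)} (hG : ∀ y, HasDerivAt G (g y) y) {s : Set ℝ}
    {U : ℝ → ℝ →ᵇ ℝ} {Y : L2 0 1} {t : ℝ} (hc : ContinuousWithinAt U s t)
    (hU : HasDerivWithinAt (fun r => (L2.ofBCF (U r) : L2 0 1)) Y s t) :
    HasDerivWithinAt (fun r => (L2.ofBCF (superpose G (U r)) : L2 0 1))
      (L2.mulL (superpose g (U t)) Y) s t := by
  have h1 := (L2.mulL (α := 0) (β := 1) (superpose g (U t))).hasFDerivAt.comp_hasDerivWithinAt t hU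
  rw [hasDerivWithinAt_iff_isLittleO] at h1 ⊢
  -- Closeness in the supremum norm makes the pointwise Taylor remainder at most `ε |U r - U t|`,
  -- hence small against the `L²` norm of `U r - U t`. That norm is of order `r - t` by
  -- differentiability in `L²`.
  have h2 : (fun r => (L2.ofBCF (superpose G (U r)) : L2 0 1) - L2.ofBCF (superpose G (U t))
      - L2.mulL (superpose g (U t)) (L2.ofBCF (U r) - L2.ofBCF (U t)))
      =o[𝓝[s] t] fun r => r - t := by
    refine Asymptotics.IsLittleO.trans_isBigO (Asymptotics.isLittleO_iff.2 fun ε hε => ?_)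
      (hasDerivWithinAt_iff_hasFDerivWithinAt.1 hU).isBigO_sub
    obtain ⟨δ, hδ, h⟩ := exists_abs_taylor_le hG ‖U t‖ hε
    filter_upwards [hc (Metric.ball_mem_nhds _ hδ)] with r hr
    refine Lp.norm_le_mul_norm_of_ae_le_mul ?_
    filter_upwards [L2.coeFn_ofBCF (α := 0) (β := 1) (superpose G (U r)),
      L2.coeFn_ofBCF (α := 0) (β := 1) (superpose G (U t)), L2.coeFn_ofBCF (α := 0) (β := 1) (U r),
      L2.coeFn_ofBCF (α := 0) (β := 1) (U t),
      Lp.coeFn_sub (L2.ofBCF (superpose G (U r)) : L2 0 1) (L2.ofBCF (superpose G (U t))),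
      Lp.coeFn_sub ((L2.ofBCF (superpose G (U r)) : L2 0 1) - L2.ofBCF (superpose G (U t)))
        (L2.mulL (superpose g (U t)) (L2.ofBCF (U r) - L2.ofBCF (U t))),
      L2.coeFn_mulL (superpose g (U t)) (L2.ofBCF (U r) - L2.ofBCF (U t) : L2 0 1),
      Lp.coeFn_sub (L2.ofBCF (U r) : L2 0 1) (L2.ofBCF (U t))] with x a1 a2 a3 a4 a5 a6 a7 a8
    rw [a6, Pi.sub_apply, a5, Pi.sub_apply, a7, a8, Pi.sub_apply, a1, a2, a3, a4]
    refine h _ _ ((U t).norm_coe_le_norm x) ?_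
    rw [← Real.dist_eq]
    exact (BoundedContinuousFunction.dist_coe_le_dist x).trans_lt hr
  refine (h2.add h1).congr_left fun r => ?_
  simp only [Function.comp, map_sub]
  abel

namespace IsDamping

/-- The damping term `a(u)`. -/
theorem of_deriv {T K : ℝ} {a a' : C(ℝ, ℝ)} (h : ∀ y, HasDerivAt a (a' y) y) (hK : 0 ≤ K)
    (hb : ∀ y, |a' y| ≤ K) {M : ℝ≥0} (hl : LipschitzWith M a') :
    IsDamping T K (fun _ U => L2.ofBCF (superpose a U))
      (fun _ U Y => L2.mulL (superpose a' U) Y) where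
  continuousOn hU hY :=
    (L2.mulL.continuous.comp_continuousOn ((continuous_superpose a').comp_continuousOn hU)).clm_apply hY
  lipschitz R := by
    refine ⟨M * |R| + K, by positivity, fun t _ U U' Y Y' _ _ hY _ => ?_⟩
    -- The coefficient difference has to be measured in the supremum norm, since it multiplies an
    -- `L²` function; for this reason `U` is a bounded continuous function.
    have e : L2.mulL (superpose a' U) Y - L2.mulL (superpose a' U') Y'
        = L2.mulL (superpose a' U - superpose a' U') Y + L2.mulL (superpose a' U') (Y - Y') := by
      simp only [map_sub, sub_apply]
      abel
    have h1 : ‖superpose a' U - superpose a' U'‖ ≤ M * ‖U - U'‖ := by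
      rw [← dist_eq_norm, ← dist_eq_norm, BoundedContinuousFunction.dist_le (by positivity)]
      exact fun x => (hl.dist_le_mul _ _).trans
        (by gcongr; exact BoundedContinuousFunction.dist_coe_le_dist x)
    have h2 : ‖superpose a' U'‖ ≤ K := (BoundedContinuousFunction.norm_le hK).2 fun x => hb _
    rw [e]
    refine (norm_add_le _ _).trans ((add_le_add (L2.norm_mulL_le _ _) (L2.norm_mulL_le _ _)).trans ?_)
    calc ‖superpose a' U - superpose a' U'‖ * ‖Y‖ + ‖superpose a' U'‖ * ‖Y - Y'‖
        ≤ (M * ‖U - U'‖) * |R| + K * ‖Y - Y'‖ := by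
          gcongr
          exact hY.trans (le_abs_self R)
      _ ≤ (M * |R| + K) * (‖U - U'‖ + ‖Y - Y'‖) := by
          have : 0 ≤ K * ‖U - U'‖ + M * |R| * ‖Y - Y'‖ := by positivity
          linarith
  growth t _ U Y := by
    have h2 : ‖superpose a' U‖ ≤ K := (BoundedContinuousFunction.norm_le hK).2 fun x => hb _
    refine (L2.norm_mulL_le _ _).trans ?_
    gcongr
    linarith [norm_nonneg U]
  hasDerivWithinAt hU _ hd t ht := hasDerivWithinAt_superpose h (hU t ht) (hd t ht)

/-- The damping term `κ u + β` with coefficients depending on time and space. -/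
theorem of_linear {T : ℝ} {κ β : ℝ → ℝ →ᵇ ℝ} {κ' β' : ℝ → L2 0 1}
    (hκ : ContinuousOn κ (Icc 0 T)) (hκ' : ContinuousOn κ' (Icc 0 T))
    (hβ' : ContinuousOn β' (Icc 0 T))
    (dκ : ∀ t ∈ Icc 0 T, HasDerivWithinAt (fun s => (L2.ofBCF (κ s) : L2 0 1)) (κ' t) (Icc 0 T) t)
    (dβ : ∀ t ∈ Icc 0 T, HasDerivWithinAt (fun s => (L2.ofBCF (β s) : L2 0 1)) (β' t) (Icc 0 T) t) :
    ∃ K, 0 ≤ K ∧ IsDamping T K (fun t U => L2.ofBCF (κ t * U + β t))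
      (fun t U Y => L2.mulL U (κ' t) + L2.mulL (κ t) Y + β' t) := by
  obtain ⟨C₁, b₁⟩ := isCompact_Icc.exists_bound_of_continuousOn hκ
  obtain ⟨C₂, b₂⟩ := isCompact_Icc.exists_bound_of_continuousOn hκ'
  obtain ⟨C₃, b₃⟩ := isCompact_Icc.exists_bound_of_continuousOn hβ'
  have hle : ∀ t ∈ Icc 0 T, ‖κ t‖ ≤ |C₁| + |C₂| + |C₃| ∧ ‖κ' t‖ ≤ |C₁| + |C₂| + |C₃|
      ∧ ‖β' t‖ ≤ |C₁| + |C₂| + |C₃| := fun t ht =>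
    ⟨by linarith [b₁ t ht, le_abs_self C₁, abs_nonneg C₂, abs_nonneg C₃],
      by linarith [b₂ t ht, le_abs_self C₂, abs_nonneg C₁, abs_nonneg C₃],
      by linarith [b₃ t ht, le_abs_self C₃, abs_nonneg C₁, abs_nonneg C₂]⟩
  set C := |C₁| + |C₂| + |C₃| with hC
  have hC0 : 0 ≤ C := by positivity
  refine ⟨C, hC0, ⟨fun {U Y} hU hY => ?_, fun R => ⟨C, hC0, fun t ht U U' Y Y' _ _ _ _ => ?_⟩,
    fun t ht U Y => ?_, fun {U Y} hU hY hd t ht => ?_⟩⟩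
  · exact (((L2.mulL.continuous.comp_continuousOn hU).clm_apply hκ').add
      ((L2.mulL.continuous.comp_continuousOn hκ).clm_apply hY)).add hβ'
  · obtain ⟨h1, h2, -⟩ := hle t ht
    have e : L2.mulL U (κ' t) + L2.mulL (κ t) Y + β' t
        - (L2.mulL U' (κ' t) + L2.mulL (κ t) Y' + β' t)
        = L2.mulL (U - U') (κ' t) + L2.mulL (κ t) (Y - Y') := by
      simp only [map_sub, sub_apply]
      abel
    rw [e]
    refine (norm_add_le _ _).trans ((add_le_add (L2.norm_mulL_le _ _) (L2.norm_mulL_le _ _)).trans ?_)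
    rw [mul_add, mul_comm C ‖U - U'‖]
    gcongr
  · obtain ⟨h1, h2, h3⟩ := hle t ht
    refine (norm_add_le _ _).trans ((add_le_add ((norm_add_le _ _).trans
      (add_le_add (L2.norm_mulL_le _ _) (L2.norm_mulL_le _ _))) h3).trans ?_)
    have a1 := mul_le_mul_of_nonneg_left h2 (norm_nonneg U)
    have a2 := mul_le_mul_of_nonneg_right h1 (norm_nonneg Y)
    linarith
  -- Polarization: `κ U = (G(κ + U) - G(κ - U)) / 2`, so the product rule follows from the chain
  -- rule for superposition with `G`.
  · let G : C(ℝ, ℝ) := ⟨fun y => y ^ 2 / 2, by fun_prop⟩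
    have hG : ∀ y, HasDerivAt G (ContinuousMap.id ℝ y) y := fun y => by
      have := (hasDerivAt_pow 2 y).div_const 2
      refine this.congr_deriv ?_
      simp
    have hid : ∀ V, superpose (ContinuousMap.id ℝ) V = V := fun V => rfl
    have h1 := hasDerivWithinAt_superpose hG ((hκ t ht).add (hU t ht))
      (((dκ t ht).add (hd t ht)).congr_of_mem (fun s _ => map_add L2.ofBCF _ _) ht)
    have h2 := hasDerivWithinAt_superpose hG ((hκ t ht).sub (hU t ht))
      (((dκ t ht).sub (hd t ht)).congr_of_mem (fun s _ => map_sub L2.ofBCF _ _) ht)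
    refine ((((h1.sub h2).const_smul (1 / 2 : ℝ)).add (dβ t ht)).congr_of_mem
      (fun s _ => ?_) ht).congr_deriv ?_
    · have e : κ s * U s = (1 / 2 : ℝ) • (superpose G (κ s + U s) - superpose G (κ s - U s)) := by
        ext x
        change κ s x * U s x = 1 / 2 * ((κ s x + U s x) ^ 2 / 2 - (κ s x - U s x) ^ 2 / 2)
        ring
      rw [map_add, e, map_smul, map_sub]
      rfl
    · rw [hid, hid]
      simp only [map_sub, map_add, sub_apply, add_apply,
        Pi.add_apply, Pi.sub_apply]
      congr 1
      module

end IsDamping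

/-! ### Boundary data, point values and parameters -/

namespace L2

theorem exists_prim_eqOn {T : ℝ} {g g' : ℝ → ℝ}
    (hg : ∀ t ∈ Icc 0 T, HasDerivWithinAt g (g' t) (Icc 0 T) t) (hc : ContinuousOn g' (Icc 0 T))
    (h0 : g 0 = 0) : ∃ ρ : L2 0 T, EqOn (prim ρ) g (Icc 0 T) := by
  obtain ⟨C, hC⟩ := isCompact_Icc.exists_bound_of_continuousOn hc
  have hm : MemLp g' 2 (volume.restrict (Ioo 0 T)) :=
    MemLp.of_bound ((hc.mono Ioo_subset_Icc_self).aestronglyMeasurable measurableSet_Ioo) C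
      ((ae_restrict_mem measurableSet_Ioo).mono fun x hx => hC x (Ioo_subset_Icc_self hx))
  refine ⟨hm.toLp g', fun t ht => ?_⟩
  have hsub : Icc 0 t ⊆ Icc 0 T := Icc_subset_Icc_right ht.2
  rw [prim, prim_congr hm.coeFn_toLp]
  have e : ∫ s in (0 : ℝ)..t, (Ioo 0 T).indicator g' s = ∫ s in (0 : ℝ)..t, g' s := by
    refine intervalIntegral.integral_congr_ae ?_
    have : ∀ᵐ s : ℝ, s ≠ T := by simp [ae_iff]
    filter_upwards [this] with s hs h
    rw [uIoc_of_le ht.1] at h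
    have hm : s ∈ Ioo 0 T := ⟨h.1, lt_of_le_of_ne (h.2.trans ht.2) hs⟩
    exact indicator_of_mem hm _
  rw [e, IsWave.integral_eq_sub ht.1 (fun s hs => (hg s (hsub hs)).mono hsub) (hc.mono hsub), h0,
    sub_zero]

/-- The condition `ψ(T) = 0` makes the reversed function vanish at time zero. It is then a primitive
of an `L²` function and admits a boundary lift. -/
theorem exists_prim_reverse {T : ℝ} (hT : 0 < T) (ψ : Sobolev 1 0 T) (h : ψ.ev T = 0) :
    ∃ ρ : L2 0 T, EqOn (prim ρ) (fun t => ψ.ev (T - t)) (Icc 0 T) := by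
  have hmp : MeasurePreserving (fun t : ℝ => T - t) (volume.restrict (Ioo 0 T))
      (volume.restrict (Ioo 0 T)) := by
    have h1 := (Measure.measurePreserving_sub_left volume T).restrict_preimage
      (measurableSet_Ioo (a := (0 : ℝ)) (b := T))
    have h2 : (fun t : ℝ => T - t) ⁻¹' Ioo 0 T = Ioo 0 T := by
      ext t
      simp only [mem_preimage, mem_Ioo]
      constructor <;> rintro ⟨h1, h2⟩ <;> constructor <;> linarith
    rwa [h2] at h1
  refine ⟨-Lp.compMeasurePreserving _ hmp ψ.dx, fun t ht => ?_⟩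
  have e := Lp.coeFn_compMeasurePreserving ψ.dx hmp
  have hT' : T ∈ Icc 0 T := ⟨hT.le, le_rfl⟩
  have hTt : T - t ∈ Icc 0 T := ⟨by linarith [ht.2], by linarith [ht.1]⟩
  rw [← neg_one_smul ℝ, prim_smul, prim_eq _ ht]
  have e2 : ∫ s in (0 : ℝ)..t, (Lp.compMeasurePreserving _ hmp ψ.dx) s
      = ∫ s in (0 : ℝ)..t, (Ioo 0 T).indicator ψ.dx (T - s) := by
    refine intervalIntegral.integral_congr_ae ?_
    have : ∀ᵐ s : ℝ, s ≠ T := by simp [ae_iff]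
    filter_upwards [this, (ae_restrict_iff' measurableSet_Ioo).1 e] with s hs he h
    rw [uIoc_of_le ht.1] at h
    have hm : s ∈ Ioo 0 T := ⟨h.1, lt_of_le_of_ne (h.2.trans ht.2) hs⟩
    rw [he hm, indicator_of_mem (show T - s ∈ Ioo 0 T from ⟨by linarith [hm.2], by linarith [hm.1]⟩)]
    rfl
  rw [e2, intervalIntegral.integral_comp_sub_left (fun s => (Ioo 0 T).indicator ψ.dx s),
    integral_indicator_eq, sub_zero]
  have h1 := ψ.ev_eq_prim hT hT'
  have h2 := ψ.ev_eq_prim hT hTt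
  simp only
  linarith

theorem norm_ofBCF_const_le {ε : ℝ} (hε : 0 ≤ ε) :
    ‖(ofBCF (BoundedContinuousFunction.const ℝ ε) : L2 0 1)‖ ≤ ε := by
  refine (Lp.norm_le_of_ae_bound hε ?_).trans ?_
  · filter_upwards [coeFn_ofBCF (α := 0) (β := 1) (BoundedContinuousFunction.const ℝ ε)] with x hx
    rw [hx]
    exact (Real.norm_of_nonneg hε).le
  · simp [measureUnivNNReal]

theorem norm_le_of_ae_abs_le {f g : L2 0 1} {K ε : ℝ} (hK : 0 ≤ K) (hε : 0 ≤ ε)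
    (h : ∀ᵐ x ∂(volume.restrict (Ioo (0 : ℝ) 1)), |f x| ≤ K * |g x| + ε) :
    ‖f‖ ≤ K * ‖g‖ + ε := by
  have h1 : ‖f‖ ≤ ‖K • |g| + ofBCF (BoundedContinuousFunction.const ℝ ε)‖ := by
    refine Lp.norm_le_norm_of_ae_le ?_
    filter_upwards [h, Lp.coeFn_add (K • |g|) (ofBCF (BoundedContinuousFunction.const ℝ ε)),
      Lp.coeFn_smul K |g|, Lp.coeFn_abs g,
      coeFn_ofBCF (α := 0) (β := 1) (BoundedContinuousFunction.const ℝ ε)] with x a1 a2 a3 a4 a5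
    rw [a2, Pi.add_apply, a3, Pi.smul_apply, a4, a5]
    exact a1.trans (le_abs_self _)
  refine (h1.trans (norm_add_le _ _)).trans (add_le_add ?_ (norm_ofBCF_const_le hε))
  rw [norm_smul, norm_abs_eq_norm, Real.norm_of_nonneg hK]

end L2

namespace Sobolev

/-- The continuous representative of an `H¹` function, extended by constants. -/
def toBCF (f : Sobolev 1 0 1) : ℝ →ᵇ ℝ :=
  BoundedContinuousFunction.const ℝ (f.ev 0) + L2.primB f.dx

theorem toBCF_eqOn (f : Sobolev 1 0 1) : EqOn f.toBCF f.ev (Icc 0 1) :=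
  fun _ hx => (f.ev_eq_prim zero_lt_one hx).symm

theorem ofBCF_toBCF (f : Sobolev 1 0 1) : L2.ofBCF f.toBCF = f.toL2 := by
  refine Lp.ext ?_
  filter_upwards [L2.coeFn_ofBCF (α := 0) (β := 1) f.toBCF, f.toL2_ae_eq_ev zero_lt_one,
    ae_restrict_mem measurableSet_Ioo] with x h1 h2 h3
  rw [h1, h2, f.toBCF_eqOn (Ioo_subset_Icc_self h3)]

theorem continuousOn_toBCF {q : ℝ → Sobolev 1 0 1} {s : Set ℝ} (hq : ContinuousOn q s) :
    ContinuousOn (fun t => (q t).toBCF) s :=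
  (BoundaryLift.continuous_bcf_const.comp_continuousOn
    (IsWave.continuousOn_ev hq (by simp))).add
    (L2.primB.continuous.comp_continuousOn (continuous_dx.comp_continuousOn hq))

/-- Interpolation, from `f(x)² = 2 ∫ f f'` over `(0, x)` and Cauchy–Schwarz. A small `L²` norm and a
merely bounded derivative give a small supremum norm, of square-root order. -/
theorem sq_ev_le {f : Sobolev 1 0 1} (h0 : f.ev 0 = 0) {x : ℝ} (hx : x ∈ Icc (0 : ℝ) 1) :
    f.ev x ^ 2 ≤ 2 * ‖f.toL2‖ * ‖f.dx‖ := by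
  have hac : AbsolutelyContinuousOnInterval (L2.prim f.dx) 0 x :=
    (L2.integrable_indicator f.dx).intervalIntegrable.absolutelyContinuousOnInterval_intervalIntegral
      left_mem_uIcc
  have key := hac.integral_deriv_mul_eq_sub hac
  have hF : ∀ y ∈ Icc (0 : ℝ) 1, L2.prim f.dx y = f.ev y := fun y hy => by
    rw [f.ev_eq_prim zero_lt_one hy, h0, zero_add]
  rw [L2.prim_left, mul_zero, sub_zero, hF x hx, ← sq] at key
  rw [← key, intervalIntegral.integral_of_le hx.1]
  have hpos : ∀ y, 0 ≤ (2 : ℝ) * (|f.toL2 y| * |f.dx y|) := fun y => by positivity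
  have hsub : Ioo 0 x ⊆ Ioo (0 : ℝ) 1 := Ioo_subset_Ioo_right hx.2
  have hint : IntegrableOn (fun y => (2 : ℝ) * (|f.toL2 y| * |f.dx y|)) (Ioo 0 1) :=
    ((Lp.memLp f.toL2).abs.integrable_mul (Lp.memLp f.dx).abs).const_mul 2
  calc ∫ y in Ioc 0 x, (deriv (L2.prim f.dx) y * L2.prim f.dx y
          + L2.prim f.dx y * deriv (L2.prim f.dx) y)
      = ∫ y in Ioo 0 x, 2 * (f.toL2 y * f.dx y) := by
        rw [integral_Ioc_eq_integral_Ioo]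
        refine integral_congr_ae (ae_restrict_of_ae_restrict_of_subset hsub ?_)
        filter_upwards [L2.ae_hasDerivAt_prim f.dx, f.toL2_ae_eq_ev zero_lt_one,
          ae_restrict_mem measurableSet_Ioo] with y h1 h2 h3
        rw [h1.deriv, hF y (Ioo_subset_Icc_self h3), h2]
        ring
    _ ≤ ∫ y in Ioo 0 x, 2 * (|f.toL2 y| * |f.dx y|) := by
        have hi : IntegrableOn (fun y => (2 : ℝ) * (f.toL2 y * f.dx y)) (Ioo 0 1) :=
          ((Lp.memLp f.toL2).integrable_mul (Lp.memLp f.dx)).const_mul 2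
        refine integral_mono (hi.mono_set hsub) (hint.mono_set hsub) fun y => ?_
        simp only
        rw [← abs_mul]
        gcongr
        exact le_abs_self _
    _ ≤ ∫ y in Ioo 0 1, 2 * (|f.toL2 y| * |f.dx y|) :=
        setIntegral_mono_set hint (Eventually.of_forall hpos) hsub.eventuallyLE
    _ = 2 * inner ℝ |f.toL2| |f.dx| := by
        rw [integral_const_mul, ← L2.integral_Ioo_mul]
        congr 1
        refine integral_congr_ae ?_
        filter_upwards [Lp.coeFn_abs f.toL2, Lp.coeFn_abs f.dx] with y h1 h2
        rw [h1, h2]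
    _ ≤ 2 * ‖f.toL2‖ * ‖f.dx‖ := by
        have := real_inner_le_norm |f.toL2| |f.dx|
        rw [norm_abs_eq_norm, norm_abs_eq_norm] at this
        linarith

/-- A constant for the embedding of `H¹(α, β)` into the continuous functions. -/
def embConst (α β : ℝ) : ℝ := (√(β - α))⁻¹ + 2 * √(β - α)

theorem embConst_nonneg (α β : ℝ) : 0 ≤ embConst α β := by unfold embConst; positivity

theorem abs_ev_le_embConst {α β : ℝ} (hαβ : α < β) {f : Sobolev 1 α β} {C : ℝ} (h₀ : ‖f.toL2‖ ≤ C)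
    (h₁ : ‖f.dx‖ ≤ C) {x : ℝ} (hx : x ∈ Icc α β) : |f.ev x| ≤ embConst α β * C := by
  refine (f.abs_ev_le hαβ hx).trans ?_
  rw [embConst, add_mul, mul_assoc]
  gcongr

/-- An `H²` function has a `C¹` extension to the real line. -/
theorem exists_extension {α β : ℝ} (hαβ : α < β) (b : Sobolev 2 α β) :
    ∃ G g : C(ℝ, ℝ), (∀ y, HasDerivAt G (g y) y) ∧ EqOn b.ev G (Icc α β) ∧
      (∀ y, |g y| ≤ embConst α β * ‖b‖) ∧ ∀ y ∈ Icc α β, |G y| ≤ embConst α β * ‖b‖ := by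
  have hn : ∀ i, ‖b.1 i‖ ≤ ‖b‖ := fun i => PiLp.norm_apply_le b.1 i
  obtain ⟨b₀, h₀₀, h₀₁⟩ : ∃ b₀ : Sobolev 1 α β, b₀.toL2 = b.toL2 ∧ b₀.dx = b.1 1 :=
    ⟨mk (b.1 0) (b.1 1) (b.2 0), rfl, rfl⟩
  obtain ⟨b₁, h₁₀, h₁₁⟩ : ∃ b₁ : Sobolev 1 α β, b₁.toL2 = b.1 1 ∧ b₁.dx = b.1 2 :=
    ⟨mk (b.1 1) (b.1 2) (b.2 1), rfl, rfl⟩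
  -- The derivative is extended by constants and then integrated, which preserves its bound.
  have hg : Continuous (IccExtend hαβ.le ((Icc α β).domRestrict b₁.ev)) :=
    (continuousOn_iff_continuous_domRestrict.1 (b₁.continuousOn_ev hαβ)).Icc_extend'
  have hb : ∀ y, IccExtend hαβ.le ((Icc α β).domRestrict b₁.ev) y
      = b₁.ev (projIcc α β hαβ.le y) := fun y => rfl
  set g := IccExtend hαβ.le ((Icc α β).domRestrict b₁.ev) with hgdef
  have hG : ∀ y, HasDerivAt (fun y => b₀.ev α + ∫ s in α..y, g s) (g y) y := fun y =>
    (hg.integral_hasStrictDerivAt α y).hasDerivAt.const_add _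
  have e0 : EqOn b₀.ev (fun y => b₀.ev α + ∫ s in α..y, g s) (Icc α β) := by
    intro y hy
    rw [b₀.ev_eq_prim hαβ hy, L2.prim_eq _ hy, h₀₁, ← h₁₀]
    simp only
    congr 1
    refine intervalIntegral.integral_congr_ae ?_
    have : ∀ᵐ s : ℝ, s ≠ β := by simp [ae_iff]
    filter_upwards [this, (ae_restrict_iff' measurableSet_Ioo).1 (b₁.toL2_ae_eq_ev hαβ)]
      with s hs h1 h2
    rw [uIoc_of_le hy.1] at h2
    have hm : s ∈ Ioo α β := ⟨h2.1, lt_of_le_of_ne (h2.2.trans hy.2) hs⟩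
    rw [hgdef, IccExtend_of_mem hαβ.le _ (Ioo_subset_Icc_self hm)]
    exact h1 hm
  have hbev : EqOn b.ev b₀.ev (Icc α β) :=
    ev_eqOn hαβ (b₀.continuousOn_ev hαβ) (h₀₀ ▸ b₀.toL2_ae_eq_ev hαβ)
  refine ⟨⟨_, continuous_iff_continuousAt.2 fun y => (hG y).continuousAt⟩, ⟨g, hg⟩, hG,
    fun y hy => (hbev hy).trans (e0 hy), fun y => ?_, fun y hy => ?_⟩
  · change |g y| ≤ _
    rw [hb]
    exact abs_ev_le_embConst hαβ (h₁₀ ▸ hn 1) (h₁₁ ▸ hn 2) (projIcc α β hαβ.le y).2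
  · change |b₀.ev α + ∫ s in α..y, g s| ≤ _
    have := e0 hy
    simp only at this
    rw [← this]
    exact abs_ev_le_embConst hαβ (h₀₀ ▸ hn 0) (h₀₁ ▸ hn 1) hy

end Sobolev

/-! ### Uniqueness and pressure drops -/

/-- The difference has homogeneous data and a source controlled by its own velocity, so the energy
estimate applies with `ε = 0`. -/
theorem IsWave.eqOn_of_norm_sub_le {T K : ℝ} (hT : 0 < T) (hK : 0 ≤ K) {f₁ f₂ : ℝ → L2 0 1}
    {p₁ u₁ p₂ u₂ : ℝ → Sobolev 1 0 1} (h₁ : IsWave T f₁ p₁ u₁) (h₂ : IsWave T f₂ p₂ u₂)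
    (hp : p₁ 0 = p₂ 0) (hu : u₁ 0 = u₂ 0) (hl : ∀ t ∈ Icc 0 T, (u₁ t).ev 0 = (u₂ t).ev 0)
    (hr : ∀ t ∈ Icc 0 T, (u₁ t).ev 1 = (u₂ t).ev 1)
    (hf : ∀ t ∈ Icc 0 T, ‖f₁ t - f₂ t‖ ≤ K * ‖(u₁ t).toL2 - (u₂ t).toL2‖) :
    EqOn p₁ p₂ (Icc 0 T) ∧ EqOn u₁ u₂ (Icc 0 T) := by
  obtain ⟨C, -, hC⟩ := IsWave.exists_bound hT hK
  have key := (hC (h₁.sub h₂) (ε := 0) (by simp [hp]) (by simp [hu])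
    (fun t ht => by
      rw [Pi.sub_apply, Sobolev.ev_sub zero_lt_one _ _ (by simp), hl t ht, sub_self])
    (fun t ht => by
      rw [Pi.sub_apply, Sobolev.ev_sub zero_lt_one _ _ (by simp), hr t ht, sub_self]) le_rfl
    (fun t ht => by simpa using hf t ht)).1
  constructor <;> intro t ht
  · refine Sobolev.ext_toL2 (sub_eq_zero.1 (norm_le_zero_iff.1 ?_))
    simpa using (key t ht).1
  · refine Sobolev.ext_toL2 (sub_eq_zero.1 (norm_le_zero_iff.1 ?_))
    simpa using (key t ht).2

theorem exists_isPressureDrop {T : ℝ} {p : ℝ → Sobolev 1 0 1} (hp : ContinuousOn p (Icc 0 T)) :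
    ∃ y : L2 0 T, IsPressureDrop p y := by
  have hc : ContinuousOn (fun t => (p t).ev 0 - (p t).ev 1) (Icc 0 T) :=
    (IsWave.continuousOn_ev hp (by simp)).sub (IsWave.continuousOn_ev hp (by simp))
  obtain ⟨C, hC⟩ := isCompact_Icc.exists_bound_of_continuousOn hc
  have hm : MemLp (fun t => (p t).ev 0 - (p t).ev 1) 2 (volume.restrict (Ioo 0 T)) :=
    MemLp.of_bound ((hc.mono Ioo_subset_Icc_self).aestronglyMeasurable measurableSet_Ioo) C
      ((ae_restrict_mem measurableSet_Ioo).mono fun x hx => hC x (Ioo_subset_Icc_self hx))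
  exact ⟨hm.toLp _, hm.coeFn_toLp⟩

namespace IsPressureDrop

variable {T : ℝ} {p p₁ p₂ : ℝ → Sobolev 1 0 1} {y y₁ y₂ : L2 0 T}

theorem unique (h₁ : IsPressureDrop p y₁) (h₂ : IsPressureDrop p y₂) : y₁ = y₂ :=
  Lp.ext (h₁.trans h₂.symm)

theorem congr (h : IsPressureDrop p₁ y) (he : EqOn p₁ p₂ (Icc 0 T)) : IsPressureDrop p₂ y := by
  refine h.trans ?_
  filter_upwards [ae_restrict_mem measurableSet_Ioo] with t ht
  rw [he (Ioo_subset_Icc_self ht)]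

theorem sub (h₁ : IsPressureDrop p₁ y₁) (h₂ : IsPressureDrop p₂ y₂) :
    IsPressureDrop (p₁ - p₂) (y₁ - y₂) := by
  refine (Lp.coeFn_sub y₁ y₂).trans ?_
  filter_upwards [h₁, h₂] with t a₁ a₂
  rw [Pi.sub_apply, a₁, a₂, Pi.sub_apply, Sobolev.ev_sub zero_lt_one _ _ (by simp),
    Sobolev.ev_sub zero_lt_one _ _ (by simp)]
  ring

theorem add (h₁ : IsPressureDrop p₁ y₁) (h₂ : IsPressureDrop p₂ y₂) :
    IsPressureDrop (p₁ + p₂) (y₁ + y₂) := by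
  refine (Lp.coeFn_add y₁ y₂).trans ?_
  filter_upwards [h₁, h₂] with t a₁ a₂
  rw [Pi.add_apply, a₁, a₂, Pi.add_apply, Sobolev.ev_add zero_lt_one _ _ (by simp),
    Sobolev.ev_add zero_lt_one _ _ (by simp)]
  ring

theorem smul (c : ℝ) (h : IsPressureDrop p y) : IsPressureDrop (c • p) (c • y) := by
  refine (Lp.coeFn_smul c y).trans ?_
  filter_upwards [h] with t a
  rw [Pi.smul_apply, a, Pi.smul_apply, Sobolev.ev_smul zero_lt_one _ _ (by simp),
    Sobolev.ev_smul zero_lt_one _ _ (by simp), smul_eq_mul]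
  ring

end IsPressureDrop

/-! ### States -/

namespace PipeData

variable {D : PipeData}

namespace IsDampingLaw

variable {a : ℝ → ℝ}

theorem hasDerivAt (ha : D.IsDampingLaw a) (y : ℝ) : HasDerivAt a (deriv a y) y :=
  (ha.contDiff.differentiable (by simp) y).hasDerivAt

theorem contDiff_deriv (ha : D.IsDampingLaw a) : ContDiff ℝ 1 (deriv a) :=
  ((contDiff_succ_iff_deriv (n := 1)).1 ha.contDiff).2.2

theorem hasDerivAt_deriv (ha : D.IsDampingLaw a) (y : ℝ) :
    HasDerivAt (deriv a) (deriv (deriv a) y) y :=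
  (ha.contDiff_deriv.differentiable (by simp) y).hasDerivAt

theorem abs_deriv_le (hD : D.Admissible) (ha : D.IsDampingLaw a) (y : ℝ) : |deriv a y| ≤ D.a₁ := by
  have h := ha.deriv_mem y
  rw [abs_of_nonneg (hD.a₀_pos.le.trans h.1)]
  exact h.2

theorem abs_deriv_deriv_le (ha : D.IsDampingLaw a) (y : ℝ) : |deriv (deriv a) y| ≤ D.a₂ := by
  have h := ha.abs_deriv2_le y
  rwa [iteratedDeriv_succ, iteratedDeriv_one] at h

/-- A damping law as a continuous map. -/
def toC (ha : D.IsDampingLaw a) : C(ℝ, ℝ) := ⟨a, ha.contDiff.continuous⟩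

/-- The derivative of a damping law as a continuous map. -/
def derivC (ha : D.IsDampingLaw a) : C(ℝ, ℝ) := ⟨deriv a, ha.contDiff_deriv.continuous⟩

/-- The second derivative of a damping law as a continuous map. -/
def deriv2C (ha : D.IsDampingLaw a) : C(ℝ, ℝ) :=
  ⟨deriv (deriv a), ha.contDiff_deriv.continuous_deriv (by simp)⟩

theorem lipschitzWith_deriv (ha : D.IsDampingLaw a) :
    LipschitzWith D.a₂.toNNReal (deriv a) := by
  refine lipschitzWith_of_nnnorm_deriv_le (ha.contDiff_deriv.differentiable (by simp)) fun y => ?_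
  rw [← NNReal.coe_le_coe, coe_nnnorm, Real.norm_eq_abs]
  exact (ha.abs_deriv_deriv_le y).trans (Real.le_coe_toNNReal _)

theorem abs_sub_le (hD : D.Admissible) (ha : D.IsDampingLaw a) (x y : ℝ) :
    |a y - a x| ≤ D.a₁ * |y - x| :=
  convex_univ.norm_image_sub_le_of_norm_hasDerivWithin_le
    (fun z _ => (ha.hasDerivAt z).hasDerivWithinAt) (fun z _ => ha.abs_deriv_le hD z) (mem_univ _)
    (mem_univ _)

/-- Mean value inequality for `z ↦ a z - deriv a x * z`; the sharp factor `1/2` is given away. -/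
theorem abs_taylor_le (hD : D.Admissible) (ha : D.IsDampingLaw a) (x y : ℝ) :
    |a y - a x - deriv a x * (y - x)| ≤ D.a₂ * |y - x| * |y - x| := by
  have key := (convex_uIcc x y).norm_image_sub_le_of_norm_hasDerivWithin_le
    (C := D.a₂ * |y - x|) (f := fun z => a z - deriv a x * z)
    (f' := fun z => deriv a z - deriv a x * 1)
    (fun z _ => ((ha.hasDerivAt z).sub ((hasDerivAt_id z).const_mul _)).hasDerivWithinAt)
    (fun z hz => ?_) left_mem_uIcc right_mem_uIcc
  · refine le_trans (le_of_eq ?_) key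
    rw [Real.norm_eq_abs]
    congr 1
    ring
  · have h := ha.lipschitzWith_deriv.dist_le_mul z x
    rw [Real.coe_toNNReal _ hD.a₂_pos.le, Real.dist_eq, Real.dist_eq] at h
    rw [mul_one, Real.norm_eq_abs]
    refine h.trans (mul_le_mul_of_nonneg_left ?_ hD.a₂_pos.le)
    exact abs_sub_left_of_mem_uIcc hz

end IsDampingLaw

/-- The boundary data admit a lift. -/
theorem Admissible.exists_boundaryLift (hD : D.Admissible) : ∃ γ₀ γ₁ : ℝ → ℝ,
    EqOn γ₀ D.g₀ (Icc 0 D.T) ∧ EqOn γ₁ D.g₁ (Icc 0 D.T) ∧ Nonempty (BoundaryLift γ₀ γ₁) := by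
  have hu := uniqueDiffOn_Icc hD.T_pos
  have key : ∀ g : ℝ → ℝ, ContDiffOn ℝ 4 g (Icc 0 D.T) → g 0 = 0 →
      ∃ ρ : L2 0 D.T, EqOn (L2.prim ρ) g (Icc 0 D.T) := fun g hg h0 =>
    L2.exists_prim_eqOn (fun t ht => (hg.differentiableOn (by simp) t ht).hasDerivWithinAt)
      (hg.continuousOn_derivWithin hu (by norm_num)) h0
  obtain ⟨ρ₀, h₀⟩ := key _ hD.contDiffOn_g₀ hD.g₀_zero
  obtain ⟨ρ₁, h₁⟩ := key _ hD.contDiffOn_g₁ hD.g₁_zero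
  exact ⟨_, _, h₀, h₁, BoundaryLift.nonempty ρ₀ ρ₁⟩

/-- Since `a 0 = 0` the initial source is zero, and `|a'| ≤ a₁` supplies the growth constant. The
bound `R` on `∂ₓ u` is therefore common to all damping laws, a uniformity that the remainder
estimate for `F` needs. -/
theorem Admissible.exists_isState (hD : D.Admissible) : ∃ R : ℝ, ∀ a, D.IsDampingLaw a →
    ∃ p u, D.IsState a p u ∧ ∀ t ∈ Icc 0 D.T, ‖(u t).dx‖ ≤ R := by
  obtain ⟨γ₀, γ₁, h₀, h₁, ⟨B⟩⟩ := hD.exists_boundaryLift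
  obtain ⟨R, hR⟩ := B.exists_isWave (σ := 0) hD.T_pos.le hD.a₁_pos.le D.c
  refine ⟨R, fun a ha => ?_⟩
  have hS : (L2.ofBCF (superpose ha.toC 0) : L2 0 1) = 0 := by
    have : superpose ha.toC 0 = 0 := by
      ext x
      exact ha.zero
    rw [this, map_zero]
  obtain ⟨p, u, U, hw, hU, hb, hp, hu⟩ := hR (IsDamping.of_deriv (T := D.T) (a := ha.toC)
    (a' := ha.derivC) ha.hasDerivAt hD.a₁_pos.le (ha.abs_deriv_le hD) ha.lipschitzWith_deriv)
    (by rw [hS, norm_zero])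
  refine ⟨p, u, ⟨hw.isClassicalSolution hD.T_pos (fun t ht => ?_)
    (fun t ht => (hb t ht).1.trans (h₀ ht)) (fun t ht => (hb t ht).2.1.trans (h₁ ht)),
    fun x hx => ⟨?_, ?_⟩⟩, fun t ht => (hb t ht).2.2⟩
  · filter_upwards [L2.coeFn_ofBCF (α := 0) (β := 1) (superpose ha.toC (U t)),
      ae_restrict_mem measurableSet_Ioo] with x h1 h2
    rw [h1, hU t (Ioo_subset_Icc_self h2)]
    rfl
  · rw [hp, Sobolev.ev_const D.c hx]
  · rw [hu, Sobolev.ev_zero zero_lt_one hx]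

namespace IsState

variable {a a' : ℝ → ℝ} {p u p' u' : ℝ → Sobolev 1 0 1}

theorem p_init (h : D.IsState a p u) : p 0 = Sobolev.const D.c :=
  Sobolev.ext_ev zero_lt_one fun x hx => by
    rw [(h.2 x (Ioo_subset_Icc_self hx)).1, Sobolev.ev_const D.c (Ioo_subset_Icc_self hx)]

theorem u_init (h : D.IsState a p u) : u 0 = 0 :=
  Sobolev.ext_ev zero_lt_one fun x hx => by
    rw [(h.2 x (Ioo_subset_Icc_self hx)).2, Sobolev.ev_zero zero_lt_one (Ioo_subset_Icc_self hx)]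

/-- A state depends only on the restriction of the damping law to `[lo, hi]`. -/
theorem congr (hD : D.Admissible) (ha : D.IsDampingLaw a) (h : D.IsState a p u)
    (he : EqOn a a' (Icc D.lo D.hi)) : D.IsState a' p u := by
  refine ⟨{ h.1 with momentum := fun t ht => ?_ }, h.2⟩
  filter_upwards [h.1.momentum t ht, ae_restrict_mem measurableSet_Ioo] with x hx hm
  rwa [← he (hD.velocity_mem a ha p u h t ht x (Ioo_subset_Icc_self hm))]

theorem eqOn (hD : D.Admissible) (ha : D.IsDampingLaw a) (h : D.IsState a p u)
    (h' : D.IsState a p' u') : EqOn p p' (Icc 0 D.T) ∧ EqOn u u' (Icc 0 D.T) := by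
  obtain ⟨f, hw, hf⟩ := h.1.exists_isWave hD.T_pos
  obtain ⟨f', hw', hf'⟩ := h'.1.exists_isWave hD.T_pos
  refine hw.eqOn_of_norm_sub_le hD.T_pos hD.a₁_pos.le hw' (h.p_init.trans h'.p_init.symm)
    (h.u_init.trans h'.u_init.symm) (fun t ht => (h.1.left t ht).trans (h'.1.left t ht).symm)
    (fun t ht => (h.1.right t ht).trans (h'.1.right t ht).symm) fun t ht => ?_
  refine Lp.norm_le_mul_norm_of_ae_le_mul ?_
  filter_upwards [hf t ht, hf' t ht, Lp.coeFn_sub (f t) (f' t),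
    Lp.coeFn_sub (u t).toL2 (u' t).toL2, (u t).toL2_ae_eq_ev zero_lt_one,
    (u' t).toL2_ae_eq_ev zero_lt_one] with x h1 h2 h3 h4 h5 h6
  rw [h3, h4, Pi.sub_apply, Pi.sub_apply, h1, h2, h5, h6]
  exact ha.abs_sub_le hD _ _

/-- Damping laws with the same restriction have the same states. -/
theorem eqOn_of_isRestriction (hD : D.Admissible) {A : D.H2} (ha : D.IsDampingLaw a)
    (hA : D.IsRestriction a A) (h : D.IsState a p u) (ha' : D.IsDampingLaw a')
    (hA' : D.IsRestriction a' A) (h' : D.IsState a' p' u') :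
    EqOn p p' (Icc 0 D.T) ∧ EqOn u u' (Icc 0 D.T) :=
  h.eqOn hD ha (h'.congr hD ha' fun _ hx => (hA' hx).symm.trans (hA hx))

/-- The choice in `forward` is immaterial: velocities stay in `[lo, hi]`, so laws with the same
restriction share their states, and states are unique. -/
theorem isPressureDrop_forward (hD : D.Admissible) {A : D.H2} (ha : D.IsDampingLaw a)
    (hA : D.IsRestriction a A) (h : D.IsState a p u) : IsPressureDrop p (D.forward A) := by
  have hex : ∃ y : L2 0 D.T, ∃ a p u, D.IsDampingLaw a ∧ D.IsRestriction a A ∧ D.IsState a p u ∧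
      IsPressureDrop p y := by
    obtain ⟨y, hy⟩ := exists_isPressureDrop h.1.continuousOn_p
    exact ⟨y, a, p, u, ha, hA, h, hy⟩
  rw [forward, dif_pos hex]
  obtain ⟨a', p', u', ha', hA', h', hy'⟩ := hex.choose_spec
  exact hy'.congr (h'.eqOn_of_isRestriction hD ha' hA' ha hA h).1

end IsState

end PipeData

/-! ### Linear systems along a given velocity -/

/-- The coefficients `K(U)` and `G(U)` are continuous in the supremum norm and differentiable in
`L²` by the chain rule, as `IsDamping.of_linear` requires. The sensitivity system and the reversed
adjoint system both have this form, with `K` the derivative of the damping law. -/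
theorem BoundaryLift.exists_isWave_linear {T : ℝ} (hT : 0 ≤ T) {γ₀ γ₁ : ℝ → ℝ}
    (B : BoundaryLift γ₀ γ₁) {U : ℝ → ℝ →ᵇ ℝ} {Y : ℝ → L2 0 1} (hU : ContinuousOn U (Icc 0 T))
    (hY : ContinuousOn Y (Icc 0 T))
    (hd : ∀ t ∈ Icc 0 T, HasDerivWithinAt (fun s => (L2.ofBCF (U s) : L2 0 1)) (Y t) (Icc 0 T) t)
    {K k G g : C(ℝ, ℝ)} (hK : ∀ y, HasDerivAt K (k y) y) (hG : ∀ y, HasDerivAt G (g y) y) :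
    ∃ f r w, IsWave T f r w ∧ (∀ t, f t =ᵐ[volume.restrict (Ioo 0 1)]
        fun x => K (U t x) * (w t).ev x + G (U t x)) ∧
      (∀ t ∈ Icc 0 T, (w t).ev 0 = γ₀ t ∧ (w t).ev 1 = γ₁ t) ∧ r 0 = 0 ∧ w 0 = 0 := by
  have c₁ : ∀ F : C(ℝ, ℝ), ContinuousOn (fun t => superpose F (U t)) (Icc 0 T) := fun F =>
    (continuous_superpose F).comp_continuousOn hU
  have c₂ : ∀ F : C(ℝ, ℝ), ContinuousOn (fun t => L2.mulL (superpose F (U t)) (Y t)) (Icc 0 T) :=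
    fun F => (L2.mulL.continuous.comp_continuousOn (c₁ F)).clm_apply hY
  obtain ⟨C, hC, h⟩ := IsDamping.of_linear (c₁ K) (c₂ k) (c₂ g)
    (fun t ht => hasDerivWithinAt_superpose hK (hU t ht) (hd t ht))
    (fun t ht => hasDerivWithinAt_superpose hG (hU t ht) (hd t ht))
  obtain ⟨R, hR⟩ := B.exists_isWave hT hC 0
  obtain ⟨r, w, W, hw, hW, hb, hr0, hw0⟩ := hR h le_rfl
  refine ⟨_, r, w, hw, fun t => ?_, fun t ht => ⟨(hb t ht).1, (hb t ht).2.1⟩, ?_, hw0⟩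
  · filter_upwards [L2.coeFn_ofBCF (α := 0) (β := 1) (superpose K (U t) * W t + superpose G (U t)),
      ae_restrict_mem measurableSet_Ioo] with x h1 h2
    rw [h1, hW t (Ioo_subset_Icc_self h2)]
    rfl
  · rw [hr0]
    exact Sobolev.ext_ev zero_lt_one fun x hx => by
      rw [Sobolev.ev_const 0 (Ioo_subset_Icc_self hx),
        Sobolev.ev_zero zero_lt_one (Ioo_subset_Icc_self hx)]

namespace Sobolev

variable {α β : ℝ}

/-- The embedding of `H²` into `H¹`. -/
def toH1 (b : Sobolev 2 α β) : Sobolev 1 α β := mk (b.1 0) (b.1 1) (b.2 0)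

theorem ev_toH1 (hαβ : α < β) (b : Sobolev 2 α β) : EqOn b.ev b.toH1.ev (Icc α β) :=
  ev_eqOn hαβ (b.toH1.continuousOn_ev hαβ) (b.toH1.toL2_ae_eq_ev hαβ)

theorem ev_add_two (hαβ : α < β) (b c : Sobolev 2 α β) {x : ℝ} (hx : x ∈ Icc α β) :
    (b + c).ev x = b.ev x + c.ev x := by
  rw [ev_toH1 hαβ _ hx, ev_toH1 hαβ _ hx, ev_toH1 hαβ _ hx, ← ev_add hαβ _ _ hx]
  rfl

theorem ev_sub_two (hαβ : α < β) (b c : Sobolev 2 α β) {x : ℝ} (hx : x ∈ Icc α β) :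
    (b - c).ev x = b.ev x - c.ev x := by
  rw [ev_toH1 hαβ _ hx, ev_toH1 hαβ _ hx, ev_toH1 hαβ _ hx, ← ev_sub hαβ _ _ hx]
  rfl

theorem ev_smul_two (hαβ : α < β) (c : ℝ) (b : Sobolev 2 α β) {x : ℝ} (hx : x ∈ Icc α β) :
    (c • b).ev x = c * b.ev x := by
  rw [ev_toH1 hαβ _ hx, ev_toH1 hαβ _ hx, ← ev_smul hαβ _ _ hx]
  rfl

end Sobolev

/-! ### The sensitivity system -/

namespace PipeData

variable {D : PipeData} {a a' : ℝ → ℝ} {p u p' u' r w r₁ w₁ r₂ w₂ : ℝ → Sobolev 1 0 1}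
  {b b₁ b₂ : D.H2}

theorem IsDampingLaw.eqOn_deriv (hD : D.Admissible) (ha : D.IsDampingLaw a)
    (ha' : D.IsDampingLaw a') (h : EqOn a a' (Icc D.lo D.hi)) :
    EqOn (deriv a) (deriv a') (Icc D.lo D.hi) := by
  intro y hy
  have hu := uniqueDiffOn_Icc hD.lo_lt_hi y hy
  rw [← (ha.hasDerivAt y).hasDerivWithinAt.derivWithin hu,
    ← (ha'.hasDerivAt y).hasDerivWithinAt.derivWithin hu]
  exact derivWithin_congr h (h hy)

theorem IsState.hasDerivWithinAt_toBCF (hD : D.Admissible) (h : D.IsState a p u) :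
    ∃ Y : ℝ → L2 0 1, ContinuousOn Y (Icc 0 D.T) ∧ ∀ t ∈ Icc 0 D.T,
      HasDerivWithinAt (fun s => (L2.ofBCF (u s).toBCF : L2 0 1)) (Y t) (Icc 0 D.T) t := by
  obtain ⟨f, hw, -⟩ := h.1.exists_isWave hD.T_pos
  refine ⟨_, ((Sobolev.continuous_dx.comp_continuousOn hw.continuousOn_p).neg.sub
    hw.continuousOn_f), fun t ht => ?_⟩
  simp only [Sobolev.ofBCF_toBCF]
  exact hw.deriv_u t ht

/-- Only values of `b` on `[lo, hi]` enter, so `b` may be replaced by a `C¹` extension to the line;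
this is where `b ∈ H²` is used. -/
theorem IsState.exists_isSensitivity (hD : D.Admissible) (ha : D.IsDampingLaw a)
    (h : D.IsState a p u) (b : D.H2) : ∃ r w, D.IsSensitivity a u b r w := by
  obtain ⟨Y, hY, hd⟩ := h.hasDerivWithinAt_toBCF hD
  obtain ⟨G, g, hG, hbG, -⟩ := b.exists_extension hD.lo_lt_hi
  obtain ⟨B⟩ := BoundaryLift.nonempty (0 : L2 0 D.T) 0
  obtain ⟨f, r, w, hw, hf, hb, hr0, hw0⟩ := B.exists_isWave_linear hD.T_pos.le
    (Sobolev.continuousOn_toBCF h.1.continuousOn_u) hY hd (K := ha.derivC) (k := ha.deriv2C)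
    ha.hasDerivAt_deriv hG
  have hz : ∀ t, L2.prim (0 : L2 0 D.T) t = 0 := fun t => by
    simpa using L2.prim_smul 0 (0 : L2 0 D.T) t
  refine ⟨r, w, hw.isClassicalSolution hD.T_pos (fun t ht => ?_)
    (fun t ht => (hb t ht).1.trans (hz t)) (fun t ht => (hb t ht).2.trans (hz t)), hr0, hw0⟩
  filter_upwards [hf t, ae_restrict_mem measurableSet_Ioo] with x h1 h2
  have hx := Ioo_subset_Icc_self h2
  rw [h1, (u t).toBCF_eqOn hx, hbG (hD.velocity_mem a ha p u h t ht x hx)]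
  rfl

namespace IsSensitivity

theorem congr (hD : D.Admissible) (h : D.IsSensitivity a u b r w) (ha : D.IsDampingLaw a)
    (hu : D.IsState a p u) (he : EqOn (deriv a) (deriv a') (Icc D.lo D.hi))
    (heu : EqOn u u' (Icc 0 D.T)) : D.IsSensitivity a' u' b r w := by
  refine ⟨{ h.1 with momentum := fun t ht => ?_ }, h.2⟩
  filter_upwards [h.1.momentum t ht, ae_restrict_mem measurableSet_Ioo] with x hx hm
  rwa [← heu ht, ← he (hD.velocity_mem a ha p u hu t ht x (Ioo_subset_Icc_self hm))]

theorem add (hD : D.Admissible) (ha : D.IsDampingLaw a) (hu : D.IsState a p u)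
    (h₁ : D.IsSensitivity a u b₁ r₁ w₁) (h₂ : D.IsSensitivity a u b₂ r₂ w₂) :
    D.IsSensitivity a u (b₁ + b₂) (r₁ + r₂) (w₁ + w₂) := by
  obtain ⟨f₁, k₁, e₁⟩ := h₁.1.exists_isWave hD.T_pos
  obtain ⟨f₂, k₂, e₂⟩ := h₂.1.exists_isWave hD.T_pos
  refine ⟨(k₁.add k₂).isClassicalSolution hD.T_pos (fun t ht => ?_) (fun t ht => ?_)
    (fun t ht => ?_), by simp [h₁.2.1, h₂.2.1], by simp [h₁.2.2, h₂.2.2]⟩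
  · filter_upwards [e₁ t ht, e₂ t ht, Lp.coeFn_add (f₁ t) (f₂ t),
      ae_restrict_mem measurableSet_Ioo] with x i₁ i₂ i₃ i₄
    have hx := Ioo_subset_Icc_self i₄
    rw [Pi.add_apply, i₃, Pi.add_apply, i₁, i₂, Pi.add_apply, Sobolev.ev_add zero_lt_one _ _ hx,
      Sobolev.ev_add_two hD.lo_lt_hi _ _ (hD.velocity_mem a ha p u hu t ht x hx)]
    ring
  · rw [Pi.add_apply, Sobolev.ev_add zero_lt_one _ _ (by simp), h₁.1.left t ht, h₂.1.left t ht]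
    simp
  · rw [Pi.add_apply, Sobolev.ev_add zero_lt_one _ _ (by simp), h₁.1.right t ht, h₂.1.right t ht]
    simp

theorem smul (hD : D.Admissible) (ha : D.IsDampingLaw a) (hu : D.IsState a p u) (c : ℝ)
    (h : D.IsSensitivity a u b r w) : D.IsSensitivity a u (c • b) (c • r) (c • w) := by
  obtain ⟨f, k, e⟩ := h.1.exists_isWave hD.T_pos
  refine ⟨(k.smul c).isClassicalSolution hD.T_pos (fun t ht => ?_) (fun t ht => ?_)
    (fun t ht => ?_), by simp [h.2.1], by simp [h.2.2]⟩
  · filter_upwards [e t ht, Lp.coeFn_smul c (f t), ae_restrict_mem measurableSet_Ioo]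
      with x i₁ i₂ i₃
    have hx := Ioo_subset_Icc_self i₃
    rw [Pi.smul_apply, i₂, Pi.smul_apply, i₁, Pi.smul_apply, Sobolev.ev_smul zero_lt_one _ _ hx,
      Sobolev.ev_smul_two hD.lo_lt_hi _ _ (hD.velocity_mem a ha p u hu t ht x hx), smul_eq_mul]
    ring
  · rw [Pi.smul_apply, Sobolev.ev_smul zero_lt_one _ _ (by simp), h.1.left t ht]
    simp
  · rw [Pi.smul_apply, Sobolev.ev_smul zero_lt_one _ _ (by simp), h.1.right t ht]
    simp

theorem eqOn (hD : D.Admissible) (ha : D.IsDampingLaw a) (h₁ : D.IsSensitivity a u b r₁ w₁)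
    (h₂ : D.IsSensitivity a u b r₂ w₂) : EqOn r₁ r₂ (Icc 0 D.T) := by
  obtain ⟨f₁, k₁, e₁⟩ := h₁.1.exists_isWave hD.T_pos
  obtain ⟨f₂, k₂, e₂⟩ := h₂.1.exists_isWave hD.T_pos
  refine (k₁.eqOn_of_norm_sub_le hD.T_pos hD.a₁_pos.le k₂ (h₁.2.1.trans h₂.2.1.symm)
    (h₁.2.2.trans h₂.2.2.symm) (fun t ht => (h₁.1.left t ht).trans (h₂.1.left t ht).symm)
    (fun t ht => (h₁.1.right t ht).trans (h₂.1.right t ht).symm) fun t ht => ?_).1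
  refine Lp.norm_le_mul_norm_of_ae_le_mul ?_
  filter_upwards [e₁ t ht, e₂ t ht, Lp.coeFn_sub (f₁ t) (f₂ t),
    Lp.coeFn_sub (w₁ t).toL2 (w₂ t).toL2, (w₁ t).toL2_ae_eq_ev zero_lt_one,
    (w₂ t).toL2_ae_eq_ev zero_lt_one] with x h1 h2 h3 h4 h5 h6
  rw [h3, h4, Pi.sub_apply, Pi.sub_apply, h1, h2, h5, h6, add_sub_add_right_eq_sub, ← mul_sub,
    norm_mul]
  gcongr
  exact ha.abs_deriv_le hD _

end IsSensitivity

theorem abs_ev_le_norm (hD : D.Admissible) (b : D.H2) {y : ℝ} (hy : y ∈ Icc D.lo D.hi) :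
    |b.ev y| ≤ Sobolev.embConst D.lo D.hi * ‖b‖ := by
  obtain ⟨G, g, -, hbG, -, hb⟩ := b.exists_extension hD.lo_lt_hi
  rw [hbG hy]
  exact hb y hy

theorem abs_ev_sub_ev_le (hD : D.Admissible) (b : D.H2) {x y : ℝ} (hx : x ∈ Icc D.lo D.hi)
    (hy : y ∈ Icc D.lo D.hi) :
    |b.ev y - b.ev x| ≤ Sobolev.embConst D.lo D.hi * ‖b‖ * |y - x| := by
  obtain ⟨G, g, hG, hbG, hb, -⟩ := b.exists_extension hD.lo_lt_hi
  rw [hbG hx, hbG hy]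
  exact convex_univ.norm_image_sub_le_of_norm_hasDerivWithin_le
    (fun z _ => (hG z).hasDerivWithinAt) (fun z _ => hb z) (mem_univ _) (mem_univ _)

/-- The part of the source not controlled by `w` is `b(u)`. The Sobolev embedding bounds it because
`u` stays in `[lo, hi]`, and the trace estimate then bounds the pressure drop, which makes the
sensitivity operator continuous. -/
theorem IsSensitivity.norm_drop_le (hD : D.Admissible) : ∃ C : ℝ, 0 ≤ C ∧ ∀ {a p u b r w},
    D.IsDampingLaw a → D.IsState a p u → D.IsSensitivity a u b r w → ∀ y : L2 0 D.T, IsPressureDrop r y →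
      ‖y‖ ≤ C * ‖b‖ := by
  obtain ⟨C, hC0, hC⟩ := IsWave.exists_bound hD.T_pos hD.a₁_pos.le
  have hE := Sobolev.embConst_nonneg D.lo D.hi
  refine ⟨C * Sobolev.embConst D.lo D.hi, by positivity, fun {a p u b r w} ha hu h => ?_⟩
  obtain ⟨f, k, e⟩ := h.1.exists_isWave hD.T_pos
  rw [mul_assoc]
  refine (hC k (by rw [h.2.1, Sobolev.toL2_zero]) (by rw [h.2.2, Sobolev.toL2_zero]) h.1.left
    h.1.right (by positivity) fun t ht => ?_).2
  refine L2.norm_le_of_ae_abs_le hD.a₁_pos.le (by positivity) ?_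
  filter_upwards [e t ht, (w t).toL2_ae_eq_ev zero_lt_one, ae_restrict_mem measurableSet_Ioo]
    with x h1 h2 h3
  rw [h1, h2]
  refine (abs_add_le _ _).trans (add_le_add ?_
    (abs_ev_le_norm hD b (hD.velocity_mem a ha p u hu t ht x (Ioo_subset_Icc_self h3))))
  rw [abs_mul]
  gcongr
  exact ha.abs_deriv_le hD _

/-- The bounded operator defined by the sensitivity system. -/
theorem IsState.exists_linear (hD : D.Admissible) (ha : D.IsDampingLaw a) (hu : D.IsState a p u) :
    ∃ L : D.H2 →L[ℝ] L2 0 D.T, ∀ b r w, D.IsSensitivity a u b r w → IsPressureDrop r (L b) := by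
  have hex : ∀ b : D.H2, ∃ y : L2 0 D.T, ∀ r w, D.IsSensitivity a u b r w → IsPressureDrop r y := by
    intro b
    obtain ⟨r, w, h⟩ := hu.exists_isSensitivity hD ha b
    obtain ⟨y, hy⟩ := exists_isPressureDrop h.1.continuousOn_p
    exact ⟨y, fun r' w' h' => hy.congr (h.eqOn hD ha h')⟩
  choose L hL using hex
  obtain ⟨C, -, hC⟩ := IsSensitivity.norm_drop_le hD
  refine ⟨LinearMap.mkContinuous
    { toFun := L
      map_add' := fun b₁ b₂ => ?_
      map_smul' := fun c b => ?_ } C fun b => ?_, fun b => hL b⟩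
  · obtain ⟨r₁, w₁, h₁⟩ := hu.exists_isSensitivity hD ha b₁
    obtain ⟨r₂, w₂, h₂⟩ := hu.exists_isSensitivity hD ha b₂
    exact (hL _ _ _ (h₁.add hD ha hu h₂)).unique ((hL _ _ _ h₁).add (hL _ _ _ h₂))
  · obtain ⟨r, w, h⟩ := hu.exists_isSensitivity hD ha b
    exact (hL _ _ _ (h.smul hD ha hu c)).unique ((hL _ _ _ h).smul c)
  · obtain ⟨r, w, h⟩ := hu.exists_isSensitivity hD ha b
    exact hC ha hu h _ (hL _ _ _ h)

end PipeData

/-! ### Differentiability of the forward operator -/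

theorem L2.norm_le_of_ae_abs_le_add {f g h : L2 0 1} {K M : ℝ} (hK : 0 ≤ K) (hM : 0 ≤ M)
    (hf : ∀ᵐ x ∂(volume.restrict (Ioo (0 : ℝ) 1)), |f x| ≤ K * |g x| + M * |h x|) :
    ‖f‖ ≤ K * ‖g‖ + M * ‖h‖ := by
  have h1 : ‖f‖ ≤ ‖K • |g| + M • |h|‖ := by
    refine Lp.norm_le_norm_of_ae_le ?_
    filter_upwards [hf, Lp.coeFn_add (K • |g|) (M • |h|), Lp.coeFn_smul K |g|, Lp.coeFn_abs g,
      Lp.coeFn_smul M |h|, Lp.coeFn_abs h] with x a1 a2 a3 a4 a5 a6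
    rw [a2, Pi.add_apply, a3, Pi.smul_apply, a4, a5, Pi.smul_apply, a6]
    exact a1.trans (le_abs_self _)
  refine (h1.trans (norm_add_le _ _)).trans_eq ?_
  rw [norm_smul, norm_smul, norm_abs_eq_norm, norm_abs_eq_norm, Real.norm_of_nonneg hK,
    Real.norm_of_nonneg hM]

namespace PipeData

variable {D : PipeData}

theorem IsRestriction.sub_eq (hD : D.Admissible) {a a' : ℝ → ℝ} {A A' : D.H2}
    (hA : D.IsRestriction a A) (hA' : D.IsRestriction a' A') {y : ℝ} (hy : y ∈ Icc D.lo D.hi) :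
    a' y = a y + (A' - A).ev y := by
  rw [Sobolev.ev_sub_two hD.lo_lt_hi _ _ hy, hA hy, hA' hy]
  ring

/-- Lipschitz dependence of the velocity on the damping law. -/
theorem IsState.norm_sub_le (hD : D.Admissible) : ∃ C : ℝ, 0 ≤ C ∧ ∀ {a a' : ℝ → ℝ} {A A' : D.H2}
    {p u p' u' : ℝ → Sobolev 1 0 1}, D.IsDampingLaw a → D.IsRestriction a A → D.IsState a p u →
      D.IsDampingLaw a' → D.IsRestriction a' A' → D.IsState a' p' u' → ∀ t ∈ Icc 0 D.T,
        ‖(u' t).toL2 - (u t).toL2‖ ≤ C * ‖A' - A‖ := by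
  obtain ⟨C, hC0, hC⟩ := IsWave.exists_bound hD.T_pos hD.a₁_pos.le
  have hE := Sobolev.embConst_nonneg D.lo D.hi
  refine ⟨C * Sobolev.embConst D.lo D.hi, by positivity,
    fun {a a' A A' p u p' u'} ha hA h ha' hA' h' t ht => ?_⟩
  obtain ⟨f, k, e⟩ := h.1.exists_isWave hD.T_pos
  obtain ⟨f', k', e'⟩ := h'.1.exists_isWave hD.T_pos
  rw [mul_assoc]
  refine ((hC (k'.sub k) (by simp [h.p_init, h'.p_init]) (by simp [h.u_init, h'.u_init])
    (fun t ht => ?_) (fun t ht => ?_) (ε := Sobolev.embConst D.lo D.hi * ‖A' - A‖) (by positivity)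
    fun t ht => ?_).1 t ht).2
  · rw [Pi.sub_apply, Sobolev.ev_sub zero_lt_one _ _ (by simp), h.1.left t ht, h'.1.left t ht,
      sub_self]
  · rw [Pi.sub_apply, Sobolev.ev_sub zero_lt_one _ _ (by simp), h.1.right t ht, h'.1.right t ht,
      sub_self]
  · refine L2.norm_le_of_ae_abs_le hD.a₁_pos.le (by positivity) ?_
    rw [Pi.sub_apply, Pi.sub_apply, Sobolev.toL2_sub]
    filter_upwards [e t ht, e' t ht, Lp.coeFn_sub (f' t) (f t),
      Lp.coeFn_sub (u' t).toL2 (u t).toL2, (u t).toL2_ae_eq_ev zero_lt_one,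
      (u' t).toL2_ae_eq_ev zero_lt_one, ae_restrict_mem measurableSet_Ioo]
      with x h1 h2 h3 h4 h5 h6 h7
    have hx := Ioo_subset_Icc_self h7
    have hm := hD.velocity_mem a' ha' p' u' h' t ht x hx
    -- The source difference splits into `a(u') - a(u)`, controlled by `u' - u`, and the
    -- perturbation `A' - A` evaluated at `u'`.
    rw [h3, h4, Pi.sub_apply, Pi.sub_apply, h1, h2, h5, h6, hA.sub_eq hD hA' hm, add_sub_right_comm]
    exact (abs_add_le _ _).trans (add_le_add (ha.abs_sub_le hD _ _) (abs_ev_le_norm hD _ hm))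

/-- With `b = A' - A`, the pair `(p' - p - r, u' - u - w)` solves the wave system with source `a'(u)
(u' - u - w)`, where `a'` is the derivative of `a`, plus the Taylor remainder of `a` and `b(u') -
b(u)`. The last two are at most `(a₂ |u' - u| + E ‖b‖) |u' - u|`. One factor `|u' - u|` is estimated
in the supremum norm by `√‖b‖`, the other in `L²` by `‖b‖`, each up to a constant, and
`IsWave.exists_bound` transfers the result to the pressure drop. -/
theorem forward_remainder_le (hD : D.Admissible) : ∃ M : ℝ, 0 ≤ M ∧ ∀ {a a' : ℝ → ℝ} {A A' : D.H2}
    {p u r w : ℝ → Sobolev 1 0 1} {y : L2 0 D.T}, D.IsDampingLaw a → D.IsRestriction a A →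
      D.IsState a p u → D.IsDampingLaw a' → D.IsRestriction a' A' →
      D.IsSensitivity a u (A' - A) r w → IsPressureDrop r y →
        ‖D.forward A' - D.forward A - y‖ ≤ M * (√‖A' - A‖ + ‖A' - A‖) * ‖A' - A‖ := by
  obtain ⟨R₀, hR₀⟩ := hD.exists_isState
  obtain ⟨C₁, hC₁0, hC₁⟩ := IsState.norm_sub_le hD
  obtain ⟨C, hC0, hC⟩ := IsWave.exists_bound hD.T_pos hD.a₁_pos.le
  have hE := Sobolev.embConst_nonneg D.lo D.hi
  set E := Sobolev.embConst D.lo D.hi with hEdef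
  have ha₂ := hD.a₂_pos.le
  set R := max R₀ 0 with hRdef
  have hR0 : 0 ≤ R := le_max_right _ _
  -- From `Sobolev.sq_ev_le` with `‖u' - u‖ ≤ C₁ ‖b‖` and `‖∂ₓ (u' - u)‖ ≤ 2 R`.
  set S := √(4 * R * C₁) with hS
  have hS0 : 0 ≤ S := Real.sqrt_nonneg _
  refine ⟨C * ((D.a₂ * S + E) * C₁), by positivity,
    fun {a a' A A' p u r w y} ha hA h ha' hA' hs hy => ?_⟩
  obtain ⟨p', u', h', hdx'⟩ := hR₀ a' ha'
  obtain ⟨p₀, u₀, h₀, hdx₀⟩ := hR₀ a ha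
  have hdx : ∀ t ∈ Icc 0 D.T, ‖(u t).dx‖ ≤ R₀ := fun t ht => by
    rw [(h.eqOn hD ha h₀).2 ht]
    exact hdx₀ t ht
  set b := A' - A with hb
  have hu := hC₁ ha hA h ha' hA' h'
  have hsup : ∀ t ∈ Icc 0 D.T, ∀ x ∈ Icc (0 : ℝ) 1, |(u' t).ev x - (u t).ev x| ≤ S * √‖b‖ := by
    intro t ht x hx
    have h0 : (u' t - u t).ev 0 = 0 := by
      rw [Sobolev.ev_sub zero_lt_one _ _ (by simp), h.1.left t ht, h'.1.left t ht, sub_self]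
    have h1 := Sobolev.sq_ev_le h0 hx
    rw [Sobolev.toL2_sub, Sobolev.dx_sub] at h1
    have h2 : ‖(u' t).dx - (u t).dx‖ ≤ 2 * R := (norm_sub_le _ _).trans
      (by linarith [hdx t ht, hdx' t ht, le_max_left R₀ 0])
    rw [← Sobolev.ev_sub zero_lt_one _ _ hx, hS, ← Real.sqrt_mul (by positivity)]
    refine Real.abs_le_sqrt (h1.trans ?_)
    calc 2 * ‖(u' t).toL2 - (u t).toL2‖ * ‖(u' t).dx - (u t).dx‖
        ≤ 2 * (C₁ * ‖b‖) * (2 * R) := by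
          gcongr
          exact hu t ht
      _ = 4 * R * C₁ * ‖b‖ := by ring
  obtain ⟨f, k, e⟩ := h.1.exists_isWave hD.T_pos
  obtain ⟨f', k', e'⟩ := h'.1.exists_isWave hD.T_pos
  obtain ⟨g, j, i⟩ := hs.1.exists_isWave hD.T_pos
  set m := D.a₂ * (S * √‖b‖) + E * ‖b‖ with hm
  have hm0 : 0 ≤ m := by positivity
  have key := (hC ((k'.sub k).sub j) (by simp [h.p_init, h'.p_init, hs.2.1])
    (by simp [h.u_init, h'.u_init, hs.2.2]) (fun t ht => ?_) (fun t ht => ?_)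
    (ε := m * (C₁ * ‖b‖)) (by positivity) fun t ht => ?_).2 _
    (((h'.isPressureDrop_forward hD ha' hA').sub (h.isPressureDrop_forward hD ha hA)).sub hy)
  · refine key.trans ?_
    have e1 : m ≤ (D.a₂ * S + E) * (√‖b‖ + ‖b‖) := by
      have : 0 ≤ D.a₂ * S * ‖b‖ + E * √‖b‖ := by positivity
      rw [hm]
      linarith
    calc C * (m * (C₁ * ‖b‖)) ≤ C * (((D.a₂ * S + E) * (√‖b‖ + ‖b‖)) * (C₁ * ‖b‖)) := by gcongr
      _ = _ := by ring
  · rw [Pi.sub_apply, Pi.sub_apply, Sobolev.ev_sub zero_lt_one _ _ (by simp),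
      Sobolev.ev_sub zero_lt_one _ _ (by simp), h.1.left t ht, h'.1.left t ht, hs.1.left t ht]
    simp
  · rw [Pi.sub_apply, Pi.sub_apply, Sobolev.ev_sub zero_lt_one _ _ (by simp),
      Sobolev.ev_sub zero_lt_one _ _ (by simp), h.1.right t ht, h'.1.right t ht, hs.1.right t ht]
    simp
  · rw [Pi.sub_apply, Pi.sub_apply, Pi.sub_apply, Pi.sub_apply, Sobolev.toL2_sub, Sobolev.toL2_sub]
    refine (L2.norm_le_of_ae_abs_le_add (h := (u' t).toL2 - (u t).toL2) hD.a₁_pos.le hm0 ?_).trans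
      (add_le_add le_rfl (mul_le_mul_of_nonneg_left (hu t ht) hm0))
    filter_upwards [e t ht, e' t ht, i t ht, Lp.coeFn_sub (f' t - f t) (g t),
      Lp.coeFn_sub (f' t) (f t), Lp.coeFn_sub ((u' t).toL2 - (u t).toL2) (w t).toL2,
      Lp.coeFn_sub (u' t).toL2 (u t).toL2, (u t).toL2_ae_eq_ev zero_lt_one,
      (u' t).toL2_ae_eq_ev zero_lt_one, (w t).toL2_ae_eq_ev zero_lt_one,
      ae_restrict_mem measurableSet_Ioo] with x h1 h2 h3 h4 h5 h6 h7 h8 h9 h10 h11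
    have hx := Ioo_subset_Icc_self h11
    have hmem := hD.velocity_mem a ha p u h t ht x hx
    have hmem' := hD.velocity_mem a' ha' p' u' h' t ht x hx
    rw [h4, h6, Pi.sub_apply, Pi.sub_apply, h5, h7, Pi.sub_apply, Pi.sub_apply, h1, h2, h3, h8, h9,
      h10, hA.sub_eq hD hA' hmem', ← hb]
    have q1 := ha.abs_taylor_le hD ((u t).ev x) ((u' t).ev x)
    have q2 := abs_ev_sub_ev_le hD b hmem hmem'
    have q3 := hsup t ht x hx
    generalize (u t).ev x = U at *
    generalize (u' t).ev x = U' at *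
    generalize (w t).ev x = W at *
    have q4 : |deriv a U * (U' - U - W)| ≤ D.a₁ * |U' - U - W| := by
      rw [abs_mul]
      gcongr
      exact ha.abs_deriv_le hD _
    have q5 : D.a₂ * |U' - U| * |U' - U| ≤ D.a₂ * (S * √‖b‖) * |U' - U| := by gcongr
    have e1 : a U' + b.ev U' - a U - (deriv a U * W + b.ev U)
        = deriv a U * (U' - U - W) + (a U' - a U - deriv a U * (U' - U)) + (b.ev U' - b.ev U) := by
      ring
    rw [e1, hm]
    refine (abs_add_three _ _ _).trans ?_
    linarith

/-- The operator built from one law and one state serves every other law with the same restriction: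
`A` determines the state on `[0, T]` and the derivative of the law on `[lo, hi]`, and the
sensitivity system uses nothing else. -/
theorem IsState.exists_isForwardDeriv (hD : D.Admissible) {a : ℝ → ℝ} {A : D.H2}
    {p u : ℝ → Sobolev 1 0 1} (ha : D.IsDampingLaw a) (hA : D.IsRestriction a A)
    (h : D.IsState a p u) : ∃ L, D.IsForwardDeriv A L := by
  obtain ⟨L, hL⟩ := h.exists_linear hD ha
  refine ⟨L, ?_, fun a' ha' hA' p' u' h' b => ⟨h'.exists_isSensitivity hD ha' b, fun r w hs => ?_⟩⟩
  · obtain ⟨M, hM0, hM⟩ := forward_remainder_le hD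
    rw [hasFDerivWithinAt_iff_isLittleO, Asymptotics.isLittleO_iff]
    intro ε hε
    have ht : Tendsto (fun A' => M * (√‖A' - A‖ + ‖A' - A‖)) (𝓝[D.forwardDomain] A) (𝓝 0) := by
      have hc : Continuous fun A' : D.H2 => M * (√‖A' - A‖ + ‖A' - A‖) := by fun_prop
      have := hc.tendsto A
      simp only [sub_self, norm_zero, Real.sqrt_zero, add_zero, mul_zero] at this
      exact this.mono_left nhdsWithin_le_nhds
    filter_upwards [ht.eventually_le_const hε, self_mem_nhdsWithin] with A' h1 h2
    obtain ⟨a', ha', hA'⟩ := h2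
    obtain ⟨r, w, hs⟩ := h.exists_isSensitivity hD ha (A' - A)
    exact (hM ha hA h ha' hA' hs (hL _ _ _ hs)).trans
      (mul_le_mul_of_nonneg_right h1 (norm_nonneg _))
  · refine hL b r w (hs.congr hD ha' h' (ha'.eqOn_deriv hD ha ?_)
      (h'.eqOn_of_isRestriction hD ha' hA' ha hA h).2)
    exact fun y hy => (hA' hy).symm.trans (hA hy)

end PipeData

/-! ### The adjoint system -/

theorem mapsTo_reverse (T : ℝ) : MapsTo (fun t => T - t) (Icc 0 T) (Icc 0 T) :=
  fun _ ht => ⟨by linarith [ht.2], by linarith [ht.1]⟩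

theorem hasDerivWithinAt_reverse {E : Type*} [NormedAddCommGroup E] [NormedSpace ℝ E] {T t : ℝ}
    {F : ℝ → E} {F' : E} (h : HasDerivWithinAt F F' (Icc 0 T) (T - t)) :
    HasDerivWithinAt (fun s => F (T - s)) (-F') (Icc 0 T) t := by
  have h1 : HasDerivWithinAt (fun s : ℝ => T - s) (-1) (Icc 0 T) t :=
    ((hasDerivAt_id t).const_sub T).hasDerivWithinAt
  have := h.scomp t h1 (mapsTo_reverse T)
  rwa [neg_one_smul] at this

/-- Time reversal. -/
theorem IsWave.reverse {T : ℝ} {f : ℝ → L2 0 1} {p u : ℝ → Sobolev 1 0 1} (h : IsWave T f p u) :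
    IsWave T (fun t => -f (T - t)) (fun t => -p (T - t)) (fun t => u (T - t)) := by
  -- Changing the sign of the pressure preserves the form of both equations; the source changes
  -- sign, which exchanges damping and amplification.
  have hr : ContinuousOn (fun t : ℝ => T - t) (Icc 0 T) := by fun_prop
  refine ⟨(h.continuousOn_p.comp hr (mapsTo_reverse T)).neg,
    h.continuousOn_u.comp hr (mapsTo_reverse T), (h.continuousOn_f.comp hr (mapsTo_reverse T)).neg,
    fun t ht => ?_, fun t ht => ?_⟩
  · refine (hasDerivWithinAt_reverse (h.deriv_p _ (mapsTo_reverse T ht))).neg.congr_deriv ?_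
    rw [neg_neg]
  · refine (hasDerivWithinAt_reverse (h.deriv_u _ (mapsTo_reverse T ht))).congr_deriv ?_
    rw [Sobolev.dx_neg]
    abel

namespace PipeData

variable {D : PipeData} {a : ℝ → ℝ} {p u r w q v : ℝ → Sobolev 1 0 1} {ψ : Sobolev 1 0 D.T}
  {b : D.H2}

/-- Time reversal turns the terminal value problem into a damped system that starts at rest, with
coefficient taken along `u(T - t)` and boundary value `ψ(T - t)`. -/
theorem IsState.exists_isAdjointState (hD : D.Admissible) (ha : D.IsDampingLaw a)
    (h : D.IsState a p u) (hψ : ψ.ev D.T = 0) : ∃ q v, D.IsAdjointState a u ψ q v := by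
  obtain ⟨Y, hY, hd⟩ := h.hasDerivWithinAt_toBCF hD
  obtain ⟨ρ, hρ⟩ := L2.exists_prim_reverse hD.T_pos ψ hψ
  obtain ⟨B⟩ := BoundaryLift.nonempty ρ ρ
  have hr : ContinuousOn (fun t : ℝ => D.T - t) (Icc 0 D.T) := by fun_prop
  have hm := mapsTo_reverse D.T
  obtain ⟨f, q, v, hw, hf, hb, hq0, hv0⟩ := B.exists_isWave_linear hD.T_pos.le
    ((Sobolev.continuousOn_toBCF h.1.continuousOn_u).comp hr hm) (hY.comp hr hm).neg
    (fun t ht => hasDerivWithinAt_reverse (hd _ (hm ht))) (K := ha.derivC) (k := ha.deriv2C)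
    (G := 0) (g := 0) ha.hasDerivAt_deriv fun y => hasDerivAt_const y 0
  have hb' : ∀ t ∈ Icc 0 D.T, L2.prim ρ (D.T - t) = ψ.ev t := fun t ht => by
    rw [hρ (hm ht)]
    simp
  refine ⟨_, _, hw.reverse.isClassicalSolution hD.T_pos (fun t ht => ?_)
    (fun t ht => (hb _ (hm ht)).1.trans (hb' t ht)) (fun t ht => (hb _ (hm ht)).2.trans (hb' t ht)),
    by simp [hq0], by simp [hv0]⟩
  filter_upwards [hf (D.T - t), Lp.coeFn_neg (f (D.T - t)), ae_restrict_mem measurableSet_Ioo]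
    with x h1 h2 h3
  have hx := Ioo_subset_Icc_self h3
  rw [h2, Pi.neg_apply, h1]
  simp only [Function.comp_apply, sub_sub_cancel]
  rw [(u t).toBCF_eqOn hx, ContinuousMap.zero_apply, add_zero]
  rfl

/-- Duality between the sensitivity system and the adjoint system. -/
theorem IsAdjointState.inner_eq (hD : D.Admissible)
    (h : D.IsAdjointState a u ψ q v) (hs : D.IsSensitivity a u b r w) {y : L2 0 D.T}
    (hy : IsPressureDrop r y) :
    inner ℝ ψ.toL2 y = ∫ t in (0 : ℝ)..D.T, ∫ x in (0 : ℝ)..1, b.ev ((u t).ev x) * (v t).ev x := by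
  obtain ⟨f, k, e⟩ := hs.1.exists_isWave hD.T_pos
  obtain ⟨g, j, i⟩ := h.1.exists_isWave hD.T_pos
  have hT := hD.T_pos.le
  -- The terms `a'(u) w v` cancel; the sign of the damping in the adjoint system is made for this.
  have hp : ∀ t ∈ Icc 0 D.T, inner ℝ (f t) (v t).toL2 + inner ℝ (w t).toL2 (g t)
      = ∫ x in (0 : ℝ)..1, b.ev ((u t).ev x) * (v t).ev x := by
    intro t ht
    have i₁ : IntegrableOn (fun x => f t x * (v t).toL2 x) (Ioo 0 1) :=
      (Lp.memLp (f t)).integrable_mul (Lp.memLp (v t).toL2)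
    have i₂ : IntegrableOn (fun x => (w t).toL2 x * g t x) (Ioo 0 1) :=
      (Lp.memLp (w t).toL2).integrable_mul (Lp.memLp (g t))
    rw [← L2.integral_Ioo_mul, ← L2.integral_Ioo_mul, ← integral_add i₁ i₂, intervalIntegral.integral_of_le zero_le_one, integral_Ioc_eq_integral_Ioo]
    refine integral_congr_ae ?_
    filter_upwards [e t ht, i t ht, (v t).toL2_ae_eq_ev zero_lt_one,
      (w t).toL2_ae_eq_ev zero_lt_one] with x h1 h2 h3 h4
    rw [h1, h2, h3, h4]
    ring
  have hpair : ∀ t ∈ Icc 0 D.T, HasDerivWithinAt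
      (fun s => inner ℝ (r s).toL2 (q s).toL2 + inner ℝ (w s).toL2 (v s).toL2)
      (ψ.ev t * ((r t).ev 0 - (r t).ev 1)
        - (inner ℝ (f t) (v t).toL2 + inner ℝ (w t).toL2 (g t))) (Icc 0 D.T) t := by
    intro t ht
    -- Since `w = 0` at both ends the traces of `q` drop out, and the common value `v = ψ` collects
    -- the pressure drop of `r`.
    refine (k.hasDerivWithinAt_pairing j ht).congr_deriv ?_
    rw [hs.1.left t ht, hs.1.right t ht, h.1.left t ht, h.1.right t ht]
    simp only [Pi.zero_apply]
    ring
  have c₁ : ContinuousOn (fun t => ψ.ev t * ((r t).ev 0 - (r t).ev 1)) (Icc 0 D.T) :=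
    (ψ.continuousOn_ev hD.T_pos).mul ((IsWave.continuousOn_ev k.continuousOn_p (by simp)).sub
      (IsWave.continuousOn_ev k.continuousOn_p (by simp)))
  have c₂ : ContinuousOn (fun t => inner ℝ (f t) (v t).toL2 + inner ℝ (w t).toL2 (g t))
      (Icc 0 D.T) :=
    (k.continuousOn_f.inner j.continuousOn_toL2_u).add
      (k.continuousOn_toL2_u.inner j.continuousOn_f)
  have key := IsWave.integral_eq_sub hT hpair (c₁.sub c₂)
  -- The pairing vanishes at `T` by the terminal condition on `(q, v)` and at 0 by the initial
  -- condition on `(r, w)`.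
  rw [h.2.1, h.2.2, hs.2.1, hs.2.2] at key
  simp only [Sobolev.toL2_zero, inner_zero_left, inner_zero_right, add_zero, sub_zero] at key
  rw [intervalIntegral.integral_sub ((uIcc_of_le hT ▸ c₁).intervalIntegrable)
    ((uIcc_of_le hT ▸ c₂).intervalIntegrable), sub_eq_zero] at key
  have e₁ : inner ℝ ψ.toL2 y = ∫ t in (0 : ℝ)..D.T, ψ.ev t * ((r t).ev 0 - (r t).ev 1) := by
    rw [← L2.integral_Ioo_mul, intervalIntegral.integral_of_le hT, integral_Ioc_eq_integral_Ioo]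
    refine integral_congr_ae ?_
    filter_upwards [hy, ψ.toL2_ae_eq_ev hD.T_pos] with t h1 h2
    rw [h1, h2]
  rw [e₁, key]
  refine intervalIntegral.integral_congr fun t ht => hp t ?_
  rwa [uIcc_of_le hT] at ht

end PipeData

theorem mainTheorem10 (D : PipeData) (hD : D.Admissible)
    (a : ℝ → ℝ) (ha : D.IsDampingLaw a) (A : D.H2) (hA : D.IsRestriction a A)
    (ψ : Sobolev 1 0 D.T) (hψ : ψ.ev D.T = 0) :
    (∃ p u, D.IsState a p u) ∧
    D.IsForwardDeriv A (D.forwardDeriv A) ∧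
    ∀ p u, D.IsState a p u →
      (∃ q v, D.IsAdjointState a u ψ q v) ∧
      ∀ q v, D.IsAdjointState a u ψ q v →
        ∀ φ : D.H2, φ = ContinuousLinearMap.adjoint (D.forwardDeriv A) ψ.toL2 ↔
          ∀ b : D.H2, inner ℝ φ b =
            ∫ t in (0 : ℝ)..D.T, ∫ x in (0 : ℝ)..1, b.ev ((u t).ev x) * (v t).ev x := by
  obtain ⟨R, hR⟩ := hD.exists_isState
  obtain ⟨p₀, u₀, h₀, -⟩ := hR a ha
  have hL : D.IsForwardDeriv A (D.forwardDeriv A) := by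
    have hex := h₀.exists_isForwardDeriv hD ha hA
    rw [PipeData.forwardDeriv, dif_pos hex]
    exact hex.choose_spec
  refine ⟨⟨p₀, u₀, h₀⟩, hL, fun p u h => ⟨h.exists_isAdjointState hD ha hψ, fun q v hq φ => ?_⟩⟩
  have key : ∀ b : D.H2, inner ℝ (ContinuousLinearMap.adjoint (D.forwardDeriv A) ψ.toL2) b
      = ∫ t in (0 : ℝ)..D.T, ∫ x in (0 : ℝ)..1, b.ev ((u t).ev x) * (v t).ev x := by
    intro b
    -- The sensitivity representation is available in every direction `b`, also in those not tangent
    -- to the domain of `F`; otherwise the adjoint would not be determined on all of `H²`.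
    obtain ⟨⟨r, w, hs⟩, hd⟩ := hL.2 a ha hA p u h b
    rw [ContinuousLinearMap.adjoint_inner_left]
    exact hq.inner_eq hD hs (hd r w hs)
  constructor
  · rintro rfl
    exact key
  · intro hφ
    exact ext_inner_right ℝ fun b => (hφ b).trans (key b).symm
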